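/- Let $k=\mathbb F_q$ be a finite field. For a finite-dimensional $k$-algebra $A$ let $\mathrm{mod}(A)$ be the category of finite-dimensional left $A$-modules, and write $\mathcal P^{\le 1}(A)$ for the class of $K\in\mathrm{mod}(A)$ with $\mathrm{proj.dim}\,K\le 1$. The Ringel–Hall algebra $\mathcal H(A)$ is the $\mathbb Q$-vector space with basis the isoclasses $[M]$ of objects of $\mathrm{mod}(A)$ and with product $$[M]\diamond[N]=\sum_{[L]}\frac{|\mathrm{Ext}^1_A(M,N)_L|}{|\mathrm{Hom}_A(M,N)|}\,[L],$$ where $\mathrm{Ext}^1_A(M,N)_L$ is the set of classes of extensions $0\to N\to L'\to M\to 0$ with $L'\cong L$. Let $I$ be the two-sided ideal of $\mathcal H(A)$ generated by all $[L]-[K\oplus M]$ for which there is a short exact sequence $0\to K\to L\to M\to 0$ with $K\in\mathcal P^{\le 1}(A)$. The modified Ringel–Hall algebra is the localization $\mathcal{MH}(A)=(\mathcal H(A)/I)[\mathcal S_A^{-1}]$ (the universal $\mathcal S_A$-inverting $\mathbb Q$-algebra) at $\mathcal S_A=\{a[K]\mid a\in\mathbb Q^\times,\ K\in\mathcal P^{\le1}(A)\}$.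 For $K\in\mathcal P^{\le1}(A)$ and $M\in\mathrm{mod}(A)$ put $\langle K,M\rangle=\dim_k\mathrm{Hom}_A(K,M)-\dim_k\mathrm{Ext}^1_A(K,M)$. The algebra $A$ is called $1$-Gorenstein if $\mathrm{inj.dim}\,{}_AA\le1$ and $\mathrm{inj.dim}\,A_A\le1$. A module $T\in\mathrm{mod}(A)$ is called tilting if $\mathrm{proj.dim}\,T\le1$, $\mathrm{Ext}^i_A(T,T)=0$ for all $i>0$, and there is a short exact sequence $0\to A\to T_0\to T_1\to0$ with $T_0,T_1\in\mathrm{add}\,T$. Let $\mathrm{Fac}\,T$ be the class of epimorphic images of objects of $\mathrm{add}\,T$. **Theorem.** Let $A$ be a finite-dimensional $1$-Gorenstein $k$-algebra and $T$ a tilting $A$-module such that $\Gamma=\mathrm{End}_A(T)^{op}$ is also $1$-Gorenstein. Put $F=\mathrm{Hom}_A(T,-):\mathrm{mod}(A)\to\mathrm{mod}(\Gamma)$. For every $M\in\mathrm{mod}(A)$ there is a short exact sequence $$0\longrightarrow M\longrightarrow X_M\longrightarrow T_M\longrightarrow0,\qquad X_M\in\mathrm{Fac}\,T,\quad T_M\in\mathrm{add}\,T,$$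 and there is an isomorphism of $\mathbb Q$-algebras $$\Xi:\mathcal{MH}(A)\xrightarrow{\ \simeq\ }\mathcal{MH}(\Gamma)$$ such that, for every $M\in\mathrm{mod}(A)$ and every such short exact sequence, $[F(T_M)]$ is invertible in $\mathcal{MH}(\Gamma)$ and $$\Xi([M])=q^{-\langle T_M,M\rangle}\,[F(T_M)]^{-1}\diamond[F(X_M)].$$ -/

import Mathlib

open CategoryTheory
open CategoryTheory.Abelian (Ext)
universe u v
namespace RingelHall

/-- `0 → K → L → M → 0` with maps `f` and `g` is a short exact sequence. -/
def IsSES {A K L M : Type u} [Ring A] [AddCommGroup K] [Module A K] [AddCommGroup L] [Module A L]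
    [AddCommGroup M] [Module A M] (f : K →ₗ[A] L) (g : L →ₗ[A] M) : Prop :=
  Function.Injective f ∧ Function.Exact f g ∧ Function.Surjective g

section Counting

theorem card_eq_of_fibers {α β : Type*} [Finite α] [Finite β] (f : α → β) (n : ℕ)
    (h : ∀ b, Nat.card {a // f a = b} = n) : Nat.card α = Nat.card β * n := by
  have := Fintype.ofFinite β
  rw [← Nat.card_congr (Equiv.sigmaFiberEquiv f), Nat.card_sigma]
  simp [h]

variable {A : Type u} [Ring A]
  {M : Type u} [AddCommGroup M] [Module A M]
  {N : Type u} [AddCommGroup N] [Module A N]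
  {Z : Type u} [AddCommGroup Z] [Module A Z]
  {L : Type u} [AddCommGroup L] [Module A L]
  {L' : Type u} [AddCommGroup L'] [Module A L']

instance finite_hom [Finite L] [Finite M] : Finite (L →ₗ[A] M) :=
  Finite.of_injective (fun f => (f : L → M)) DFunLike.coe_injective

instance finite_equiv [Finite L] [Finite M] : Finite (L ≃ₗ[A] M) :=
  Finite.of_injective (fun f => (f : L → M)) DFunLike.coe_injective

instance finite_submodule [Finite L] : Finite (Submodule A L) :=
  Finite.of_injective (fun U => (U : Set L)) SetLike.coe_injective

theorem card_equiv_eq (h : Nonempty (L ≃ₗ[A] M)) : Nat.card (L ≃ₗ[A] M) = Nat.card (M ≃ₗ[A] M) := by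
  obtain ⟨e⟩ := h
  exact Nat.card_congr
    { toFun := fun φ => e.symm.trans φ
      invFun := fun φ => e.trans φ
      left_inv := fun φ => by ext; simp
      right_inv := fun φ => by ext; simp }

variable (A M N L) in
/-- Short exact sequences `0 → N → L → M → 0`. -/
abbrev Ses : Type u := {p : (N →ₗ[A] L) × (L →ₗ[A] M) // IsSES p.1 p.2}

variable (A M N L) in
/-- Submodules of `L` of type `N` and cotype `M`. -/
abbrev Sub : Type u :=
  {U : Submodule A L // Nonempty (U ≃ₗ[A] N) ∧ Nonempty ((L ⧸ U) ≃ₗ[A] M)}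

instance [Finite L] [Finite M] [Finite N] : Finite (Ses A M N L) := by
  unfold Ses; infer_instance
instance [Finite L] : Finite (Sub A M N L) := by
  unfold Sub; infer_instance

/-- The submodule underlying a short exact sequence. -/
noncomputable def Ses.toSub (w : Ses A M N L) : Sub A M N L :=
  ⟨LinearMap.range w.1.1, ⟨(LinearEquiv.ofInjective _ w.2.1).symm⟩,
    ⟨(Submodule.quotEquivOfEq _ _ (LinearMap.exact_iff.1 w.2.2.1).symm).trans
      (w.1.2.quotKerEquivOfSurjective w.2.2.2)⟩⟩

/-- Short exact sequences with a given underlying submodule. -/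
noncomputable def fiberEquiv (U : Sub A M N L) :
    {w : Ses A M N L // w.toSub = U} ≃ (N ≃ₗ[A] U.1) × ((L ⧸ U.1) ≃ₗ[A] M) where
  toFun w :=
    ((LinearEquiv.ofInjective _ w.1.2.1).trans (LinearEquiv.ofEq _ _ (congrArg Subtype.val w.2)),
      (Submodule.quotEquivOfEq _ _ ((congrArg Subtype.val w.2).symm.trans
        (LinearMap.exact_iff.1 w.1.2.2.1).symm)).trans
      (w.1.1.2.quotKerEquivOfSurjective w.1.2.2.2))
  invFun p := ⟨⟨(U.1.subtype ∘ₗ p.1.toLinearMap, p.2.toLinearMap ∘ₗ U.1.mkQ),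
    by
      refine ⟨?_, ?_, ?_⟩
      · simpa using! p.1.injective
      · rw [LinearMap.exact_iff, LinearMap.range_comp, LinearEquiv.range, Submodule.map_top]
        simp [LinearMap.ker_comp]
      · simpa using! p.2.surjective.comp U.1.mkQ_surjective⟩,
    by
      apply Subtype.ext
      simp [Ses.toSub, LinearMap.range_comp]⟩
  left_inv w := by
    apply Subtype.ext; apply Subtype.ext
    refine Prod.ext ?_ ?_ <;> ext x
    · rfl
    · simp
  right_inv p := by
    refine Prod.ext ?_ ?_
    · ext x; rfl
    · ext x
      obtain ⟨x, rfl⟩ := U.1.mkQ_surjective x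
      simp

theorem card_ses [Finite L] [Finite M] [Finite N] :
    Nat.card (Ses A M N L) =
      Nat.card (Sub A M N L) * (Nat.card (N ≃ₗ[A] N) * Nat.card (M ≃ₗ[A] M)) := by
  refine card_eq_of_fibers Ses.toSub _ fun U => ?_
  rw [Nat.card_congr (fiberEquiv U), Nat.card_prod, card_equiv_eq U.2.2]
  congr 1
  obtain ⟨⟨e⟩, -⟩ := U.2
  exact Nat.card_congr
    { toFun := fun φ => φ.trans e
      invFun := fun φ => φ.trans e.symm
      left_inv := fun φ => by ext; simp
      right_inv := fun φ => by ext; simp }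

/-- Transport of submodules along an isomorphism. -/
noncomputable def subCongr (e : L ≃ₗ[A] L') : Sub A M N L ≃ Sub A M N L' :=
  (Submodule.orderIsoMapComap e).toEquiv.subtypeEquiv fun U => by
    refine and_congr ⟨?_, ?_⟩ ⟨?_, ?_⟩
    · rintro ⟨f⟩; exact ⟨(e.submoduleMap U).symm.trans f⟩
    · rintro ⟨f⟩; exact ⟨(e.submoduleMap U).trans f⟩
    · rintro ⟨f⟩; exact ⟨(Submodule.Quotient.equiv U _ e rfl).symm.trans f⟩
    · rintro ⟨f⟩; exact ⟨(Submodule.Quotient.equiv U _ e rfl).trans f⟩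

variable (A M N Z L) in
/-- Filtrations `U ≤ V ≤ L` with subquotients `U ≅ Z`, `V/U ≅ N`, `L/V ≅ M`, seen from `U`. -/
def FlagL : Type u := Σ U : {U : Submodule A L // Nonempty (U ≃ₗ[A] Z)}, Sub A M N (L ⧸ U.1)
variable (A M N Z L) in
/-- The same filtrations, seen from `V`. -/
def FlagR : Type u := Σ V : {V : Submodule A L // Nonempty ((L ⧸ V) ≃ₗ[A] M)}, Sub A N Z V.1

/-- For submodules `U`, `V`, the quotient `V/U` in its two guises. -/
noncomputable def subquot (U V : Submodule A L) :
    (V ⧸ U.comap V.subtype) ≃ₗ[A] V.map U.mkQ :=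
  (Submodule.quotEquivOfEq _ _ (by
    ext x; simp [LinearMap.mem_ker, ← Subtype.val_inj])).trans
    ((U.mkQ.restrict (p := V) (q := V.map U.mkQ)
      fun x hx => Submodule.mem_map_of_mem hx).quotKerEquivOfSurjective (by
        rintro ⟨y, hy⟩
        obtain ⟨x, hx, rfl⟩ := hy
        exact ⟨⟨x, hx⟩, rfl⟩))

variable (A M N Z L) in
/-- The same filtrations, as pairs of submodules. -/
def Flag : Type u := {p : Submodule A L × Submodule A L // p.1 ≤ p.2 ∧ Nonempty (p.1 ≃ₗ[A] Z) ∧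
  Nonempty ((p.2 ⧸ p.1.comap p.2.subtype) ≃ₗ[A] N) ∧ Nonempty ((L ⧸ p.2) ≃ₗ[A] M)}

/-- The quotient `L ⧸ U` determines the second step. -/
noncomputable def flagL : FlagL A M N Z L ≃ Flag A M N Z L where
  toFun p := ⟨(p.1.1, p.2.1.comap p.1.1.mkQ), by
    have hle : p.1.1 ≤ p.2.1.comap p.1.1.mkQ := by
      intro x hx
      have : p.1.1.mkQ x = 0 := by simpa using hx
      simp [this]
    have hmap : (p.2.1.comap p.1.1.mkQ).map p.1.1.mkQ = p.2.1 :=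
      Submodule.map_comap_eq_of_surjective p.1.1.mkQ_surjective _
    refine ⟨hle, p.1.2, ?_, ?_⟩
    · obtain ⟨e⟩ := p.2.2.1
      exact ⟨(subquot _ _).trans ((LinearEquiv.ofEq _ _ hmap).trans e)⟩
    · obtain ⟨e⟩ := p.2.2.2
      exact ⟨(Submodule.quotientQuotientEquivQuotient _ _ hle).symm.trans
        ((Submodule.quotEquivOfEq _ _ hmap).trans e)⟩⟩
  invFun p := ⟨⟨p.1.1, p.2.2.1⟩, ⟨p.1.2.map p.1.1.mkQ, by
    obtain ⟨hle, -, ⟨e⟩, ⟨e'⟩⟩ := p.2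
    exact ⟨⟨(subquot _ _).symm.trans e⟩,
      ⟨(Submodule.quotientQuotientEquivQuotient _ _ hle).trans e'⟩⟩⟩⟩
  left_inv p := by
    obtain ⟨U, V⟩ := p
    refine Sigma.ext rfl (heq_of_eq (Subtype.ext ?_))
    exact Submodule.map_comap_eq_of_surjective U.1.mkQ_surjective _
  right_inv p := by
    apply Subtype.ext
    refine Prod.ext rfl ?_
    simpa [Submodule.comap_map_eq] using p.2.1

/-- The submodule `V` determines the first step. -/
noncomputable def flagR : FlagR A M N Z L ≃ Flag A M N Z L where
  toFun p := ⟨(p.2.1.map p.1.1.subtype, p.1.1), by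
    refine ⟨Submodule.map_subtype_le _ _, ?_, ?_, p.1.2⟩
    · obtain ⟨e⟩ := p.2.2.1
      exact ⟨(Submodule.equivSubtypeMap _ _).symm.trans e⟩
    · obtain ⟨e⟩ := p.2.2.2
      exact ⟨(Submodule.quotEquivOfEq _ _
        (Submodule.comap_map_eq_of_injective p.1.1.injective_subtype _)).trans e⟩⟩
  invFun p := ⟨⟨p.1.2, p.2.2.2.2⟩, ⟨p.1.1.comap p.1.2.subtype, by
    obtain ⟨hle, ⟨e⟩, he, -⟩ := p.2
    exact ⟨⟨(Submodule.comapSubtypeEquivOfLe hle).trans e⟩, he⟩⟩⟩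
  left_inv p := by
    obtain ⟨U, V⟩ := p
    refine Sigma.ext rfl (heq_of_eq (Subtype.ext ?_))
    exact Submodule.comap_map_eq_of_injective U.1.injective_subtype _
  right_inv p := by
    apply Subtype.ext
    refine Prod.ext ?_ rfl
    simpa [Submodule.map_comap_subtype] using p.2.1

theorem card_flagL_eq_card_flagR : Nat.card (FlagL A M N Z L) = Nat.card (FlagR A M N Z L) :=
  Nat.card_congr (flagL.trans flagR.symm)

end Counting

section
variable {A : Type u} [Ring A]
/-- `Ext¹(M, N)_L`: the classes of the extensions `0 → N → L → M → 0` with middle term `L`. -/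
def ExtMid (M N L : FGModuleCat.{u} A) : Set (Ext M.obj N.obj 1) :=
  {e | ∃ (f : N.obj ⟶ L.obj) (g : L.obj ⟶ M.obj) (w : f ≫ g = 0)
    (h : (ShortComplex.mk f g w).ShortExact), h.extClass = e}

end

section ExtCount

theorem exists_map_of_extClass_eq {C : Type*} [Category C] [Abelian C] [HasExt.{u} C]
    {X Y L : C} {f f' : X ⟶ L} {g g' : L ⟶ Y} (w : f ≫ g = 0) (w' : f' ≫ g' = 0)
    (h : (ShortComplex.mk f g w).ShortExact) (h' : (ShortComplex.mk f' g' w').ShortExact)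
    (e : h.extClass = h'.extClass) : ∃ φ : L ⟶ L, f ≫ φ = f' ∧ φ ≫ g' = g := by
  obtain ⟨x, hx⟩ := Ext.contravariant_sequence_exact₁ h L (Ext.mk₀ f') (add_zero 1)
    (by rw [e]; exact h'.extClass_comp)
  obtain ⟨φ₀, rfl⟩ := (Ext.mk₀_bijective _ _).2 x
  have hφ₀ : f ≫ φ₀ = f' := by
    rw [Ext.mk₀_comp_mk₀] at hx
    exact (Ext.mk₀_bijective _ _).1 hx
  have := h.epi_g
  have hz : f ≫ (φ₀ ≫ g') = 0 := by rw [← Category.assoc, hφ₀, w']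
  let θ : Y ⟶ Y := h.exact.desc (φ₀ ≫ g') hz
  have hθ : g ≫ θ = φ₀ ≫ g' := h.exact.g_desc _ _
  let F : ShortComplex.mk f g w ⟶ ShortComplex.mk f' g' w' :=
    { τ₁ := 𝟙 _
      τ₂ := φ₀
      τ₃ := θ
      comm₁₂ := by simpa using! hφ₀.symm
      comm₂₃ := hθ.symm }
  have hnat : h.extClass.comp (Ext.mk₀ (𝟙 X)) (add_zero 1) =
      (Ext.mk₀ θ).comp h'.extClass (zero_add 1) :=
    ShortComplex.ShortExact.extClass_naturality h h' F
  rw [Ext.comp_mk₀_id, e] at hnat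
  have h0 : (Ext.mk₀ (θ - 𝟙 Y)).comp h'.extClass (zero_add 1) = 0 := by
    have : Ext.mk₀ (θ - 𝟙 Y) = Ext.mk₀ θ + -Ext.mk₀ (𝟙 Y) := by
      rw [sub_eq_add_neg, Ext.mk₀_add, Ext.mk₀_neg]
    rw [this, Ext.add_comp, Ext.neg_comp, ← hnat, Ext.mk₀_id_comp, add_neg_cancel]
  obtain ⟨y, hy⟩ := Ext.covariant_sequence_exact₃ Y h' _ (zero_add 1) h0
  obtain ⟨s, rfl⟩ := (Ext.mk₀_bijective _ _).2 y
  rw [Ext.mk₀_comp_mk₀] at hy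
  have hs : s ≫ g' = θ - 𝟙 Y := (Ext.mk₀_bijective _ _).1 hy
  refine ⟨φ₀ - g ≫ s, ?_, ?_⟩
  · rw [Preadditive.comp_sub, hφ₀, ← Category.assoc, w, Limits.zero_comp, sub_zero]
  · rw [Preadditive.sub_comp, Category.assoc, hs, ← hθ, Preadditive.comp_sub, Category.comp_id,
      sub_sub_cancel]

variable {A : Type u} [Ring A] {M N L : FGModuleCat.{u} A}

/-- The short complex of modules attached to a short exact sequence. -/
def Ses.sc (w : Ses A M N L) : ShortComplex (ModuleCat.{u} A) :=
  ShortComplex.mk (X₁ := N.obj) (X₂ := L.obj) (X₃ := M.obj)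
    (ModuleCat.ofHom w.1.1) (ModuleCat.ofHom w.1.2) (by
      ext x
      exact (w.2.2.1 _).2 ⟨x, rfl⟩)

theorem Ses.shortExact (w : Ses A M N L) : w.sc.ShortExact := by
  have : Mono w.sc.f := (ModuleCat.mono_iff_injective _).2 w.2.1
  have : Epi w.sc.g := (ModuleCat.epi_iff_surjective _).2 w.2.2.2
  exact ⟨(ShortComplex.ShortExact.moduleCat_exact_iff_function_exact _).2 w.2.2.1⟩

/-- The class of a short exact sequence in `Ext¹`. -/
noncomputable def Ses.toExt (w : Ses A M N L) : ExtMid M N L :=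
  ⟨w.shortExact.extClass, _, _, _, w.shortExact, rfl⟩

theorem Ses.toExt_surjective : Function.Surjective (Ses.toExt (M := M) (N := N) (L := L)) := by
  rintro ⟨e, f, g, w, h, rfl⟩
  refine ⟨⟨(f.hom, g.hom), ?_, ?_, ?_⟩, rfl⟩
  · exact (ModuleCat.mono_iff_injective _).1 h.mono_f
  · exact (ShortComplex.ShortExact.moduleCat_exact_iff_function_exact _).1 h.exact
  · exact (ModuleCat.epi_iff_surjective _).1 h.epi_g

/-- Transport of a short exact sequence along an automorphism of the middle term. -/
def Ses.act (φ : L ≃ₗ[A] L) (w : Ses A M N L) : Ses A M N L :=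
  ⟨(φ.toLinearMap ∘ₗ w.1.1, w.1.2 ∘ₗ φ.symm.toLinearMap), by
    refine ⟨φ.injective.comp w.2.1, ?_, w.2.2.2.comp φ.symm.surjective⟩
    intro x
    constructor
    · intro hx
      obtain ⟨y, hy⟩ := (w.2.2.1 _).1 hx
      exact ⟨y, by simp [hy]⟩
    · rintro ⟨y, rfl⟩
      have := (w.2.2.1 _).2 ⟨y, rfl⟩
      simpa using this⟩

theorem Ses.toExt_eq_of_map (w w' : Ses A M N L) (φ : L →ₗ[A] L)
    (h1 : φ ∘ₗ w.1.1 = w'.1.1) (h2 : w'.1.2 ∘ₗ φ = w.1.2) : w.toExt = w'.toExt := by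
  let F : w.sc ⟶ w'.sc :=
    { τ₁ := 𝟙 _
      τ₂ := ModuleCat.ofHom φ
      τ₃ := 𝟙 _
      comm₁₂ := by
        apply ModuleCat.hom_ext
        exact h1.symm
      comm₂₃ := by
        apply ModuleCat.hom_ext
        exact h2 }
  have := ShortComplex.ShortExact.extClass_naturality w.shortExact w'.shortExact F
  apply Subtype.ext
  change w.shortExact.extClass = w'.shortExact.extClass
  have e1 : F.τ₁ = 𝟙 N.obj := rfl
  have e3 : F.τ₃ = 𝟙 M.obj := rfl
  erw [e1, e3, Ext.comp_mk₀_id, Ext.mk₀_id_comp] at this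
  exact this

theorem Ses.factor (w : Ses A M N L) (δ : L →ₗ[A] L) (h1 : δ ∘ₗ w.1.1 = 0)
    (h2 : w.1.2 ∘ₗ δ = 0) : ∃ h : M →ₗ[A] N, δ = w.1.1 ∘ₗ h ∘ₗ w.1.2 := by
  have hk : ∀ x, ∃ y, w.1.1 y = δ x := fun x => (w.2.2.1 _).1 (LinearMap.congr_fun h2 x)
  choose s hs using hk
  obtain ⟨r, hr⟩ := w.2.2.2.hasRightInverse
  have key : ∀ x x', w.1.2 x = w.1.2 x' → δ x = δ x' := by
    intro x x' hx
    have : w.1.2 (x - x') = 0 := by rw [map_sub, hx, sub_self]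
    obtain ⟨y, hy⟩ := (w.2.2.1 _).1 this
    have h3 : δ (x - x') = 0 := by rw [← hy]; exact LinearMap.congr_fun h1 y
    rwa [map_sub, sub_eq_zero] at h3
  refine ⟨⟨⟨fun m => s (r m), ?_⟩, ?_⟩, ?_⟩
  · intro a b
    apply w.2.1
    rw [map_add, hs, hs, hs, ← map_add]
    exact key _ _ (by rw [hr, map_add, hr, hr])
  · intro c a
    apply w.2.1
    dsimp only [RingHom.id_apply]
    rw [map_smul, hs, hs, ← map_smul]
    exact key _ _ (by rw [hr, map_smul, hr])
  · ext x
    change δ x = w.1.1 (s (r (w.1.2 x)))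
    rw [hs]
    exact key _ _ (hr _).symm

theorem Ses.exists_of_toExt_eq (w w' : Ses A M N L) (h : w.toExt = w'.toExt) :
    ∃ φ : L ≃ₗ[A] L, φ.toLinearMap ∘ₗ w.1.1 = w'.1.1 ∧ w'.1.2 ∘ₗ φ.toLinearMap = w.1.2 := by
  obtain ⟨φ', hp1, hp2⟩ := exists_map_of_extClass_eq w.sc.zero w'.sc.zero w.shortExact
    w'.shortExact (congrArg Subtype.val h)
  let φ : L →ₗ[A] L := φ'.hom
  have p1 : φ ∘ₗ w.1.1 = w'.1.1 := congrArg ModuleCat.Hom.hom hp1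
  have p2 : w'.1.2 ∘ₗ φ = w.1.2 := congrArg ModuleCat.Hom.hom hp2
  have bij : Function.Bijective φ := by
    constructor
    · rw [injective_iff_map_eq_zero]
      intro x hx
      have : w.1.2 x = 0 := by rw [← p2]; simp [hx]
      obtain ⟨y, rfl⟩ := (w.2.2.1 _).1 this
      have h4 : w'.1.1 y = 0 := by rw [← p1]; exact hx
      rw [(injective_iff_map_eq_zero _).1 w'.2.1 y h4, map_zero]
    · intro z
      obtain ⟨x, hx⟩ := w.2.2.2 (w'.1.2 z)
      have : w'.1.2 (z - φ x) = 0 := by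
        rw [map_sub, ← hx, ← p2]; simp
      obtain ⟨y, hy⟩ := (w'.2.2.1 _).1 this
      refine ⟨x + w.1.1 y, ?_⟩
      have : φ (w.1.1 y) = w'.1.1 y := LinearMap.congr_fun p1 y
      rw [map_add, this, hy]; abel
  exact ⟨LinearEquiv.ofBijective φ bij, p1, p2⟩

/-- The unipotent automorphism `1 + f h g` of the middle term. -/
def Ses.unip (w : Ses A M N L) (h : M →ₗ[A] N) : L ≃ₗ[A] L :=
  have hgf : ∀ y, w.1.2 (w.1.1 y) = 0 := fun y => (w.2.2.1 _).2 ⟨y, rfl⟩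
  LinearEquiv.ofLinearMap (LinearMap.id + w.1.1 ∘ₗ h ∘ₗ w.1.2) (LinearMap.id - w.1.1 ∘ₗ h ∘ₗ w.1.2)
    (by ext x; simp [hgf]) (by ext x; simp [hgf])

theorem Ses.unip_apply (w : Ses A M N L) (h : M →ₗ[A] N) (x : L) :
    w.unip h x = x + w.1.1 (h (w.1.2 x)) := rfl

theorem Ses.card_fiber (w : Ses A M N L) :
    Nat.card {p : Ses A M N L × (M →ₗ[A] N) // p.1.toExt = w.toExt} = Nat.card (L ≃ₗ[A] L) := by
  have hgf : ∀ y, w.1.2 (w.1.1 y) = 0 := fun y => (w.2.2.1 _).2 ⟨y, rfl⟩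
  have hex : ∀ w' : {w' : Ses A M N L // w'.toExt = w.toExt},
      ∃ φ : L ≃ₗ[A] L, φ.toLinearMap ∘ₗ w.1.1 = w'.1.1.1 ∧ w'.1.1.2 ∘ₗ φ.toLinearMap = w.1.2 :=
    fun w' => w.exists_of_toExt_eq w'.1 w'.2.symm
  choose σ hσ1 hσ2 using hex
  refine Nat.card_congr (Equiv.ofBijective
    (fun p => (w.unip p.1.2).trans (σ ⟨p.1.1, p.2⟩)) ⟨?_, ?_⟩)
  · rintro ⟨⟨w1, h1⟩, e1⟩ ⟨⟨w2, h2⟩, e2⟩ heq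
    have heq' : ∀ x, σ ⟨w1, e1⟩ (w.unip h1 x) = σ ⟨w2, e2⟩ (w.unip h2 x) :=
      fun x => LinearEquiv.congr_fun heq x
    have hw : w1 = w2 := by
      apply Subtype.ext
      refine Prod.ext ?_ ?_
      · rw [← hσ1 ⟨w1, e1⟩, ← hσ1 ⟨w2, e2⟩]
        ext y
        simpa [Ses.unip_apply, hgf] using heq' (w.1.1 y)
      · have k : ∀ (w' : Ses A M N L) (e) (h : M →ₗ[A] N) (x : L),
            w'.1.2 (σ ⟨w', e⟩ (w.unip h x)) = w.1.2 x := by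
          intro w' e h x
          have := LinearMap.congr_fun (hσ2 ⟨w', e⟩) (w.unip h x)
          simpa [Ses.unip_apply, hgf] using this
        ext z
        obtain ⟨x, rfl⟩ := ((w.unip h1).trans (σ ⟨w1, e1⟩)).surjective z
        have a := k w1 e1 h1 x
        have b := k w2 e2 h2 x
        rw [← heq'] at b
        exact a.trans b.symm
    subst hw
    have : h1 = h2 := by
      ext m
      obtain ⟨x, rfl⟩ := w.2.2.2 m
      have := (σ ⟨w1, e1⟩).injective (heq' x)
      rw [Ses.unip_apply, Ses.unip_apply] at this
      exact w.2.1 (add_left_cancel this)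
    subst this
    rfl
  · intro φ
    have hact : (w.act φ).toExt = w.toExt :=
      (Ses.toExt_eq_of_map w (w.act φ) φ.toLinearMap rfl (by ext x; simp [Ses.act])).symm
    let χ : L ≃ₗ[A] L := φ.trans (σ ⟨_, hact⟩).symm
    have c1 : ∀ y, χ (w.1.1 y) = w.1.1 y := by
      intro y
      have := LinearMap.congr_fun (hσ1 ⟨_, hact⟩) y
      change σ ⟨_, hact⟩ (w.1.1 y) = φ (w.1.1 y) at this
      change (σ ⟨_, hact⟩).symm (φ (w.1.1 y)) = w.1.1 y
      rw [← this, LinearEquiv.symm_apply_apply]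
    have c2 : ∀ x, w.1.2 (χ x) = w.1.2 x := by
      intro x
      have := LinearMap.congr_fun (hσ2 ⟨_, hact⟩) (χ x)
      rw [← this]
      change w.1.2 (φ.symm (σ ⟨_, hact⟩ ((σ ⟨_, hact⟩).symm (φ x)))) = w.1.2 x
      simp
    obtain ⟨h, hh⟩ := w.factor (χ.toLinearMap - LinearMap.id)
      (by ext y; simp [c1]) (by ext x; simp [c2])
    refine ⟨⟨⟨w.act φ, h⟩, hact⟩, ?_⟩
    ext x
    have hx : w.unip h x = χ x := by
      have := LinearMap.congr_fun hh x
      simp only [LinearMap.sub_apply, LinearMap.id_apply, LinearMap.comp_apply,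
        LinearEquiv.coe_coe] at this
      rw [Ses.unip_apply, ← this]; abel
    change σ ⟨_, hact⟩ (w.unip h x) = φ x
    rw [hx]
    change σ ⟨_, hact⟩ ((σ ⟨_, hact⟩).symm (φ x)) = φ x
    simp

theorem card_extMid [Finite M] [Finite N] [Finite L] :
    Nat.card (ExtMid M N L) * Nat.card (L ≃ₗ[A] L) =
      Nat.card (Ses A M N L) * Nat.card (M.obj ⟶ N.obj) := by
  have : Finite (ExtMid M N L) := Finite.of_surjective _ Ses.toExt_surjective
  rw [Nat.card_congr (ModuleCat.homEquiv : (M.obj ⟶ N.obj) ≃ (M →ₗ[A] N)),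
    ← Nat.card_prod (Ses A M N L)]
  refine (card_eq_of_fibers (fun p : Ses A M N L × (M →ₗ[A] N) => p.1.toExt) _ fun e => ?_).symm
  obtain ⟨w, rfl⟩ := Ses.toExt_surjective e
  exact w.card_fiber

end ExtCount

section HallAlgebra

set_option linter.unusedSectionVars false

variable {A : Type u} [Ring A]

/-- Isomorphism classes of finitely generated left `A`-modules. -/
abbrev IsoClass (A : Type u) [Ring A] : Type (u + 1) :=
  Quotient (isIsomorphicSetoid (FGModuleCat.{u} A))

theorem isoClass_eq_iff {M N : FGModuleCat.{u} A} :
    (⟦M⟧ : IsoClass A) = ⟦N⟧ ↔ Nonempty (M ≃ₗ[A] N) := by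
  rw [Quotient.eq]
  constructor
  · rintro ⟨e⟩; exact ⟨FGModuleCat.isoToLinearEquiv e⟩
  · rintro ⟨e⟩; exact ⟨e.toFGModuleCatIso⟩

theorem nonempty_out_equiv (M : FGModuleCat.{u} A) :
    Nonempty ((⟦M⟧ : IsoClass A).out ≃ₗ[A] M) :=
  isoClass_eq_iff.1 (Quotient.out_eq _)

variable [Finite A]

instance finite_fg (M : FGModuleCat.{u} A) : Finite M := Module.finite_of_finite A
instance finite_fg' (M : FGModuleCat.{u} A) : Finite M.obj := Module.finite_of_finite A

/-- The structure constant `|Ext¹(M, N)_L| / |Hom(M, N)|`. -/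
noncomputable def hallNumber (M N L : FGModuleCat.{u} A) : ℚ :=
  (Nat.card (ExtMid M N L) : ℚ) / (Nat.card (M.obj ⟶ N.obj) : ℚ)

/-- The number of automorphisms of `M`. -/
noncomputable def aut (M : FGModuleCat.{u} A) : ℚ := Nat.card (M ≃ₗ[A] M)

theorem aut_ne_zero (M : FGModuleCat.{u} A) : aut M ≠ 0 := by
  unfold aut
  exact_mod_cast Nat.card_pos.ne'

theorem hallNumber_eq (M N L : FGModuleCat.{u} A) :
    hallNumber M N L = Nat.card (Sub A M N L) * (aut N * aut M) / aut L := by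
  have h := card_extMid (M := M) (N := N) (L := L)
  rw [card_ses] at h
  have h2 : (Nat.card (M.obj ⟶ N.obj) : ℚ) ≠ 0 := by
    have : Finite (M.obj ⟶ N.obj) := Finite.of_equiv _ ModuleCat.homEquiv.symm
    exact_mod_cast Nat.card_pos.ne'
  rw [hallNumber, div_eq_div_iff h2 (aut_ne_zero L)]
  unfold aut
  exact_mod_cast h

theorem card_sub_congr {M M' N N' L L' : FGModuleCat.{u} A} (hM : Nonempty (M ≃ₗ[A] M'))
    (hN : Nonempty (N ≃ₗ[A] N')) (hL : Nonempty (L ≃ₗ[A] L')) :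
    Nat.card (Sub A M N L) = Nat.card (Sub A M' N' L') := by
  obtain ⟨eM⟩ := hM
  obtain ⟨eN⟩ := hN
  obtain ⟨eL⟩ := hL
  rw [Nat.card_congr (subCongr eL)]
  refine Nat.card_congr (Equiv.subtypeEquivRight fun U => and_congr ⟨?_, ?_⟩ ⟨?_, ?_⟩)
  · rintro ⟨e⟩; exact ⟨e.trans eN⟩
  · rintro ⟨e⟩; exact ⟨e.trans eN.symm⟩
  · rintro ⟨e⟩; exact ⟨e.trans eM⟩
  · rintro ⟨e⟩; exact ⟨e.trans eM.symm⟩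

theorem aut_congr {M M' : FGModuleCat.{u} A} (hM : Nonempty (M ≃ₗ[A] M')) : aut M = aut M' := by
  have h' := hM
  obtain ⟨e⟩ := hM
  unfold aut
  rw [← card_equiv_eq h']
  norm_cast
  exact Nat.card_congr
    { toFun := fun φ => φ.trans e
      invFun := fun φ => φ.trans e.symm
      left_inv := fun φ => by ext; simp
      right_inv := fun φ => by ext; simp }

theorem hallNumber_congr {M M' N N' L L' : FGModuleCat.{u} A} (hM : Nonempty (M ≃ₗ[A] M'))
    (hN : Nonempty (N ≃ₗ[A] N')) (hL : Nonempty (L ≃ₗ[A] L')) :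
    hallNumber M N L = hallNumber M' N' L' := by
  rw [hallNumber_eq, hallNumber_eq, card_sub_congr hM hN hL, aut_congr hM, aut_congr hN,
    aut_congr hL]

theorem finite_isoClass (n : ℕ) : {c : IsoClass A | Nat.card c.out = n}.Finite := by
  have : Finite (Submodule A (Fin n → A)) :=
    Finite.of_injective (fun U => (U : Set (Fin n → A))) SetLike.coe_injective
  refine (Set.finite_range fun U : Submodule A (Fin n → A) =>
    (⟦FGModuleCat.of A ((Fin n → A) ⧸ U)⟧ : IsoClass A)).subset ?_
  intro c hc
  have e : Fin n ≃ c.out := (Finite.equivFinOfCardEq hc).symm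
  let p : (Fin n → A) →ₗ[A] c.out := Fintype.linearCombination A (fun i => (e i : c.out))
  have hp : Function.Surjective p := by
    intro x
    refine ⟨Pi.single (e.symm x) 1, ?_⟩
    simp [p]
  refine ⟨LinearMap.ker p, ?_⟩
  conv_rhs => rw [← Quotient.out_eq c]
  exact isoClass_eq_iff.2 ⟨p.quotKerEquivOfSurjective hp⟩

theorem card_of_sub {M N L : FGModuleCat.{u} A} (U : Sub A M N L) :
    Nat.card L = Nat.card M * Nat.card N := by
  obtain ⟨⟨e⟩, ⟨e'⟩⟩ := U.2
  rw [Submodule.card_eq_card_quotient_mul_card U.1, Nat.card_congr e.toEquiv,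
    Nat.card_congr e'.toEquiv, mul_comm]

theorem hallNumber_support (M N : FGModuleCat.{u} A) :
    (Function.support fun L : IsoClass A => hallNumber M N L.out).Finite := by
  refine (finite_isoClass (Nat.card M * Nat.card N)).subset fun L hL => ?_
  rw [Function.mem_support, hallNumber_eq] at hL
  have : Nat.card (Sub A M N L.out) ≠ 0 := by
    intro h; simp [h] at hL
  have := (Nat.card_ne_zero.1 this).1
  exact card_of_sub this.some

variable (A) in
/-- The free `ℚ`-vector space on the isomorphism classes. -/
abbrev HallSpace : Type (u + 1) := IsoClass A →₀ ℚ

namespace HallSpace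

/-- The basis vector of the class of `M`. -/
noncomputable def cls (M : FGModuleCat.{u} A) : HallSpace A := Finsupp.single ⟦M⟧ (1 : ℚ)

/-- The Hall product `[M] ⋄ [N] = ∑ |Ext¹(M, N)_L| / |Hom(M, N)| [L]` of two classes. -/
noncomputable def prod (M N : IsoClass A) : HallSpace A :=
  Finsupp.ofSupportFinite (fun L => hallNumber M.out N.out L.out) (hallNumber_support _ _)

/-- The Hall product, extended bilinearly. -/
noncomputable def mulLin : HallSpace A →ₗ[ℚ] HallSpace A →ₗ[ℚ] HallSpace A :=
  Finsupp.linearCombination ℚ fun M : IsoClass A =>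
    (Finsupp.linearCombination ℚ fun N : IsoClass A => prod M N)

/-- Basis element of an isomorphism class. -/
noncomputable def basis (c : IsoClass A) : HallSpace A := Finsupp.single c (1 : ℚ)

theorem mulLin_basis (M N : IsoClass A) : mulLin (basis M) (basis N) = prod M N := by
  unfold mulLin basis
  rw [Finsupp.linearCombination_single, one_smul, Finsupp.linearCombination_single, one_smul]

theorem prod_apply (M N L : IsoClass A) :
    (prod M N) L = hallNumber M.out N.out L.out := rfl

theorem basis_ext {V : Type*} [AddCommGroup V] [Module ℚ V] {f g : HallSpace A →ₗ[ℚ] V}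
    (h : ∀ c, f (basis c) = g (basis c)) : f = g :=
  Finsupp.lhom_ext' fun c => LinearMap.ext_ring (h c)

theorem mulLin_prod_left (M N Z L : IsoClass A) :
    (mulLin (prod M N) (basis Z)) L =
      ∑ X ∈ (prod M N).support,
        (prod M N) X * (prod X Z) L := by
  have h : (prod M N : HallSpace A) = ∑ X ∈ (prod M N).support,
      (prod M N) X • basis X := by
    conv_lhs => rw [← Finsupp.sum_single (prod M N)]
    refine Finset.sum_congr rfl fun X _ => ?_
    unfold basis
    rw [Finsupp.smul_single, smul_eq_mul, mul_one]
  conv_lhs => rw [h]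
  rw [map_sum, LinearMap.sum_apply]
  simp only [map_smul, LinearMap.smul_apply, mulLin_basis]
  rw [Finsupp.finsetSum_apply]
  rfl

theorem mulLin_prod_right (M N Z L : IsoClass A) :
    (mulLin (basis M) (prod N Z)) L =
      ∑ Y ∈ (prod N Z).support,
        (prod N Z) Y * (prod M Y) L := by
  have h : (prod N Z : HallSpace A) = ∑ X ∈ (prod N Z).support,
      (prod N Z) X • basis X := by
    conv_lhs => rw [← Finsupp.sum_single (prod N Z)]
    refine Finset.sum_congr rfl fun X _ => ?_
    unfold basis
    rw [Finsupp.smul_single, smul_eq_mul, mul_one]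
  conv_lhs => rw [h]
  rw [map_sum]
  simp only [map_smul, mulLin_basis]
  rw [Finsupp.finsetSum_apply]
  rfl

theorem mem_support_prod {M N X : IsoClass A} :
    X ∈ (prod M N).support ↔ Nat.card (Sub A M.out N.out X.out) ≠ 0 := by
  rw [Finsupp.mem_support_iff, prod_apply, hallNumber_eq]
  simp [aut_ne_zero]

/-- A sum over a finite type, fibred over isomorphism classes. -/
theorem sum_fiber {ι : Type u} [Fintype ι] (κ : ι → IsoClass A) (F : IsoClass A → ℕ)
    (s : Finset (IsoClass A)) (hs : ∀ X, F X ≠ 0 → X ∈ s) :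
    ∑ i, F (κ i) = ∑ X ∈ s, F X * Nat.card {i // κ i = X} := by
  classical
  have h1 : ∑ i, F (κ i) = ∑ i with κ i ∈ s, F (κ i) := by
    rw [Finset.sum_filter]
    refine Finset.sum_congr rfl fun i _ => ?_
    split_ifs with h
    · rfl
    · by_contra h'; exact h (hs _ h')
  rw [h1, ← Finset.sum_fiberwise_of_maps_to (t := s) (g := κ) (by simp)]
  refine Finset.sum_congr rfl fun X hX => ?_
  rw [Finset.sum_congr rfl (g := fun _ => F X) (by
    intro i hi; rw [(Finset.mem_filter.1 hi).2])]
  rw [Finset.sum_const, smul_eq_mul, mul_comm, Nat.card_eq_fintype_card, Fintype.card_subtype,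
    Finset.filter_filter]
  congr 2
  ext i
  simp only [Finset.mem_filter, Finset.mem_univ, true_and]
  constructor
  · rintro ⟨-, h⟩; exact h
  · rintro rfl; exact ⟨hX, rfl⟩

theorem card_flagL (M N Z L : IsoClass A) :
    Nat.card (FlagL A M.out N.out Z.out L.out) =
      ∑ X ∈ (prod M N).support,
        Nat.card (Sub A M.out N.out X.out) * Nat.card (Sub A X.out Z.out L.out) := by
  have := Fintype.ofFinite {U : Submodule A L.out // Nonempty (U ≃ₗ[A] Z.out)}
  have (U : {U : Submodule A L.out // Nonempty (U ≃ₗ[A] Z.out)}) : Finite (L.out ⧸ U.1) :=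
    Finite.of_surjective _ U.1.mkQ_surjective
  rw [FlagL, Nat.card_sigma]
  let κ : {U : Submodule A L.out // Nonempty (U ≃ₗ[A] Z.out)} → IsoClass A :=
    fun U => ⟦FGModuleCat.of A (L.out ⧸ U.1)⟧
  have h := sum_fiber κ (fun X => Nat.card (Sub A M.out N.out X.out)) _
    (fun X hX => mem_support_prod.2 hX)
  refine Eq.trans (Finset.sum_congr rfl fun U _ => ?_) (h.trans
    (Finset.sum_congr rfl fun X _ => ?_))
  · obtain ⟨e⟩ := nonempty_out_equiv (FGModuleCat.of A (L.out ⧸ U.1))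
    exact Nat.card_congr (subCongr e.symm)
  · congr 1
    refine Nat.card_congr ((Equiv.subtypeSubtypeEquivSubtypeInter _ (fun U : Submodule A L.out =>
      (⟦FGModuleCat.of A (L.out ⧸ U)⟧ : IsoClass A) = X)).trans
      (Equiv.subtypeEquivRight fun U => and_congr Iff.rfl ?_))
    conv_lhs => rw [← Quotient.out_eq X]
    exact isoClass_eq_iff

theorem card_flagR (M N Z L : IsoClass A) :
    Nat.card (FlagR A M.out N.out Z.out L.out) =
      ∑ Y ∈ (prod N Z).support,
        Nat.card (Sub A N.out Z.out Y.out) * Nat.card (Sub A M.out Y.out L.out) := by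
  have := Fintype.ofFinite {V : Submodule A L.out // Nonempty ((L.out ⧸ V) ≃ₗ[A] M.out)}
  rw [FlagR, Nat.card_sigma]
  let κ : {V : Submodule A L.out // Nonempty ((L.out ⧸ V) ≃ₗ[A] M.out)} → IsoClass A :=
    fun V => ⟦FGModuleCat.of A V.1⟧
  have h := sum_fiber κ (fun X => Nat.card (Sub A N.out Z.out X.out)) _
    (fun X hX => mem_support_prod.2 hX)
  refine Eq.trans (Finset.sum_congr rfl fun V _ => ?_) (h.trans
    (Finset.sum_congr rfl fun X _ => ?_))
  · obtain ⟨e⟩ := nonempty_out_equiv (FGModuleCat.of A V.1)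
    exact Nat.card_congr (subCongr e.symm)
  · congr 1
    refine Nat.card_congr ((Equiv.subtypeSubtypeEquivSubtypeInter _ (fun U : Submodule A L.out =>
      (⟦FGModuleCat.of A U⟧ : IsoClass A) = X)).trans
      (Equiv.subtypeEquivRight fun U => and_comm.trans (and_congr ?_ Iff.rfl)))
    conv_lhs => rw [← Quotient.out_eq X]
    exact isoClass_eq_iff

theorem mulLin_assoc_basis (M N Z : IsoClass A) :
    mulLin (mulLin (basis M) (basis N)) (basis Z) =
      mulLin (basis M) (mulLin (basis N) (basis Z)) := by
  rw [mulLin_basis, mulLin_basis]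
  refine Finsupp.ext fun L => ?_
  rw [mulLin_prod_left, mulLin_prod_right]
  have h := card_flagL_eq_card_flagR (A := A) (M := M.out) (N := N.out) (Z := Z.out) (L := L.out)
  rw [card_flagL, card_flagR] at h
  have h' := congrArg (fun n : ℕ =>
    (n : ℚ) * (aut M.out * aut N.out * aut Z.out / aut L.out)) h
  simp only [Nat.cast_sum, Nat.cast_mul, Finset.sum_mul] at h'
  refine Eq.trans (Finset.sum_congr rfl fun X _ => ?_) (h'.trans
    (Finset.sum_congr rfl fun X _ => ?_))
  · rw [prod_apply, prod_apply, hallNumber_eq, hallNumber_eq]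
    have := aut_ne_zero X.out
    field_simp
  · rw [prod_apply, prod_apply, hallNumber_eq, hallNumber_eq]
    have := aut_ne_zero X.out
    field_simp

theorem mulLin_assoc (x y z : HallSpace A) :
    mulLin (mulLin x y) z = mulLin x (mulLin y z) := by
  revert z
  suffices h : ∀ z, (mulLin.flip z ∘ₗ mulLin x) y = (mulLin x ∘ₗ mulLin.flip z) y from h
  intro z
  refine LinearMap.congr_fun (basis_ext fun N => ?_) y
  change (mulLin (mulLin x (basis N))) z = mulLin x (mulLin (basis N) z)
  refine LinearMap.congr_fun (f := mulLin (mulLin x (basis N)))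
    (g := mulLin x ∘ₗ mulLin (basis N)) (basis_ext fun Z => ?_) z
  change (mulLin (mulLin x (basis N))) (basis Z) = mulLin x (mulLin (basis N) (basis Z))
  refine LinearMap.congr_fun (f := mulLin.flip (basis Z) ∘ₗ mulLin.flip (basis N))
    (g := mulLin.flip (mulLin (basis N) (basis Z))) (basis_ext fun M => ?_) x
  exact mulLin_assoc_basis M N Z

theorem mulLin_cls (M N L : FGModuleCat.{u} A) :
    mulLin (cls M) (cls N) ⟦L⟧ = hallNumber M N L := by
  change (mulLin (basis ⟦M⟧) (basis ⟦N⟧)) ⟦L⟧ = _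
  rw [mulLin_basis, prod_apply]
  exact hallNumber_congr (nonempty_out_equiv M) (nonempty_out_equiv N) (nonempty_out_equiv L)

open Classical in
theorem hallNumber_zero_left (N L : FGModuleCat.{u} A) :
    hallNumber (FGModuleCat.of A PUnit) N L = if (⟦N⟧ : IsoClass A) = ⟦L⟧ then 1 else 0 := by
  rw [hallNumber_eq]
  have h0 : aut (FGModuleCat.of A PUnit.{u + 1}) = 1 := by
    unfold aut
    have : Nat.card (PUnit.{u + 1} ≃ₗ[A] PUnit.{u + 1}) = 1 := by
      rw [Nat.card_eq_one_iff_unique]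
      exact ⟨⟨fun a b => by ext⟩, ⟨LinearEquiv.refl _ _⟩⟩
    exact_mod_cast this
  rw [h0, mul_one]
  have key : ∀ U : Submodule A L, (Nonempty (U ≃ₗ[A] N) ∧
      Nonempty ((L ⧸ U) ≃ₗ[A] PUnit.{u + 1})) ↔ U = ⊤ ∧ Nonempty (L ≃ₗ[A] N) := by
    intro U
    constructor
    · rintro ⟨⟨e⟩, ⟨e'⟩⟩
      have : Subsingleton (L ⧸ U) := e'.toEquiv.subsingleton
      have hU : U = ⊤ := Submodule.Quotient.subsingleton_iff.1 this
      subst hU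
      exact ⟨rfl, ⟨Submodule.topEquiv.symm.trans e⟩⟩
    · rintro ⟨rfl, ⟨e⟩⟩
      have : Subsingleton (L ⧸ (⊤ : Submodule A L)) :=
        Submodule.Quotient.subsingleton_iff.2 rfl
      exact ⟨⟨Submodule.topEquiv.trans e⟩, ⟨LinearEquiv.ofSubsingleton _ _⟩⟩
  split_ifs with h
  · have e := isoClass_eq_iff.1 h.symm
    have h1 : Nat.card (Sub A PUnit.{u + 1} N L) = 1 := by
      rw [Nat.card_eq_one_iff_unique]
      exact ⟨⟨fun a b => Subtype.ext (((key _).1 a.2).1.trans ((key _).1 b.2).1.symm)⟩,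
        ⟨⟨⊤, (key _).2 ⟨rfl, e⟩⟩⟩⟩
    erw [h1]
    rw [aut_congr e]
    simp [aut_ne_zero]
  · have : IsEmpty (Sub A PUnit.{u + 1} N L) :=
      ⟨fun U => h (isoClass_eq_iff.2 ((key _).1 U.2).2).symm⟩
    have h1 : Nat.card (Sub A PUnit.{u + 1} N L) = 0 := Nat.card_of_isEmpty
    erw [h1]
    simp

open Classical in
theorem hallNumber_zero_right (M L : FGModuleCat.{u} A) :
    hallNumber M (FGModuleCat.of A PUnit) L = if (⟦M⟧ : IsoClass A) = ⟦L⟧ then 1 else 0 := by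
  rw [hallNumber_eq]
  have h0 : aut (FGModuleCat.of A PUnit.{u + 1}) = 1 := by
    unfold aut
    have : Nat.card (PUnit.{u + 1} ≃ₗ[A] PUnit.{u + 1}) = 1 := by
      rw [Nat.card_eq_one_iff_unique]
      exact ⟨⟨fun a b => by ext⟩, ⟨LinearEquiv.refl _ _⟩⟩
    exact_mod_cast this
  rw [h0, one_mul]
  have key : ∀ U : Submodule A L, (Nonempty (U ≃ₗ[A] PUnit.{u + 1}) ∧
      Nonempty ((L ⧸ U) ≃ₗ[A] M)) ↔ U = ⊥ ∧ Nonempty (L ≃ₗ[A] M) := by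
    intro U
    constructor
    · rintro ⟨⟨e⟩, ⟨e'⟩⟩
      have : Subsingleton U := e.toEquiv.subsingleton
      have hU : U = ⊥ := Submodule.subsingleton_iff_eq_bot.1 this
      subst hU
      exact ⟨rfl, ⟨(Submodule.quotEquivOfEqBot _ rfl).symm.trans e'⟩⟩
    · rintro ⟨rfl, ⟨e⟩⟩
      exact ⟨⟨LinearEquiv.ofSubsingleton _ _⟩, ⟨(Submodule.quotEquivOfEqBot _ rfl).trans e⟩⟩
  split_ifs with h
  · have e := isoClass_eq_iff.1 h.symm
    have h1 : Nat.card (Sub A M PUnit.{u + 1} L) = 1 := by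
      rw [Nat.card_eq_one_iff_unique]
      exact ⟨⟨fun a b => Subtype.ext (((key _).1 a.2).1.trans ((key _).1 b.2).1.symm)⟩,
        ⟨⟨⊥, (key _).2 ⟨rfl, e⟩⟩⟩⟩
    erw [h1]
    rw [aut_congr e]
    simp [aut_ne_zero]
  · have : IsEmpty (Sub A M PUnit.{u + 1} L) :=
      ⟨fun U => h (isoClass_eq_iff.2 ((key _).1 U.2).2).symm⟩
    have h1 : Nat.card (Sub A M PUnit.{u + 1} L) = 0 := Nat.card_of_isEmpty
    erw [h1]
    simp

theorem one_mulLin (x : HallSpace A) : mulLin (cls (FGModuleCat.of A PUnit)) x = x := by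
  refine LinearMap.congr_fun (g := LinearMap.id) (basis_ext fun N => ?_) x
  obtain ⟨N, rfl⟩ := Quotient.exists_rep N
  refine Finsupp.ext fun L => ?_
  obtain ⟨L, rfl⟩ := Quotient.exists_rep L
  refine (mulLin_cls _ N L).trans ?_
  rw [hallNumber_zero_left]
  classical
  exact (Finsupp.single_apply).symm

theorem mulLin_one (x : HallSpace A) : mulLin x (cls (FGModuleCat.of A PUnit)) = x := by
  refine LinearMap.congr_fun (f := mulLin.flip (cls (FGModuleCat.of A PUnit)))
    (g := LinearMap.id) (basis_ext fun N => ?_) x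
  obtain ⟨N, rfl⟩ := Quotient.exists_rep N
  refine Finsupp.ext fun L => ?_
  obtain ⟨L, rfl⟩ := Quotient.exists_rep L
  refine (mulLin_cls N _ L).trans ?_
  rw [hallNumber_zero_right]
  classical
  exact (Finsupp.single_apply).symm

theorem mulLin_add_left (x y z : HallSpace A) :
    mulLin (x + y) z = mulLin x z + mulLin y z := by
  rw [map_add, LinearMap.add_apply]

theorem mulLin_zero_left (x : HallSpace A) : mulLin 0 x = 0 := by
  rw [map_zero, LinearMap.zero_apply]

theorem mulLin_smul_left (r : ℚ) (x y : HallSpace A) : mulLin (r • x) y = r • mulLin x y := by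
  rw [map_smul, LinearMap.smul_apply]

end HallSpace

variable (A) in
/-- The Ringel-Hall algebra of the category of finitely generated `A`-modules. -/
def Hall : Type (u + 1) := HallSpace A

namespace Hall

noncomputable instance : AddCommGroup (Hall A) := inferInstanceAs (AddCommGroup (HallSpace A))
noncomputable instance : Module ℚ (Hall A) := inferInstanceAs (Module ℚ (HallSpace A))

noncomputable instance : Ring (Hall A) :=
  { (inferInstance : AddCommGroup (Hall A)) with
    mul := fun x y => HallSpace.mulLin x y
    one := HallSpace.cls (FGModuleCat.of A PUnit)
    left_distrib := fun x y z => map_add (HallSpace.mulLin x) y z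
    right_distrib := fun x y z => HallSpace.mulLin_add_left x y z
    zero_mul := fun x => HallSpace.mulLin_zero_left x
    mul_zero := fun x => map_zero (HallSpace.mulLin x)
    mul_assoc := fun x y z => HallSpace.mulLin_assoc x y z
    one_mul := fun x => HallSpace.one_mulLin x
    mul_one := fun x => HallSpace.mulLin_one x }

noncomputable instance : Algebra ℚ (Hall A) :=
  Algebra.ofModule
    (fun r x y => HallSpace.mulLin_smul_left r x y)
    (fun r x y => map_smul (HallSpace.mulLin x) r y)

variable (A) in
/-- The Hall algebra as the free `ℚ`-vector space on the isomorphism classes. -/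
noncomputable def toFinsupp : Hall A ≃ₗ[ℚ] (IsoClass A →₀ ℚ) := LinearEquiv.refl ℚ (HallSpace A)

/-- The basis element `[M]`. -/
noncomputable def cls (M : FGModuleCat.{u} A) : Hall A :=
  (toFinsupp A).symm (Finsupp.single ⟦M⟧ 1)

theorem toFinsupp_cls_mul_cls (M N L : FGModuleCat.{u} A) :
    toFinsupp A (cls M * cls N) ⟦L⟧ =
      (Nat.card (ExtMid M N L) : ℚ) / (Nat.card (M.obj ⟶ N.obj) : ℚ) :=
  HallSpace.mulLin_cls M N L

theorem one_eq_cls : (1 : Hall A) = cls (FGModuleCat.of A PUnit) := rfl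

end Hall
end HallAlgebra

/-! ### Universal localization -/

section Localization

variable {R : Type v} [Ring R] [Algebra ℚ R]

/-- The relations, in the free algebra on symbols `r` (`r ∈ R`) and `s⁻¹` (`s ∈ S`), making the
symbols `r` a homomorphic image of `R` in which every `s ∈ S` has the two-sided inverse `s⁻¹`. -/
inductive LocRel (S : Set R) : FreeAlgebra ℚ (R ⊕ S) → FreeAlgebra ℚ (R ⊕ S) → Prop
  | add (a b : R) : LocRel S (FreeAlgebra.ι ℚ (.inl (a + b)))
      (FreeAlgebra.ι ℚ (.inl a) + FreeAlgebra.ι ℚ (.inl b))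
  | mul (a b : R) : LocRel S (FreeAlgebra.ι ℚ (.inl (a * b)))
      (FreeAlgebra.ι ℚ (.inl a) * FreeAlgebra.ι ℚ (.inl b))
  | scalar (c : ℚ) : LocRel S (FreeAlgebra.ι ℚ (.inl (algebraMap ℚ R c)))
      (algebraMap ℚ (FreeAlgebra ℚ (R ⊕ S)) c)
  | mul_inv (s : S) : LocRel S (FreeAlgebra.ι ℚ (.inl s.1) * FreeAlgebra.ι ℚ (.inr s)) 1
  | inv_mul (s : S) : LocRel S (FreeAlgebra.ι ℚ (.inr s) * FreeAlgebra.ι ℚ (.inl s.1)) 1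

/-- The localization `R[S⁻¹]` of a (noncommutative) `ℚ`-algebra `R` at a subset `S`: the universal
`S`-inverting algebra. When `S` is a right Ore, right reversible multiplicative set, this is the
right Ore localization. -/
abbrev Loc (S : Set R) : Type v := RingQuot (LocRel S)

namespace Loc

variable (S : Set R)

/-- The localization map `R → R[S⁻¹]`. -/
noncomputable def of : R →ₐ[ℚ] Loc S :=
  AlgHom.ofLinearMap
    { toFun := fun r => RingQuot.mkAlgHom ℚ (LocRel S) (FreeAlgebra.ι ℚ (.inl r))
      map_add' := fun a b => by
        rw [RingQuot.mkAlgHom_rel ℚ (LocRel.add a b), map_add]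
      map_smul' := fun c a => by
        rw [Algebra.smul_def, RingQuot.mkAlgHom_rel ℚ (LocRel.mul _ a), map_mul,
          RingQuot.mkAlgHom_rel ℚ (LocRel.scalar c), AlgHom.commutes, RingHom.id_apply,
          Algebra.smul_def] }
    (by
      change RingQuot.mkAlgHom ℚ (LocRel S) (FreeAlgebra.ι ℚ (.inl 1)) = 1
      rw [← map_one (algebraMap ℚ R), RingQuot.mkAlgHom_rel ℚ (LocRel.scalar 1), map_one,
        map_one])
    (fun a b => by
      change RingQuot.mkAlgHom ℚ (LocRel S) (FreeAlgebra.ι ℚ (.inl (a * b))) =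
        RingQuot.mkAlgHom ℚ (LocRel S) (FreeAlgebra.ι ℚ (.inl a)) *
          RingQuot.mkAlgHom ℚ (LocRel S) (FreeAlgebra.ι ℚ (.inl b))
      rw [RingQuot.mkAlgHom_rel ℚ (LocRel.mul a b), map_mul])

theorem isUnit_of {s : R} (hs : s ∈ S) : IsUnit (of S s) :=
  ⟨⟨of S s, RingQuot.mkAlgHom ℚ (LocRel S) (FreeAlgebra.ι ℚ (.inr ⟨s, hs⟩)),
    by
      have := RingQuot.mkAlgHom_rel ℚ (LocRel.mul_inv (⟨s, hs⟩ : S))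
      rwa [map_mul, map_one] at this,
    by
      have := RingQuot.mkAlgHom_rel ℚ (LocRel.inv_mul (⟨s, hs⟩ : S))
      rwa [map_mul, map_one] at this⟩, rfl⟩

/-- The universal property: an algebra map inverting `S` extends uniquely to `R[S⁻¹]`. -/
theorem existsUnique_lift {B : Type*} [Ring B] [Algebra ℚ B] (f : R →ₐ[ℚ] B)
    (hf : ∀ s ∈ S, IsUnit (f s)) : ∃! F : Loc S →ₐ[ℚ] B, F.comp (of S) = f := by
  let g : FreeAlgebra ℚ (R ⊕ S) →ₐ[ℚ] B := FreeAlgebra.lift ℚ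
    (Sum.elim f fun s => ((hf s.1 s.2).unit⁻¹ : Bˣ))
  have hl : ∀ r, g (FreeAlgebra.ι ℚ (.inl r)) = f r := fun r => by simp [g]
  have hr : ∀ s : S, g (FreeAlgebra.ι ℚ (.inr s)) = ((hf s.1 s.2).unit⁻¹ : Bˣ) :=
    fun s => by simp [g]
  have hg : ∀ ⦃x y⦄, LocRel S x y → g x = g y := by
    intro x y h
    cases h with
    | add a b => rw [map_add, hl, hl, hl, map_add]
    | mul a b => rw [map_mul, hl, hl, hl, map_mul]
    | scalar c => rw [hl, AlgHom.commutes, AlgHom.commutes]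
    | mul_inv s => rw [map_mul, hl, hr, map_one]; exact (hf s.1 s.2).mul_val_inv
    | inv_mul s => rw [map_mul, hl, hr, map_one]; exact (hf s.1 s.2).val_inv_mul
  refine ⟨RingQuot.liftAlgHom ℚ ⟨g, hg⟩, ?_, ?_⟩
  · ext r
    change RingQuot.liftAlgHom ℚ ⟨g, hg⟩ (RingQuot.mkAlgHom ℚ (LocRel S) _) = f r
    rw [RingQuot.liftAlgHom_mkAlgHom_apply, hl]
  · intro F hF
    refine RingQuot.liftAlgHom_unique ℚ g hg F ?_
    refine FreeAlgebra.hom_ext (funext fun x => ?_)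
    change F (RingQuot.mkAlgHom ℚ (LocRel S) (FreeAlgebra.ι ℚ x)) = g (FreeAlgebra.ι ℚ x)
    have hFl : ∀ r, F (RingQuot.mkAlgHom ℚ (LocRel S) (FreeAlgebra.ι ℚ (.inl r))) = f r :=
      fun r => AlgHom.congr_fun hF r
    rcases x with r | s
    · rw [hFl, hl]
    · rw [hr]
      have h1 := congrArg F (RingQuot.mkAlgHom_rel ℚ (LocRel.inv_mul s))
      rw [map_mul, map_mul, map_one, map_one, hFl] at h1
      exact Units.eq_inv_of_mul_eq_one_right (u := (hf s.1 s.2).unit) h1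

end Loc

end Localization

/-! ### Modified Ringel-Hall algebras -/

section Modified

variable (A : Type u) [Ring A] [Finite A]

/-- The relations `[L] = [K ⊕ M]` for all short exact sequences `0 → K → L → M → 0` of finitely
generated modules with `K` of projective dimension at most one. -/
inductive ModRel : Hall A → Hall A → Prop
  | of_ses (K L M : FGModuleCat.{u} A) (f : K →ₗ[A] L) (g : L →ₗ[A] M) (h : IsSES f g)
      (hK : HasProjectiveDimensionLE K.obj 1) :
      ModRel (Hall.cls L) (Hall.cls (FGModuleCat.of A (K × M)))

/-- The quotient of the Hall algebra by the two-sided ideal generated by the differences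
`[L] - [K ⊕ M]`. -/
abbrev HallQuot : Type (u + 1) := RingQuot (ModRel A)

/-- The set of all `a [K]` with `a ∈ ℚ` nonzero and `K` of projective dimension at most one. -/
def denominators : Set (HallQuot A) :=
  {s | ∃ (a : ℚ) (K : FGModuleCat.{u} A), a ≠ 0 ∧ HasProjectiveDimensionLE K.obj 1 ∧
    s = a • RingQuot.mkAlgHom ℚ (ModRel A) (Hall.cls K)}

/-- The modified Ringel-Hall algebra of `A`. -/
abbrev MH : Type (u + 1) := Loc (denominators A)

variable {A} in
/-- The class of a module in the modified Ringel-Hall algebra. -/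
noncomputable def MH.cls (M : FGModuleCat.{u} A) : MH A :=
  Loc.of (denominators A) (RingQuot.mkAlgHom ℚ (ModRel A) (Hall.cls M))

end Modified

/-! ### Gorenstein algebras and tilting modules -/

section Tilting

variable {A : Type u} [Ring A]

variable (A) in
/-- `A` has injective dimension at most one as a left and as a right module over itself. -/
structure IsOneGorenstein : Prop where
  left : HasInjectiveDimensionLE (ModuleCat.of A A) 1
  right : HasInjectiveDimensionLE (ModuleCat.of Aᵐᵒᵖ A) 1

/-- `M ∈ add T`: `M` is a direct summand of a finite direct sum of copies of `T`. -/
def InAdd (T M : FGModuleCat.{u} A) : Prop :=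
  ∃ (n : ℕ) (i : M →ₗ[A] (Fin n → T)) (p : (Fin n → T) →ₗ[A] M), p ∘ₗ i = LinearMap.id

/-- `M ∈ Fac T`: `M` is an epimorphic image of an object of `add T`. -/
def InFac (T M : FGModuleCat.{u} A) : Prop :=
  ∃ (T₀ : FGModuleCat.{u} A) (p : T₀ →ₗ[A] M), InAdd T T₀ ∧ Function.Surjective p

/-- Tilting modules (of projective dimension at most one). -/
structure IsTilting (T : FGModuleCat.{u} A) : Prop where
  projDim : HasProjectiveDimensionLE T.obj 1
  ext_self : ∀ i : ℕ, 0 < i → Subsingleton (Ext T.obj T.obj i)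
  coresolution : ∃ (T₀ T₁ : FGModuleCat.{u} A) (f : A →ₗ[A] T₀) (g : T₀ →ₗ[A] T₁),
    InAdd T T₀ ∧ InAdd T T₁ ∧ IsSES f g

/-- The opposite endomorphism algebra `End_A(T)ᵒᵖ`. -/
abbrev EndOp (T : FGModuleCat.{u} A) : Type u := (Module.End A T)ᵐᵒᵖ

/-- The abelian group `Hom_A(T, M)`. -/
def HomFrom (T M : FGModuleCat.{u} A) : Type u := T →ₗ[A] M

instance (T M : FGModuleCat.{u} A) : AddCommGroup (HomFrom T M) :=
  inferInstanceAs (AddCommGroup (T →ₗ[A] M))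

/-- `End_A(T)ᵒᵖ` acts on `Hom_A(T, M)` from the left by precomposition. -/
instance (T M : FGModuleCat.{u} A) : Module (EndOp T) (HomFrom T M) where
  smul φ f := LinearMap.comp (show T →ₗ[A] M from f) φ.unop
  one_smul f := LinearMap.comp_id (show T →ₗ[A] M from f)
  mul_smul φ ψ f := (LinearMap.comp_assoc φ.unop ψ.unop (show T →ₗ[A] M from f)).symm
  smul_zero φ := LinearMap.zero_comp φ.unop
  smul_add φ f g := LinearMap.add_comp φ.unop (show T →ₗ[A] M from g) (show T →ₗ[A] M from f)
  add_smul φ ψ f := LinearMap.comp_add φ.unop ψ.unop (show T →ₗ[A] M from f)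
  zero_smul f := LinearMap.comp_zero (show T →ₗ[A] M from f)

variable [Finite A]

instance (T : FGModuleCat.{u} A) : Finite (EndOp T) :=
  Finite.of_equiv (T →ₗ[A] T) MulOpposite.opEquiv

instance (T M : FGModuleCat.{u} A) : Finite (HomFrom T M) :=
  inferInstanceAs (Finite (T →ₗ[A] M))

/-- The functor `F = Hom_A(T, -)` on objects, with values in `End_A(T)ᵒᵖ`-modules. -/
def homFunctor (T M : FGModuleCat.{u} A) : FGModuleCat.{u} (EndOp T) :=
  FGModuleCat.of (EndOp T) (HomFrom T M)

end Tilting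

/-- The Euler form `⟨K, M⟩ = dim Hom(K, M) - dim Ext¹(K, M)`, for `K` of projective dimension at
most one. -/
noncomputable def eulerForm (k : Type v) [Field k] {A : Type u} [Ring A] [Algebra k A]
    (K M : FGModuleCat.{u} A) : ℤ :=
  (Module.finrank k (K.obj ⟶ M.obj) : ℤ) - (Module.finrank k (Ext K.obj M.obj 1) : ℤ)

end RingelHall

/-!
# Tilting invariance of modified Ringel-Hall algebras

Write `χ(M, N) = |Ext¹(M, N)| / |Hom(M, N)|`. In the modified Ringel-Hall algebra the classes of the
modules `K` of projective dimension at most one are invertible, and every short exact sequence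
`0 → K → L → M → 0` or `0 → M → L → K → 0` gives `[K] [M] = χ(K, M) [L]`. So `[M]` is determined by
the classes of the modules in a class that is large enough, and the theorem comes from a comparison
of such classes: the functor `F = Hom(T, -)` is an exact, fully faithful functor from the torsion
class `Fac T` onto a torsion-free class of `Γ`-modules (`InHom T`), and it preserves Hall products,
Euler forms and projective dimension at most one.

* A function on modules that is multiplicative on Hall products, is compatible with the sequences
  above, and has invertible values on modules of projective dimension at most one
  (`IsHallMap`) is the same as an algebra map on the modified Ringel-Hall algebra
  (`IsHallMap.exists_algHom`).
* Every module `M` is the kernel of an epimorphism `X → T'` with `X` in `Fac T` and `T'` in `add T`.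
  A function `ρ` with these properties on `Fac T` extends to all modules by
  `ρ(T') ρ(M) = χ(T', M) ρ(X)` (`ExtendsFac.isHallMap`).
* Every `Γ`-module `N` is the cokernel of a monomorphism `P → Y` with `P` projective and `Y` a
  submodule of a projective module, because `N` embeds in a module of projective dimension at most
  one. A function on the torsion-free class extends by `ρ(P) ρ(N) = χ(P, N) ρ(Y)`
  (`ExtendsSub.isHallMap`).

In both cases the point is that the extension is still multiplicative. Hall products are computed as
`[M] [N] = |Hom(F, N)|⁻¹ ∑ [F ⊔ N]`, a sum of pushouts of a presentation `0 → Ω → F → M → 0` over the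
maps `Ω → N` (`Hall.cls_mul_cls`). Such sums can be compared along short exact sequences in either
variable, under vanishing conditions on `Ext` (`MultAt.of_left_quot`, `MultAt.of_left_sub`,
`MultAt.of_right_quot`, `MultAt.of_right_sub`). The Gorenstein hypotheses give these conditions:
injective dimension at most one of the left regular module makes `Ext²(-, K)` vanish for `K` of
projective dimension at most one; injective dimension at most one of the right regular module gives
that every module embeds in one of projective dimension at most one (`exists_embedding_pd1`).

Applied to `[F(-)]` on `Fac T` and to a quasi-inverse of `F` on its image, the two extensions give
algebra maps in both directions, which are inverse to each other on generators.
-/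

namespace RingelHall

/-! ### Short exact sequences of modules -/

section ShortExact

variable {A : Type u} [Ring A]

section Unbundled

variable {K L M N C K' M' L' : Type u}
  [AddCommGroup K] [Module A K] [AddCommGroup L] [Module A L] [AddCommGroup M] [Module A M]
  [AddCommGroup N] [Module A N] [AddCommGroup C] [Module A C] [AddCommGroup K'] [Module A K']
  [AddCommGroup M'] [Module A M'] [AddCommGroup L'] [Module A L']

theorem IsSES.apply_eq_zero {f : K →ₗ[A] L} {g : L →ₗ[A] M} (h : IsSES f g) (x : K) :
    g (f x) = 0 := (h.2.1 _).2 ⟨x, rfl⟩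

theorem isSES_ker {g : L →ₗ[A] M} (hg : Function.Surjective g) :
    IsSES (LinearMap.ker g).subtype g :=
  ⟨Submodule.injective_subtype _, by rw [LinearMap.exact_iff]; simp, hg⟩

theorem isSES_mkQ (U : Submodule A L) : IsSES U.subtype U.mkQ :=
  ⟨Submodule.injective_subtype _, by rw [LinearMap.exact_iff]; simp, U.mkQ_surjective⟩

theorem isSES_coker {f : K →ₗ[A] L} (hf : Function.Injective f) :
    IsSES f (LinearMap.range f).mkQ :=
  ⟨hf, by rw [LinearMap.exact_iff]; simp, Submodule.mkQ_surjective _⟩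

theorem IsSES.congr_right {f : K →ₗ[A] L} {g : L →ₗ[A] M} (h : IsSES f g) (e : M ≃ₗ[A] M') :
    IsSES f (e.toLinearMap ∘ₗ g) :=
  ⟨h.1, fun x => by simpa using h.2.1 x, e.surjective.comp h.2.2⟩

theorem IsSES.congr_left {f : K →ₗ[A] L} {g : L →ₗ[A] M} (h : IsSES f g) (e : K' ≃ₗ[A] K) :
    IsSES (f ∘ₗ e.toLinearMap) g := by
  refine ⟨h.1.comp e.injective, fun x => (h.2.1 x).trans ⟨?_, ?_⟩, h.2.2⟩
  · rintro ⟨y, rfl⟩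
    exact ⟨e.symm y, by simp⟩
  · rintro ⟨y, rfl⟩
    exact ⟨e y, rfl⟩

theorem IsSES.congr_mid {f : K →ₗ[A] L} {g : L →ₗ[A] M} (h : IsSES f g) (e : L ≃ₗ[A] L') :
    IsSES (e.toLinearMap ∘ₗ f) (g ∘ₗ e.symm.toLinearMap) := by
  refine ⟨e.injective.comp h.1, fun x => ?_, h.2.2.comp e.symm.surjective⟩
  refine (h.2.1 (e.symm x)).trans ⟨?_, ?_⟩
  · rintro ⟨y, hy⟩
    exact ⟨y, by simp [hy]⟩
  · rintro ⟨y, rfl⟩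
    exact ⟨y, by simp⟩

theorem isSES_inl_snd : IsSES (LinearMap.inl A K M) (LinearMap.snd A K M) :=
  ⟨LinearMap.inl_injective, LinearMap.exact_iff.2 (LinearMap.ker_snd _ _ _),
    LinearMap.snd_surjective⟩

theorem isSES_inr_fst : IsSES (LinearMap.inr A M K) (LinearMap.fst A M K) :=
  ⟨LinearMap.inr_injective, LinearMap.exact_iff.2 (LinearMap.ker_fst _ _ _),
    LinearMap.fst_surjective⟩

theorem isSES_zero_id : IsSES (0 : PUnit.{u + 1} →ₗ[A] L) (LinearMap.id : L →ₗ[A] L) :=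
  ⟨fun _ _ _ => rfl, fun x => by simp [eq_comm], Function.surjective_id⟩

theorem isSES_id_zero : IsSES (LinearMap.id : L →ₗ[A] L) (0 : L →ₗ[A] PUnit.{u + 1}) :=
  ⟨Function.injective_id, fun x => by simp, fun x => ⟨0, rfl⟩⟩

/-- The product of a short exact sequence with a fixed module in the first two terms. -/
theorem IsSES.prod_right {f : K →ₗ[A] L} {g : L →ₗ[A] M} (h : IsSES f g) :
    IsSES (f.prodMap (LinearMap.id : N →ₗ[A] N)) (g ∘ₗ LinearMap.fst A L N) := by
  refine ⟨h.1.prodMap Function.injective_id, fun x => (h.2.1 x.1).trans ⟨?_, ?_⟩,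
    h.2.2.comp LinearMap.fst_surjective⟩
  · rintro ⟨y, hy⟩
    exact ⟨(y, x.2), Prod.ext hy rfl⟩
  · rintro ⟨y, rfl⟩
    exact ⟨y.1, rfl⟩

/-- The product of a fixed module with a short exact sequence in the first two terms. -/
theorem IsSES.prod_right' {f : K →ₗ[A] L} {g : L →ₗ[A] M} (h : IsSES f g) :
    IsSES ((LinearMap.id : N →ₗ[A] N).prodMap f) (g ∘ₗ LinearMap.snd A N L) := by
  refine ⟨Function.injective_id.prodMap h.1, fun x => (h.2.1 x.2).trans ⟨?_, ?_⟩,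
    h.2.2.comp LinearMap.snd_surjective⟩
  · rintro ⟨y, hy⟩
    exact ⟨(x.1, y), Prod.ext rfl hy⟩
  · rintro ⟨y, rfl⟩
    exact ⟨y.2, rfl⟩

/-- The product of a short exact sequence with a fixed module in the last two terms. -/
theorem IsSES.prod_left {f : K →ₗ[A] L} {g : L →ₗ[A] M} (h : IsSES f g) :
    IsSES (LinearMap.inl A L N ∘ₗ f) (g.prodMap (LinearMap.id : N →ₗ[A] N)) := by
  refine ⟨LinearMap.inl_injective.comp h.1, fun x => ?_,
    h.2.2.prodMap Function.surjective_id⟩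
  constructor
  · intro hx
    obtain ⟨y, hy⟩ := (h.2.1 x.1).1 (congrArg Prod.fst hx)
    exact ⟨y, Prod.ext hy (congrArg Prod.snd hx).symm⟩
  · rintro ⟨y, rfl⟩
    exact Prod.ext (h.apply_eq_zero y) rfl

/-- A map out of the middle term killing the left term descends to the right term. -/
theorem IsSES.exists_desc {f : K →ₗ[A] L} {g : L →ₗ[A] M} (h : IsSES f g) (t : L →ₗ[A] N)
    (ht : t ∘ₗ f = 0) : ∃ s : M →ₗ[A] N, s ∘ₗ g = t := by
  let e := g.quotKerEquivOfSurjective h.2.2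
  have hle : LinearMap.ker g ≤ LinearMap.ker t := by
    rw [LinearMap.exact_iff.1 h.2.1]
    rintro _ ⟨y, rfl⟩
    exact LinearMap.congr_fun ht y
  refine ⟨(LinearMap.ker g).liftQ t hle ∘ₗ e.symm.toLinearMap, ?_⟩
  ext x
  have : e.symm (g x) = (LinearMap.ker g).mkQ x := by
    rw [LinearEquiv.symm_apply_eq]; rfl
  simp [this]

/-- A map into the middle term killed by the right map factors through the left term. -/
theorem IsSES.exists_lift {f : K →ₗ[A] L} {g : L →ₗ[A] M} (h : IsSES f g) (t : N →ₗ[A] L)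
    (ht : g ∘ₗ t = 0) : ∃ s : N →ₗ[A] K, f ∘ₗ s = t := by
  let e := LinearEquiv.ofInjective f h.1
  have hr : ∀ x, t x ∈ LinearMap.range f := fun x => (h.2.1 _).1 (LinearMap.congr_fun ht x)
  refine ⟨e.symm.toLinearMap ∘ₗ t.codRestrict _ hr, ?_⟩
  ext x
  have : ∀ y, f (e.symm y) = y := fun y => by
    obtain ⟨z, rfl⟩ := e.surjective y
    rw [e.symm_apply_apply]; rfl
  simp [this]

theorem IsSES.desc_unique {f : K →ₗ[A] L} {g : L →ₗ[A] M} (h : IsSES f g) {s s' : M →ₗ[A] N}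
    (e : s ∘ₗ g = s' ∘ₗ g) : s = s' := by
  ext y
  obtain ⟨x, rfl⟩ := h.2.2 y
  exact LinearMap.congr_fun e x

theorem IsSES.lift_unique {f : K →ₗ[A] L} {g : L →ₗ[A] M} (h : IsSES f g) {s s' : N →ₗ[A] K}
    (e : f ∘ₗ s = f ∘ₗ s') : s = s' := by
  ext y
  exact h.1 (LinearMap.congr_fun e y)

/-- Isomorphic left and middle terms give isomorphic right terms. -/
theorem IsSES.equiv_right {f : K →ₗ[A] L} {g : L →ₗ[A] M} {f' : K' →ₗ[A] L'} {g' : L' →ₗ[A] M'}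
    (h : IsSES f g) (h' : IsSES f' g') (a : K ≃ₗ[A] K') (b : L ≃ₗ[A] L')
    (hab : b.toLinearMap ∘ₗ f = f' ∘ₗ a.toLinearMap) : Nonempty (M ≃ₗ[A] M') := by
  have h2 : IsSES (f' ∘ₗ a.toLinearMap) (g ∘ₗ b.symm.toLinearMap) := hab ▸ h.congr_mid b
  have h3 := h'.congr_left a
  obtain ⟨s, hs⟩ := h2.exists_desc g' (by ext x; exact h3.apply_eq_zero x)
  obtain ⟨t, ht⟩ := h3.exists_desc (g ∘ₗ b.symm.toLinearMap)
    (by ext x; exact h2.apply_eq_zero x)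
  refine ⟨LinearEquiv.ofLinearMap s t (h3.desc_unique ?_) (h2.desc_unique ?_)⟩
  · rw [LinearMap.comp_assoc, ht, hs, LinearMap.id_comp]
  · rw [LinearMap.comp_assoc, hs, ht, LinearMap.id_comp]

/-- The short five lemma. -/
theorem IsSES.bijective_mid {f : K →ₗ[A] L} {g : L →ₗ[A] M} {f' : K →ₗ[A] L'} {g' : L' →ₗ[A] M}
    (h : IsSES f g) (h' : IsSES f' g') (b : L →ₗ[A] L') (h1 : b ∘ₗ f = f') (h2 : g' ∘ₗ b = g) :
    Function.Bijective b := by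
  constructor
  · rw [injective_iff_map_eq_zero]
    intro x hx
    have : g x = 0 := by rw [← h2]; simp [hx]
    obtain ⟨y, rfl⟩ := (h.2.1 _).1 this
    have h4 : f' y = 0 := by rw [← h1]; exact hx
    rw [(injective_iff_map_eq_zero _).1 h'.1 y h4, map_zero]
  · intro z
    obtain ⟨x, hx⟩ := h.2.2 (g' z)
    have : g' (z - b x) = 0 := by
      rw [map_sub, ← hx, ← h2]; simp
    obtain ⟨y, hy⟩ := (h'.2.1 _).1 this
    refine ⟨x + f y, ?_⟩
    have : b (f y) = f' y := LinearMap.congr_fun h1 y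
    rw [map_add, this, hy]; abel

theorem IsSES.equiv_prod_of_section {f : K →ₗ[A] L} {g : L →ₗ[A] M} (h : IsSES f g)
    (s : M →ₗ[A] L) (hs : g ∘ₗ s = LinearMap.id) : Nonempty ((K × M) ≃ₗ[A] L) := by
  refine ⟨LinearEquiv.ofBijective (f.coprod s)
    (isSES_inl_snd.bijective_mid h _ (LinearMap.coprod_inl _ _) ?_)⟩
  ext x
  · simp [h.apply_eq_zero]
  · simpa using LinearMap.congr_fun hs x

/-- In the pushout square of a map out of the left term of a short exact sequence, the two maps
out of the middle and right terms have the same kernel. -/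
theorem IsSES.quotient_of_lift {Ω Y E E' : Type u} [AddCommGroup Ω] [Module A Ω] [AddCommGroup Y]
    [Module A Y] [AddCommGroup E] [Module A E] [AddCommGroup E'] [Module A E']
    {a : K →ₗ[A] Y} {b : Y →ₗ[A] C} (h : IsSES a b) {j' : Ω →ₗ[A] Y} {p' : Y →ₗ[A] E'}
    (h' : IsSES j' p') {j : Ω →ₗ[A] C} {p : C →ₗ[A] E} (hE : IsSES j p)
    (hj : b ∘ₗ j' = j) : ∃ r : E' →ₗ[A] E, IsSES (p' ∘ₗ a) r := by
  obtain ⟨r, hr⟩ := h'.exists_desc (p ∘ₗ b) (by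
    rw [LinearMap.comp_assoc, hj]; ext x; exact hE.apply_eq_zero x)
  have hr' : ∀ y, r (p' y) = p (b y) := fun y => LinearMap.congr_fun hr y
  have hj' : ∀ w, b (j' w) = j w := fun w => LinearMap.congr_fun hj w
  refine ⟨r, ?_, ?_, ?_⟩
  · rw [injective_iff_map_eq_zero]
    intro x hx
    obtain ⟨w, hw⟩ := (h'.2.1 _).1 hx
    have : j w = 0 := by rw [← hj', hw, h.apply_eq_zero]
    have hw0 : w = 0 := (injective_iff_map_eq_zero _).1 hE.1 w this
    exact (injective_iff_map_eq_zero _).1 h.1 x (by rw [← hw, hw0, map_zero])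
  · intro e
    obtain ⟨y, rfl⟩ := h'.2.2 e
    rw [hr']
    constructor
    · intro hy
      obtain ⟨w, hw⟩ := (hE.2.1 _).1 hy
      have : b (y - j' w) = 0 := by rw [map_sub, hj', hw, sub_self]
      obtain ⟨x, hx⟩ := (h.2.1 _).1 this
      refine ⟨x, ?_⟩
      simp [hx, h'.apply_eq_zero]
    · rintro ⟨x, hx⟩
      rw [← hr', ← hx, LinearMap.comp_apply, hr', h.apply_eq_zero, map_zero]
  · intro e
    obtain ⟨c, rfl⟩ := hE.2.2 e
    obtain ⟨y, rfl⟩ := h.2.2 c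
    exact ⟨p' y, hr' y⟩

/-- A pushout of a monomorphism is a monomorphism, with the same cokernel. -/
theorem IsSES.pushout_inl {X E : Type u} [AddCommGroup X] [Module A X] [AddCommGroup E]
    [Module A E] {ι : K →ₗ[A] L} {π : L →ₗ[A] M} (h : IsSES ι π) {φ : K →ₗ[A] X}
    {q : X × L →ₗ[A] E} (hq : IsSES (φ.prod ι) q) :
    ∃ r : E →ₗ[A] M, IsSES (q ∘ₗ LinearMap.inl A X L) r ∧ r ∘ₗ q = π ∘ₗ LinearMap.snd A X L := by
  obtain ⟨r, hr⟩ := hq.exists_desc (π ∘ₗ LinearMap.snd A X L)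
    (by ext x; simp [h.apply_eq_zero])
  have hr' : ∀ y, r (q y) = π y.2 := fun y => LinearMap.congr_fun hr y
  refine ⟨r, ⟨?_, ?_, ?_⟩, hr⟩
  · rw [injective_iff_map_eq_zero]
    intro x hx
    obtain ⟨w, hw⟩ := (hq.2.1 _).1 hx
    have h2 : ι w = 0 := congrArg Prod.snd hw
    have h1 : φ w = x := congrArg Prod.fst hw
    rw [← h1, (injective_iff_map_eq_zero _).1 h.1 w h2, map_zero]
  · intro e
    obtain ⟨⟨x, y⟩, rfl⟩ := hq.2.2 e
    rw [hr']
    refine (h.2.1 y).trans ⟨?_, ?_⟩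
    · rintro ⟨w, rfl⟩
      refine ⟨x - φ w, ?_⟩
      have : q (φ w, ι w) = 0 := hq.apply_eq_zero w
      rw [LinearMap.comp_apply, LinearMap.inl_apply, ← add_zero (q (_, 0)), ← this, ← map_add]
      simp
    · rintro ⟨x', hx'⟩
      exact (h.2.1 y).1 (by rw [← hr' (x, y), ← hx', LinearMap.comp_apply, hr']; simp)
  · intro m
    obtain ⟨y, rfl⟩ := h.2.2 m
    exact ⟨q (0, y), hr' _⟩

end Unbundled

section Bundled

variable {K L M N C X X' Z : FGModuleCat.{u} A}

/-- The quotient of a module by a submodule of a submodule. -/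
theorem exists_quotient {i : M →ₗ[A] X} {p : X →ₗ[A] C} {f : K →ₗ[A] M} {g : M →ₗ[A] N}
    (h : IsSES i p) (h' : IsSES f g) :
    ∃ (Z : FGModuleCat.{u} A) (q : X →ₗ[A] Z) (a : N →ₗ[A] Z) (b : Z →ₗ[A] C),
      IsSES (i ∘ₗ f) q ∧ IsSES a b ∧ a ∘ₗ g = q ∘ₗ i ∧ b ∘ₗ q = p := by
  have hq := isSES_coker (f := i ∘ₗ f) (h.1.comp h'.1)
  obtain ⟨a, ha⟩ := h'.exists_desc ((LinearMap.range (i ∘ₗ f)).mkQ ∘ₗ i)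
    (by ext x; exact hq.apply_eq_zero x)
  obtain ⟨b, hb⟩ := hq.exists_desc p (by ext x; exact h.apply_eq_zero _)
  have ha' : ∀ x, a (g x) = (LinearMap.range (i ∘ₗ f)).mkQ (i x) :=
    fun x => LinearMap.congr_fun ha x
  have hb' : ∀ x, b ((LinearMap.range (i ∘ₗ f)).mkQ x) = p x := fun x => LinearMap.congr_fun hb x
  refine ⟨FGModuleCat.of A (X ⧸ LinearMap.range (i ∘ₗ f)), _, a, b, hq, ⟨?_, ?_, ?_⟩, ha, hb⟩
  · rw [injective_iff_map_eq_zero]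
    intro y hy
    obtain ⟨x, rfl⟩ := h'.2.2 y
    rw [ha'] at hy
    obtain ⟨z, hz⟩ := (hq.2.1 _).1 hy
    have : f z = x := h.1 hz
    rw [← this, h'.apply_eq_zero]
  · intro z
    obtain ⟨x, rfl⟩ := hq.2.2 z
    rw [hb']
    refine (h.2.1 x).trans ⟨?_, ?_⟩
    · rintro ⟨y, rfl⟩
      exact ⟨g y, ha' y⟩
    · rintro ⟨y, hy⟩
      obtain ⟨y, rfl⟩ := h'.2.2 y
      rw [ha', ← sub_eq_zero, ← map_sub] at hy
      obtain ⟨z, hz⟩ := (hq.2.1 _).1 hy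
      refine ⟨y - f z, ?_⟩
      change i (f z) = _ at hz
      rw [map_sub, hz]; abel
  · intro c
    obtain ⟨x, rfl⟩ := h.2.2 c
    exact ⟨_, hb' x⟩

/-- The pushout of two monomorphisms. -/
theorem exists_pushout {f : M →ₗ[A] X} {g : X →ₗ[A] C} {f' : M →ₗ[A] X'} {g' : X' →ₗ[A] N}
    (h : IsSES f g) (h' : IsSES f' g') :
    ∃ (Z : FGModuleCat.{u} A) (a : X →ₗ[A] Z) (b : Z →ₗ[A] N) (a' : X' →ₗ[A] Z) (b' : Z →ₗ[A] C),
      IsSES a b ∧ IsSES a' b' := by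
  have hq : IsSES (f'.prod f) (LinearMap.range (f'.prod f)).mkQ :=
    isSES_coker fun x y hxy => h.1 (congrArg Prod.snd hxy)
  obtain ⟨r, hr, -⟩ := h.pushout_inl hq
  have hq' := hq.congr_mid (LinearEquiv.prodComm A X' X)
  have e : (LinearEquiv.prodComm A X' X).toLinearMap ∘ₗ f'.prod f = f.prod f' := rfl
  rw [e] at hq'
  obtain ⟨r', hr', -⟩ := h'.pushout_inl hq'
  exact ⟨FGModuleCat.of A ((X' × X) ⧸ LinearMap.range (f'.prod f)), _, r', _, r, hr', hr⟩

variable [Finite A]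

/-- The preimage of a submodule under an epimorphism. -/
theorem exists_preimage {f : K →ₗ[A] N} {g : N →ₗ[A] Z} {m : M →ₗ[A] Z} {c : Z →ₗ[A] C}
    (h : IsSES f g) (h' : IsSES m c) :
    ∃ (W : FGModuleCat.{u} A) (a : K →ₗ[A] W) (b : W →ₗ[A] M) (j : W →ₗ[A] N),
      IsSES a b ∧ IsSES j (c ∘ₗ g) ∧ j ∘ₗ a = f ∧ m ∘ₗ b = g ∘ₗ j := by
  have hj := isSES_ker (g := c ∘ₗ g) (h'.2.2.comp h.2.2)
  obtain ⟨a, ha⟩ := hj.exists_lift f (by ext x; simp [h.apply_eq_zero])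
  obtain ⟨b, hb⟩ := h'.exists_lift (g ∘ₗ (LinearMap.ker (c ∘ₗ g)).subtype)
    (by ext x; exact LinearMap.mem_ker.1 x.2)
  have ha' : ∀ x, (a x : N) = f x := fun x => LinearMap.congr_fun ha x
  have hb' : ∀ x, m (b x) = g x := fun x => LinearMap.congr_fun hb x
  refine ⟨FGModuleCat.of A (LinearMap.ker (c ∘ₗ g)), a, b, _, ⟨?_, ?_, ?_⟩, hj, ha, hb⟩
  · intro x y hxy
    exact h.1 (by rw [← ha', ← ha', hxy])
  · intro w
    rw [← map_eq_zero_iff m h'.1, hb']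
    refine (h.2.1 _).trans ⟨?_, ?_⟩
    · rintro ⟨x, hx⟩
      exact ⟨x, Subtype.ext ((ha' x).trans hx)⟩
    · rintro ⟨x, rfl⟩
      exact ⟨x, (ha' x).symm⟩
  · intro y
    obtain ⟨n, hn⟩ := h.2.2 (m y)
    refine ⟨⟨n, ?_⟩, h'.1 ?_⟩
    · simp [hn, h'.apply_eq_zero]
    · rw [hb']; exact hn

/-- The pullback of two epimorphisms. -/
theorem exists_pullback {f : K →ₗ[A] X} {g : X →ₗ[A] Z} {f' : L →ₗ[A] X'} {g' : X' →ₗ[A] Z}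
    (h : IsSES f g) (h' : IsSES f' g') :
    ∃ (W : FGModuleCat.{u} A) (a : K →ₗ[A] W) (b : W →ₗ[A] X') (a' : L →ₗ[A] W) (b' : W →ₗ[A] X),
      IsSES a b ∧ IsSES a' b' := by
  let U : Submodule A (X × X') := LinearMap.ker (g.coprod (-g'))
  have mem : ∀ x, x ∈ U ↔ g x.1 = g' x.2 := fun x => by
    simp [U, LinearMap.mem_ker, ← sub_eq_add_neg, sub_eq_zero]
  refine ⟨FGModuleCat.of A U,
    (LinearMap.inl A X X' ∘ₗ f).codRestrict U (fun x => (mem _).2 (by simp [h.apply_eq_zero])),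
    LinearMap.snd A X X' ∘ₗ U.subtype,
    (LinearMap.inr A X X' ∘ₗ f').codRestrict U (fun x => (mem _).2 (by simp [h'.apply_eq_zero])),
    LinearMap.fst A X X' ∘ₗ U.subtype, ⟨?_, ?_, ?_⟩, ⟨?_, ?_, ?_⟩⟩
  · intro x y hxy
    exact h.1 (congrArg (fun w : U => w.1.1) hxy)
  · rintro ⟨⟨x, x'⟩, hx⟩
    constructor
    · intro h0
      change x' = 0 at h0
      subst h0
      obtain ⟨y, hy⟩ := (h.2.1 x).1 (by simpa using (mem _).1 hx)
      exact ⟨y, Subtype.ext (Prod.ext hy rfl)⟩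
    · rintro ⟨y, hy⟩
      exact (congrArg (fun w : U => w.1.2) hy).symm
  · intro x'
    obtain ⟨x, hx⟩ := h.2.2 (g' x')
    exact ⟨⟨(x, x'), (mem _).2 hx⟩, rfl⟩
  · intro x y hxy
    exact h'.1 (congrArg (fun w : U => w.1.2) hxy)
  · rintro ⟨⟨x, x'⟩, hx⟩
    constructor
    · intro h0
      change x = 0 at h0
      subst h0
      obtain ⟨y, hy⟩ := (h'.2.1 x').1 (by simpa using ((mem _).1 hx).symm)
      exact ⟨y, Subtype.ext (Prod.ext rfl hy)⟩
    · rintro ⟨y, hy⟩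
      exact (congrArg (fun w : U => w.1.1) hy).symm
  · intro x
    obtain ⟨x', hx⟩ := h'.2.2 (g x)
    exact ⟨⟨(x, x'), (mem _).2 hx.symm⟩, rfl⟩

end Bundled

end ShortExact

/-! ### Extensions, liftings and the multiplicative Euler form -/

section Lifting

variable {A : Type u} [Ring A]

/-- `Ext¹(F, N) = 0`, expressed as a lifting property: a map from `F` to a module `M` lifts to
every extension of `M` by `N`. -/
def Lifts (F N : FGModuleCat.{u} A) : Prop :=
  ∀ (L M : FGModuleCat.{u} A) (f : N →ₗ[A] L) (g : L →ₗ[A] M), IsSES f g →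
    ∀ π : F →ₗ[A] M, ∃ ψ : F →ₗ[A] L, g ∘ₗ ψ = π

/-- Projective dimension at most one. -/
abbrev PD1 (M : FGModuleCat.{u} A) : Prop := HasProjectiveDimensionLE M.obj 1

theorem lifts_of_projective {F N : FGModuleCat.{u} A} [Module.Projective A F] : Lifts F N :=
  fun _ _ _ g h π => Module.projective_lifting_property g π h.2.2

theorem exists_free_presentation [Finite A] (M : FGModuleCat.{u} A) :
    ∃ (Ω F : FGModuleCat.{u} A) (ι : Ω →ₗ[A] F) (π : F →ₗ[A] M),
      IsSES ι π ∧ Module.Projective A F := by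
  obtain ⟨n, p, hp⟩ := Module.Finite.exists_fin' A M
  exact ⟨FGModuleCat.of A (LinearMap.ker p), FGModuleCat.of A (Fin n → A), _, p, isSES_ker hp,
    inferInstanceAs (Module.Projective A (Fin n → A))⟩

variable {K L M N F Ω : FGModuleCat.{u} A}

/-- The short complex in the category of modules underlying a short exact sequence. -/
abbrev IsSES.sc {f : K →ₗ[A] L} {g : L →ₗ[A] M} (h : IsSES f g) : ShortComplex (ModuleCat.{u} A) :=
  ShortComplex.mk (X₁ := K.obj) (X₂ := L.obj) (X₃ := M.obj) (ModuleCat.ofHom f) (ModuleCat.ofHom g)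
    (Ses.sc (M := M) (N := K) (L := L) ⟨(f, g), h⟩).zero

theorem IsSES.shortExact {f : K →ₗ[A] L} {g : L →ₗ[A] M} (h : IsSES f g) : h.sc.ShortExact :=
  Ses.shortExact (M := M) (N := K) (L := L) ⟨(f, g), h⟩

theorem projective_iff_obj : Module.Projective A M ↔ Projective M.obj :=
  IsProjective.iff_projective (R := A) M

theorem lifts_of_subsingleton_ext (h : Subsingleton (Ext F.obj N.obj 1)) : Lifts F N := by
  intro L M f g hfg π
  obtain ⟨x, hx⟩ := Ext.covariant_sequence_exact₃ F.obj hfg.shortExact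
    (Ext.mk₀ (ModuleCat.ofHom π)) (zero_add 1) (Subsingleton.elim _ _)
  obtain ⟨y, rfl⟩ := (Ext.mk₀_bijective _ _).2 x
  rw [Ext.mk₀_comp_mk₀] at hx
  exact ⟨y.hom, congrArg ModuleCat.Hom.hom ((Ext.mk₀_bijective _ _).1 hx)⟩

/-- A map out of the left term `Ω` of an extension of `F` by `Ω` extends to the middle term if
`Ext¹(F, N) = 0`. -/
theorem Lifts.exists_extension {P : FGModuleCat.{u} A} (h : Lifts F N) {ι : Ω →ₗ[A] P}
    {π : P →ₗ[A] F} (hs : IsSES ι π) (φ : Ω →ₗ[A] N) : ∃ ψ : P →ₗ[A] N, ψ ∘ₗ ι = φ := by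
  have hq : IsSES (φ.prod ι) (LinearMap.range (φ.prod ι)).mkQ :=
    isSES_coker fun x y hxy => hs.1 (congrArg Prod.snd hxy)
  obtain ⟨r, hr, hrq⟩ := hs.pushout_inl hq
  obtain ⟨s, hs'⟩ := h (FGModuleCat.of A ((N × P) ⧸ LinearMap.range (φ.prod ι))) F _ r hr
    LinearMap.id
  have hrq' : ∀ y, r ((LinearMap.range (φ.prod ι)).mkQ y) = π y.2 :=
    fun y => LinearMap.congr_fun hrq y
  -- the difference of the inclusion of `P` and the composite through the section lands in `N`
  obtain ⟨t, ht⟩ := hr.exists_lift (s ∘ₗ π - (LinearMap.range (φ.prod ι)).mkQ ∘ₗ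
    LinearMap.inr A N P) (by
      ext x
      have := LinearMap.congr_fun hs' (π x)
      simp only [LinearMap.comp_apply, LinearMap.sub_apply, map_sub, hrq'] at this ⊢
      rw [this]; simp)
  refine ⟨t, hr.lift_unique ?_⟩
  ext w
  have h1 := LinearMap.congr_fun ht (ι w)
  have h2 : (LinearMap.range (φ.prod ι)).mkQ (φ w, ι w) = 0 := hq.apply_eq_zero w
  have h3 : (φ w, ι w) = LinearMap.inl A N P (φ w) + LinearMap.inr A N P (ι w) := by simp
  rw [h3, map_add] at h2
  simp only [LinearMap.comp_apply, LinearMap.sub_apply, hs.apply_eq_zero, map_zero,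
    zero_sub] at h1 ⊢
  rw [h1]
  exact (eq_neg_of_add_eq_zero_left h2).symm

/-- The connecting map `Hom(Ω, N) → Ext¹(M, N)` of a short exact sequence `0 → Ω → F → M → 0`. -/
noncomputable def IsSES.connect {ι : Ω →ₗ[A] F} {π : F →ₗ[A] M} (h : IsSES ι π)
    (N : FGModuleCat.{u} A) : (Ω →ₗ[A] N) →+ Ext M.obj N.obj 1 :=
  AddMonoidHom.mk' (fun φ => h.shortExact.extClass.comp
      (Ext.mk₀ (ModuleCat.ofHom φ : Ω.obj ⟶ N.obj)) (add_zero 1)) fun φ ψ => by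
    rw [← Ext.comp_add, ← Ext.mk₀_add, ModuleCat.ofHom_add]

theorem IsSES.connect_eq_zero_iff {ι : Ω →ₗ[A] F} {π : F →ₗ[A] M} (h : IsSES ι π)
    (φ : Ω →ₗ[A] N) : h.connect N φ = 0 ↔ ∃ ψ : F →ₗ[A] N, ψ ∘ₗ ι = φ := by
  constructor
  · intro h0
    obtain ⟨x, hx⟩ := Ext.contravariant_sequence_exact₁ h.shortExact N.obj
      (Ext.mk₀ (ModuleCat.ofHom φ : Ω.obj ⟶ N.obj)) (add_zero 1) h0
    obtain ⟨y, rfl⟩ := (Ext.mk₀_bijective _ _).2 x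
    rw [Ext.mk₀_comp_mk₀] at hx
    exact ⟨y.hom, congrArg ModuleCat.Hom.hom ((Ext.mk₀_bijective _ _).1 hx)⟩
  · rintro ⟨ψ, rfl⟩
    change h.shortExact.extClass.comp (Ext.mk₀ ((ModuleCat.ofHom ι : Ω.obj ⟶ F.obj) ≫
      (ModuleCat.ofHom ψ : F.obj ⟶ N.obj))) (add_zero 1) = 0
    rw [← Ext.mk₀_comp_mk₀]
    exact h.shortExact.extClass_comp_assoc _

theorem subsingleton_ext_of_projective {n : ℕ} [Module.Projective A F] :
    Subsingleton (Ext F.obj N.obj (n + 1)) := by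
  have : Projective F.obj := projective_iff_obj.1 inferInstance
  exact Ext.subsingleton_of_projective _ _ _

theorem IsSES.connect_surjective {ι : Ω →ₗ[A] F} {π : F →ₗ[A] M} (h : IsSES ι π)
    (hF : Subsingleton (Ext F.obj N.obj 1)) : Function.Surjective (h.connect N) := by
  intro e
  obtain ⟨x, hx⟩ := Ext.contravariant_sequence_exact₃ h.shortExact N.obj e
    (@Subsingleton.elim _ hF _ _) (add_zero 1)
  obtain ⟨y, rfl⟩ := (Ext.mk₀_bijective _ _).2 x
  exact ⟨y.hom, hx⟩

theorem lifts_iff [Finite A] : Lifts F N ↔ Subsingleton (Ext F.obj N.obj 1) := by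
  refine ⟨fun h => ?_, lifts_of_subsingleton_ext⟩
  obtain ⟨Ω, P, ι, π, hs, hP⟩ := exists_free_presentation F
  refine subsingleton_of_forall_eq 0 fun e => ?_
  obtain ⟨φ, rfl⟩ := hs.connect_surjective subsingleton_ext_of_projective e
  exact (hs.connect_eq_zero_iff φ).2 (h.exists_extension hs φ)

end Lifting

section Chi

variable {A : Type u} [Ring A]

/-- The multiplicative Euler form `|Ext¹(M, N)| / |Hom(M, N)|`. It agrees with `q ^ (-⟨M, N⟩)` if
`M` has projective dimension at most one, and is additive on short exact sequences only under
vanishing conditions. -/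
noncomputable def chi (M N : FGModuleCat.{u} A) : ℚ :=
  (Nat.card (Ext M.obj N.obj 1) : ℚ) / (Nat.card (M →ₗ[A] N) : ℚ)

variable {K L M N F Ω M₁ M₂ M₃ : FGModuleCat.{u} A}

theorem card_hom_mul {f : M₁ →ₗ[A] M₂} {g : M₂ →ₗ[A] M₃} (h : IsSES f g)
    (hF : ∀ t : F →ₗ[A] M₃, ∃ s : F →ₗ[A] M₂, g ∘ₗ s = t) :
    Nat.card (F →ₗ[A] M₂) = Nat.card (F →ₗ[A] M₁) * Nat.card (F →ₗ[A] M₃) := by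
  let p : (F →ₗ[A] M₂) →+ (F →ₗ[A] M₃) :=
    AddMonoidHom.mk' (fun ψ => g ∘ₗ ψ) fun a b => LinearMap.comp_add _ _ _
  have hp : Function.Surjective p := hF
  rw [AddSubgroup.card_eq_card_quotient_mul_card_addSubgroup p.ker, mul_comm,
    Nat.card_congr (QuotientAddGroup.quotientKerEquivOfSurjective p hp).toEquiv]
  congr 1
  symm
  refine Nat.card_congr (Equiv.ofBijective (fun s => (⟨f ∘ₗ s, ?_⟩ : p.ker)) ⟨?_, ?_⟩)
  · change g ∘ₗ (f ∘ₗ s) = 0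
    ext x; simp [h.apply_eq_zero]
  · intro s s' hss
    exact h.lift_unique (congrArg Subtype.val hss)
  · rintro ⟨t, ht⟩
    obtain ⟨s, hs⟩ := h.exists_lift t ht
    exact ⟨s, Subtype.ext hs⟩

theorem card_hom_mul' {f : M₁ →ₗ[A] M₂} {g : M₂ →ₗ[A] M₃} (h : IsSES f g) (hF : Lifts M₃ N) :
    Nat.card (M₂ →ₗ[A] N) = Nat.card (M₃ →ₗ[A] N) * Nat.card (M₁ →ₗ[A] N) := by
  let p : (M₂ →ₗ[A] N) →+ (M₁ →ₗ[A] N) :=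
    AddMonoidHom.mk' (fun ψ => ψ ∘ₗ f) fun a b => LinearMap.add_comp _ _ _
  have hp : Function.Surjective p := hF.exists_extension h
  rw [AddSubgroup.card_eq_card_quotient_mul_card_addSubgroup p.ker, mul_comm,
    Nat.card_congr (QuotientAddGroup.quotientKerEquivOfSurjective p hp).toEquiv]
  congr 1
  symm
  refine Nat.card_congr (Equiv.ofBijective (fun s => (⟨s ∘ₗ g, ?_⟩ : p.ker)) ⟨?_, ?_⟩)
  · change (s ∘ₗ g) ∘ₗ f = 0
    ext x; simp [h.apply_eq_zero]
  · intro s s' hss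
    exact h.desc_unique (congrArg Subtype.val hss)
  · rintro ⟨t, ht⟩
    obtain ⟨s, hs⟩ := h.exists_desc t ht
    exact ⟨s, Subtype.ext hs⟩

variable [Finite A]

theorem card_hom_ne_zero (M N : FGModuleCat.{u} A) : (Nat.card (M →ₗ[A] N) : ℚ) ≠ 0 := by
  exact_mod_cast Nat.card_pos.ne'

theorem finite_ext (M N : FGModuleCat.{u} A) : Finite (Ext M.obj N.obj 1) := by
  obtain ⟨Ω, P, ι, π, hs, hP⟩ := exists_free_presentation M
  exact Finite.of_surjective _ (hs.connect_surjective (N := N) subsingleton_ext_of_projective)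

theorem chi_ne_zero (M N : FGModuleCat.{u} A) : chi M N ≠ 0 := by
  have := finite_ext M N
  refine div_ne_zero ?_ (card_hom_ne_zero M N)
  exact_mod_cast Nat.card_pos.ne'

/-- The multiplicative Euler form, computed from a presentation. -/
theorem chi_eq {ι : Ω →ₗ[A] F} {π : F →ₗ[A] M} (h : IsSES ι π) (hF : Lifts F N) :
    chi M N = (Nat.card (Ω →ₗ[A] N) : ℚ) / (Nat.card (F →ₗ[A] N) : ℚ) := by
  let res : (F →ₗ[A] N) →+ (Ω →ₗ[A] N) :=
    AddMonoidHom.mk' (fun ψ => ψ ∘ₗ ι) fun a b => LinearMap.add_comp _ _ _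
  have hk : (h.connect N).ker = res.range := by
    ext φ
    exact h.connect_eq_zero_iff φ
  have h1 : Nat.card (Ω →ₗ[A] N) = Nat.card (Ext M.obj N.obj 1) * Nat.card res.range := by
    rw [AddSubgroup.card_eq_card_quotient_mul_card_addSubgroup (h.connect N).ker, hk, ← hk,
      Nat.card_congr (QuotientAddGroup.quotientKerEquivOfSurjective (h.connect N)
        (h.connect_surjective (lifts_iff.1 hF))).toEquiv]
  have hk2 : Nat.card res.ker = Nat.card (M →ₗ[A] N) := by
    symm
    refine Nat.card_congr (Equiv.ofBijective (fun s => (⟨s ∘ₗ π, ?_⟩ : res.ker)) ⟨?_, ?_⟩)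
    · change (s ∘ₗ π) ∘ₗ ι = 0
      ext x; simp [h.apply_eq_zero]
    · intro s s' hss
      exact h.desc_unique (congrArg Subtype.val hss)
    · rintro ⟨t, ht⟩
      obtain ⟨s, hs⟩ := h.exists_desc t ht
      exact ⟨s, Subtype.ext hs⟩
  have h2 : Nat.card (F →ₗ[A] N) = Nat.card res.range * Nat.card (M →ₗ[A] N) := by
    rw [AddSubgroup.card_eq_card_quotient_mul_card_addSubgroup res.ker, hk2,
      Nat.card_congr (QuotientAddGroup.quotientKerEquivRange res).toEquiv]
  have h3 := card_hom_ne_zero F N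
  rw [chi, div_eq_div_iff (card_hom_ne_zero M N) h3, h1, h2]
  push_cast
  ring

end Chi

section ProjDim

variable {A : Type u} [Ring A] {K L M N F Ω M₁ M₂ M₃ : FGModuleCat.{u} A}

theorem projective_iff_lt_one : Module.Projective A M ↔ HasProjectiveDimensionLT M.obj 1 :=
  projective_iff_obj.trans projective_iff_hasProjectiveDimensionLT_one

theorem projective_left {ι : Ω →ₗ[A] F} {π : F →ₗ[A] M} (h : IsSES ι π) [Module.Projective A F]
    (hM : PD1 M) : Module.Projective A Ω :=
  projective_iff_lt_one.2
    (h.shortExact.hasProjectiveDimensionLT_X₁ 1 (projective_iff_lt_one.1 inferInstance) hM)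

theorem pd1_of_projective [Module.Projective A M] : PD1 M := by
  have : HasProjectiveDimensionLT M.obj 1 := projective_iff_lt_one.1 inferInstance
  exact hasProjectiveDimensionLT_of_ge M.obj 1 2 (by norm_num)

theorem pd1_right {ι : Ω →ₗ[A] F} {π : F →ₗ[A] M} (h : IsSES ι π) [Module.Projective A Ω]
    (hF : PD1 F) : PD1 M :=
  h.shortExact.hasProjectiveDimensionLT_X₃ 1 (projective_iff_lt_one.1 inferInstance) hF

theorem pd1_mid {f : K →ₗ[A] L} {g : L →ₗ[A] M} (h : IsSES f g) (hK : PD1 K) (hM : PD1 M) :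
    PD1 L := h.shortExact.hasProjectiveDimensionLT_X₂ 2 hK hM

theorem PD1.subsingleton_ext_two (hM : PD1 M) : Subsingleton (Ext M.obj N.obj 2) :=
  HasProjectiveDimensionLT.subsingleton M.obj 2 2 le_rfl N.obj

theorem pd1_congr (e : M ≃ₗ[A] N) (hM : PD1 M) : PD1 N :=
  hasProjectiveDimensionLT_of_iso (X := M.obj) (X' := N.obj) e.toModuleIso 2

variable [Finite A]

theorem lifts_left {ι : Ω →ₗ[A] F} {π : F →ₗ[A] M} (h : IsSES ι π)
    (h2 : Subsingleton (Ext M.obj N.obj 2)) (hF : Lifts F N) : Lifts Ω N := by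
  rw [lifts_iff] at hF ⊢
  refine subsingleton_of_forall_eq 0 fun e => ?_
  obtain ⟨x, rfl⟩ := Ext.contravariant_sequence_exact₁ h.shortExact N.obj e (n₁ := 2) rfl
    (Subsingleton.elim _ _)
  have : x = 0 := hF.elim x 0
  rw [this, Ext.comp_zero]

/-- Additivity of the multiplicative Euler form at a sequence on which `Hom(M, -)` and
`Ext¹(M, -)` are exact. -/
theorem chi_mid_right_of_card {f : M₁ →ₗ[A] M₂} {g : M₂ →ₗ[A] M₃} (h : IsSES f g)
    {ι : Ω →ₗ[A] F} {π : F →ₗ[A] M} (hs : IsSES ι π) [Module.Projective A F]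
    (hΩ : ∀ t : Ω →ₗ[A] M₃, ∃ s : Ω →ₗ[A] M₂, g ∘ₗ s = t) :
    chi M M₂ = chi M M₁ * chi M M₃ := by
  rw [chi_eq hs lifts_of_projective, chi_eq hs lifts_of_projective,
    chi_eq hs lifts_of_projective, card_hom_mul h hΩ,
    card_hom_mul h (lifts_of_projective _ _ f g h)]
  push_cast
  rw [div_mul_div_comm]

theorem chi_mid_right {f : M₁ →ₗ[A] M₂} {g : M₂ →ₗ[A] M₃} (h : IsSES f g) (hK : PD1 K) :
    chi K M₂ = chi K M₁ * chi K M₃ := by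
  obtain ⟨Ω, P, ι, π, hs, hP⟩ := exists_free_presentation K
  have := projective_left hs hK
  exact chi_mid_right_of_card h hs (lifts_of_projective _ _ f g h)

theorem chi_mid_left {f : M₁ →ₗ[A] M₂} {g : M₂ →ₗ[A] M₃} (h : IsSES f g) (hM : PD1 M₃) :
    chi M₂ N = chi M₁ N * chi M₃ N := by
  obtain ⟨Ω, P, ι, π, hs, hP⟩ := exists_free_presentation M₂
  obtain ⟨W, a, b, j, hab, hj, -, -⟩ := exists_preimage hs h
  have := projective_left hj hM
  rw [chi_eq hs lifts_of_projective, chi_eq hab lifts_of_projective,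
    chi_eq hj lifts_of_projective]
  have := card_hom_ne_zero W N
  field_simp

/-- Additivity of the multiplicative Euler form at a sequence with projective left term. -/
theorem chi_mid_left_of_projective {f : M₁ →ₗ[A] M₂} {g : M₂ →ₗ[A] M₃} (h : IsSES f g)
    [Module.Projective A M₁] : chi M₂ N = chi M₁ N * chi M₃ N := by
  obtain ⟨Ω, P, ι, π, hs, hP⟩ := exists_free_presentation M₂
  obtain ⟨W, a, b, j, hab, hj, -, -⟩ := exists_preimage hs h
  have hc := card_hom_mul' (N := N) hab lifts_of_projective
  have h0 := chi_eq (Ω := FGModuleCat.of A PUnit.{u + 1}) (F := M₁) (M := M₁) (N := N)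
    isSES_zero_id lifts_of_projective
  have hz : Nat.card ((FGModuleCat.of A PUnit.{u + 1}) →ₗ[A] N) = 1 := by
    rw [Nat.card_eq_one_iff_unique]
    exact ⟨⟨fun a b => LinearMap.ext fun x => (map_zero a).trans (map_zero b).symm⟩, ⟨0⟩⟩
  rw [hz] at h0
  rw [chi_eq hs lifts_of_projective, h0, chi_eq hj lifts_of_projective, hc]
  have := card_hom_ne_zero M₁ N
  push_cast
  field_simp

end ProjDim

/-! ### Hall products from presentations -/

section Glue

variable {A : Type u} [Ring A] {M N L F Ω : FGModuleCat.{u} A}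

/-- The pushout of `φ : Ω → N` and `ι : Ω → F`, up to a sign: the quotient of `N × F` by the
elements `(φ w, ι w)`. -/
abbrev glue (φ : Ω →ₗ[A] N) (ι : Ω →ₗ[A] F) : FGModuleCat.{u} A :=
  FGModuleCat.of A ((N × F) ⧸ LinearMap.range (φ.prod ι))

/-- The projection `N × F → glue φ ι`. -/
abbrev glueMk (φ : Ω →ₗ[A] N) (ι : Ω →ₗ[A] F) : N × F →ₗ[A] glue φ ι :=
  (LinearMap.range (φ.prod ι)).mkQ

theorem isSES_glueMk (φ : Ω →ₗ[A] N) {ι : Ω →ₗ[A] F} (hι : Function.Injective ι) :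
    IsSES (φ.prod ι) (glueMk φ ι) :=
  isSES_coker fun _ _ hxy => hι (congrArg Prod.snd hxy)

theorem exists_isSES_glue (φ : Ω →ₗ[A] N) {ι : Ω →ₗ[A] F} {π : F →ₗ[A] M} (h : IsSES ι π) :
    ∃ r : glue φ ι →ₗ[A] M, IsSES (glueMk φ ι ∘ₗ LinearMap.inl A N F) r ∧
      r ∘ₗ glueMk φ ι = π ∘ₗ LinearMap.snd A N F :=
  h.pushout_inl (isSES_glueMk φ h.1)

/-- An extension of `M` by `N` with a lift of `F → M` to its middle term is the pushout of
`0 → Ω → F → M → 0` along a unique map `Ω → N`. -/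
theorem exists_glue_equiv {ι : Ω →ₗ[A] F} {π : F →ₗ[A] M} (h : IsSES ι π) {f : N →ₗ[A] L}
    {g : L →ₗ[A] M} (hfg : IsSES f g) (ψ : F →ₗ[A] L) (hψ : g ∘ₗ ψ = π) :
    ∃ (φ : Ω →ₗ[A] N) (e : glue φ ι ≃ₗ[A] L), e.toLinearMap ∘ₗ glueMk φ ι = f.coprod ψ := by
  obtain ⟨φ, hφ⟩ := hfg.exists_lift (-(ψ ∘ₗ ι)) (by
    ext x
    have : g (ψ (ι x)) = π (ι x) := LinearMap.congr_fun hψ _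
    simp [this, h.apply_eq_zero])
  have hφ' : ∀ x, f (φ x) = -ψ (ι x) := fun x => LinearMap.congr_fun hφ x
  obtain ⟨t, ht⟩ := (isSES_glueMk φ h.1).exists_desc (f.coprod ψ) (by ext x; simp [hφ'])
  obtain ⟨r, hr, hr'⟩ := exists_isSES_glue φ h
  refine ⟨φ, LinearEquiv.ofBijective t (hr.bijective_mid hfg t ?_ ?_), ht⟩
  · rw [← LinearMap.comp_assoc, ht, LinearMap.coprod_inl]
  · refine (isSES_glueMk φ h.1).desc_unique ?_
    rw [LinearMap.comp_assoc, ht, hr', LinearMap.comp_coprod, hψ]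
    ext x
    · simp [hfg.apply_eq_zero]
    · simp

theorem exists_glue_equiv_of_lifts {ι : Ω →ₗ[A] F} {π : F →ₗ[A] M} (h : IsSES ι π)
    (hF : Lifts F N) {f : N →ₗ[A] L} {g : L →ₗ[A] M} (hfg : IsSES f g) :
    ∃ φ : Ω →ₗ[A] N, Nonempty (glue φ ι ≃ₗ[A] L) := by
  obtain ⟨ψ, hψ⟩ := hF L M f g hfg π
  obtain ⟨φ, e, -⟩ := exists_glue_equiv h hfg ψ hψ
  exact ⟨φ, ⟨e⟩⟩

/-- Maps that differ by a map extending to `F` have isomorphic pushouts. -/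
theorem nonempty_glue_add_equiv (φ : Ω →ₗ[A] N) {ι : Ω →ₗ[A] F} (hι : Function.Injective ι)
    (ψ : F →ₗ[A] N) : Nonempty (glue φ ι ≃ₗ[A] glue (φ + ψ ∘ₗ ι) ι) := by
  let s : N × F →ₗ[A] N × F := ((LinearMap.fst A N F) + ψ ∘ₗ LinearMap.snd A N F).prod
    (LinearMap.snd A N F)
  let t : N × F →ₗ[A] N × F := ((LinearMap.fst A N F) - ψ ∘ₗ LinearMap.snd A N F).prod
    (LinearMap.snd A N F)
  let b : (N × F) ≃ₗ[A] (N × F) := LinearEquiv.ofLinearMap s t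
    (by ext x <;> simp [s, t]) (by ext x <;> simp [s, t])
  exact (isSES_glueMk φ hι).equiv_right (isSES_glueMk (φ + ψ ∘ₗ ι) hι) (LinearEquiv.refl A Ω) b
    (by ext x <;> simp [b, s])

theorem nonempty_glue_zero_equiv {ι : Ω →ₗ[A] F} {π : F →ₗ[A] M} (h : IsSES ι π) :
    Nonempty (glue (0 : Ω →ₗ[A] N) ι ≃ₗ[A] N × M) := by
  refine (isSES_glueMk (0 : Ω →ₗ[A] N) h.1).equiv_right
    (M' := N × M) (f' := (LinearMap.inr A N F) ∘ₗ ι)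
    (g' := (LinearMap.id : N →ₗ[A] N).prodMap π) ?_ (LinearEquiv.refl A Ω) (LinearEquiv.refl A _) ?_
  · refine ⟨LinearMap.inr_injective.comp h.1, fun x => ?_, Function.surjective_id.prodMap h.2.2⟩
    constructor
    · intro hx
      obtain ⟨y, hy⟩ := (h.2.1 x.2).1 (congrArg Prod.snd hx)
      exact ⟨y, Prod.ext (congrArg Prod.fst hx).symm hy⟩
    · rintro ⟨y, rfl⟩
      exact Prod.ext rfl (h.apply_eq_zero y)
  · ext x <;> simp

end Glue

section HallProduct

variable {A : Type u} [Ring A] [Finite A] {M N F Ω : FGModuleCat.{u} A}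

theorem hallNumber_eq_card_ses (M N L : FGModuleCat.{u} A) :
    hallNumber M N L = Nat.card (Ses A M N L) / aut L := by
  rw [hallNumber_eq, card_ses]
  unfold aut
  push_cast
  rfl

/-- Extensions of `M` by `N` with middle term `L`, together with a lift of `π : F → M` to `L`, are
the isomorphisms from the pushouts of `0 → Ω → F → M → 0` to `L`. -/
theorem card_ses_mul (L : FGModuleCat.{u} A) {ι : Ω →ₗ[A] F} {π : F →ₗ[A] M} (h : IsSES ι π)
    (hF : Lifts F N) :
    Nat.card (Ses A M N L) * Nat.card (F →ₗ[A] N) =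
      Nat.card (Σ φ : Ω →ₗ[A] N, glue φ ι ≃ₗ[A] L) := by
  let X := {p : Ses A M N L × (F →ₗ[A] L) // p.1.1.2 ∘ₗ p.2 = π}
  have hX : Nat.card X = Nat.card (Ses A M N L) * Nat.card (F →ₗ[A] N) := by
    refine card_eq_of_fibers (fun p : X => p.1.1) _ fun w => ?_
    obtain ⟨ψ₀, hψ₀⟩ := hF L M _ _ w.2 π
    symm
    refine Nat.card_congr (Equiv.ofBijective (fun t => ⟨⟨(w, ψ₀ + w.1.1 ∘ₗ t), ?_⟩, rfl⟩) ⟨?_, ?_⟩)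
    · have : w.1.2 ∘ₗ w.1.1 = 0 := by ext x; exact w.2.apply_eq_zero x
      rw [LinearMap.comp_add, hψ₀, ← LinearMap.comp_assoc, this, LinearMap.zero_comp, add_zero]
    · intro s t hst
      have : ψ₀ + w.1.1 ∘ₗ s = ψ₀ + w.1.1 ∘ₗ t := congrArg (fun p => p.1.1.2) hst
      exact w.2.lift_unique (add_left_cancel this)
    · rintro ⟨⟨⟨w', ψ⟩, hψ⟩, rfl⟩
      obtain ⟨t, ht⟩ := w'.2.exists_lift (ψ - ψ₀) (by
        rw [LinearMap.comp_sub, hψ₀]; exact sub_eq_zero.2 hψ)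
      refine ⟨t, Subtype.ext (Subtype.ext (Prod.ext rfl ?_))⟩
      change ψ₀ + w'.1.1 ∘ₗ t = ψ
      rw [ht]; abel
  rw [← hX]
  choose r hr hr' using fun φ : Ω →ₗ[A] N => exists_isSES_glue φ h
  symm
  refine Nat.card_congr (Equiv.ofBijective (fun p => ⟨(⟨(p.2.toLinearMap ∘ₗ glueMk p.1 ι ∘ₗ
    LinearMap.inl A N F, r p.1 ∘ₗ p.2.symm.toLinearMap), (hr p.1).congr_mid p.2⟩,
    p.2.toLinearMap ∘ₗ glueMk p.1 ι ∘ₗ LinearMap.inr A N F), ?_⟩) ⟨?_, ?_⟩)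
  · ext x
    have := LinearMap.congr_fun (hr' p.1) (0, x)
    simpa using this
  · rintro ⟨φ, e⟩ ⟨φ', e'⟩ heq
    have h1 : e.toLinearMap ∘ₗ glueMk φ ι ∘ₗ LinearMap.inl A N F =
      e'.toLinearMap ∘ₗ glueMk φ' ι ∘ₗ LinearMap.inl A N F := congrArg (fun p => p.1.1.1.1) heq
    have h2 : e.toLinearMap ∘ₗ glueMk φ ι ∘ₗ LinearMap.inr A N F =
      e'.toLinearMap ∘ₗ glueMk φ' ι ∘ₗ LinearMap.inr A N F := congrArg (fun p => p.1.2) heq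
    have h3 : e.toLinearMap ∘ₗ glueMk φ ι = e'.toLinearMap ∘ₗ glueMk φ' ι :=
      LinearMap.prod_ext h1 h2
    have hφ : φ = φ' := by
      refine ((hr φ').congr_mid e').lift_unique ?_
      ext w
      have a1 : e (glueMk φ ι (φ w, ι w)) = 0 := by
        rw [show glueMk φ ι (φ w, ι w) = 0 from (isSES_glueMk φ h.1).apply_eq_zero w, map_zero]
      have a2 : e' (glueMk φ' ι (φ' w, ι w)) = 0 := by
        rw [show glueMk φ' ι (φ' w, ι w) = 0 from (isSES_glueMk φ' h.1).apply_eq_zero w, map_zero]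
      have a3 : e' (glueMk φ' ι (φ w, ι w)) = 0 := a1 ▸ (LinearMap.congr_fun h3 (φ w, ι w)).symm
      have a4 : e' (glueMk φ' ι ((φ w, ι w) - (φ' w, ι w))) = 0 := by
        rw [map_sub, map_sub, a3, a2, sub_zero]
      have a5 : ((φ w, ι w) - (φ' w, ι w) : N × F) = (φ w, 0) - (φ' w, 0) := by simp
      rw [a5, map_sub, map_sub, sub_eq_zero] at a4
      exact a4
    subst hφ
    have : e = e' := by
      apply LinearEquiv.toLinearMap_injective
      exact (isSES_glueMk φ h.1).desc_unique h3
    rw [this]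
  · rintro ⟨⟨⟨⟨f, g⟩, hfg⟩, ψ⟩, hψ⟩
    obtain ⟨φ, e, he⟩ := exists_glue_equiv h hfg ψ hψ
    refine ⟨⟨φ, e⟩, Subtype.ext (Prod.ext (Subtype.ext (Prod.ext ?_ ?_)) ?_)⟩
    · change e.toLinearMap ∘ₗ glueMk φ ι ∘ₗ LinearMap.inl A N F = f
      rw [← LinearMap.comp_assoc, he, LinearMap.coprod_inl]
    · change r φ ∘ₗ e.symm.toLinearMap = g
      have : r φ = g ∘ₗ e.toLinearMap := by
        refine (isSES_glueMk φ h.1).desc_unique ?_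
        rw [LinearMap.comp_assoc, he, hr', LinearMap.comp_coprod, show g ∘ₗ ψ = π from hψ]
        ext x
        · simp [IsSES.apply_eq_zero hfg]
        · simp
      rw [this]; ext x; simp
    · change e.toLinearMap ∘ₗ glueMk φ ι ∘ₗ LinearMap.inr A N F = ψ
      rw [← LinearMap.comp_assoc, he, LinearMap.coprod_inr]

theorem Hall.cls_congr {M N : FGModuleCat.{u} A} (h : Nonempty (M ≃ₗ[A] N)) :
    Hall.cls M = Hall.cls N := by
  unfold Hall.cls
  rw [isoClass_eq_iff.2 h]

/-- The Hall product `[M] ⋄ [N]` as a sum over the pushouts of a presentation of `M`. -/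
theorem Hall.cls_mul_cls {ι : Ω →ₗ[A] F} {π : F →ₗ[A] M} (h : IsSES ι π) (hF : Lifts F N)
    [Fintype (Ω →ₗ[A] N)] :
    Hall.cls M * Hall.cls N =
      (Nat.card (F →ₗ[A] N) : ℚ)⁻¹ • ∑ φ : Ω →ₗ[A] N, Hall.cls (glue φ ι) := by
  classical
  apply (Hall.toFinsupp A).injective
  refine Finsupp.ext fun c => ?_
  obtain ⟨L, rfl⟩ := Quotient.exists_rep c
  have h1 := Hall.toFinsupp_cls_mul_cls M N L
  rw [show (Nat.card (ExtMid M N L) : ℚ) / (Nat.card (M.obj ⟶ N.obj) : ℚ) = hallNumber M N L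
    from rfl, hallNumber_eq_card_ses] at h1
  refine h1.trans ?_
  rw [map_smul, map_sum, Finsupp.smul_apply, Finsupp.finsetSum_apply]
  have hc := card_ses_mul L h hF
  have hfin (φ : Ω →ₗ[A] N) : Finite (glue φ ι ≃ₗ[A] L) :=
    @finite_equiv _ _ _ _ _ _ _ _ (finite_fg (glue φ ι)) (finite_fg L)
  rw [Nat.card_sigma] at hc
  have hs : ∀ φ : Ω →ₗ[A] N, ((Nat.card (glue φ ι ≃ₗ[A] L) : ℕ) : ℚ) =
      (Hall.toFinsupp A (Hall.cls (glue φ ι))) ⟦L⟧ * aut L := by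
    intro φ
    rw [Hall.cls, LinearEquiv.apply_symm_apply, Finsupp.single_apply]
    split_ifs with he
    · rw [card_equiv_eq (isoClass_eq_iff.1 he), one_mul]
      rfl
    · have : IsEmpty (glue φ ι ≃ₗ[A] L) := ⟨fun e => he (isoClass_eq_iff.2 ⟨e⟩)⟩
      simp
  have hc' : (Nat.card (Ses A M N L) : ℚ) * (Nat.card (F →ₗ[A] N) : ℚ) =
      (∑ φ : Ω →ₗ[A] N, (Hall.toFinsupp A (Hall.cls (glue φ ι))) ⟦L⟧) * aut L := by
    rw [Finset.sum_mul, ← Finset.sum_congr rfl fun φ _ => hs φ]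
    exact_mod_cast hc
  have := aut_ne_zero L
  have := card_hom_ne_zero F N
  rw [smul_eq_mul, div_eq_iff (aut_ne_zero L), mul_assoc, ← hc']
  field_simp

end HallProduct

/-! ### The universal property of the modified Ringel-Hall algebra -/

section HallMap

variable {A : Type u} [Ring A] [Finite A] {R : Type v} [Ring R] [Algebra ℚ R]
  {K L M N : FGModuleCat.{u} A}

theorem Hall.induction_cls {p : Hall A → Prop} (h0 : p 0) (hadd : ∀ x y, p x → p y → p (x + y))
    (hsmul : ∀ (c : ℚ) (M : FGModuleCat.{u} A), p (c • Hall.cls M)) (x : Hall A) : p x := by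
  obtain ⟨y, rfl⟩ := (Hall.toFinsupp A).symm.surjective x
  induction y using Finsupp.induction_linear with
  | zero => rwa [map_zero]
  | add f g hf hg => rw [map_add]; exact hadd _ _ hf hg
  | single c r =>
    obtain ⟨M, rfl⟩ := Quotient.exists_rep c
    have : (Finsupp.single (⟦M⟧ : IsoClass A) r) = r • Finsupp.single (⟦M⟧ : IsoClass A) (1 : ℚ) := by
      rw [Finsupp.smul_single, smul_eq_mul, mul_one]
    rw [this, map_smul]
    exact hsmul r M

/-- The linear extension to the Hall algebra of a function on modules. It takes the value `ρ M` at
`[M]` if `ρ` is invariant under isomorphisms. -/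
noncomputable def Hall.extend (ρ : FGModuleCat.{u} A → R) : Hall A →ₗ[ℚ] R :=
  (Finsupp.linearCombination ℚ fun c : IsoClass A => ρ c.out) ∘ₗ (Hall.toFinsupp A).toLinearMap

/-- `ρ` takes the same value at isomorphic modules. -/
def IsoInvariant (ρ : FGModuleCat.{u} A → R) : Prop :=
  ∀ ⦃M N : FGModuleCat.{u} A⦄, Nonempty (M ≃ₗ[A] N) → ρ M = ρ N

theorem Hall.extend_cls {ρ : FGModuleCat.{u} A → R} (hρ : IsoInvariant ρ)
    (M : FGModuleCat.{u} A) : Hall.extend ρ (Hall.cls M) = ρ M := by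
  change Finsupp.linearCombination ℚ (fun c : IsoClass A => ρ c.out)
    (Hall.toFinsupp A (Hall.cls M)) = _
  rw [Hall.cls, LinearEquiv.apply_symm_apply, Finsupp.linearCombination_single, one_smul]
  exact hρ (nonempty_out_equiv M)

/-- `ρ` is multiplicative on the Hall product `[M] ⋄ [N]`. -/
def MultAt (ρ : FGModuleCat.{u} A → R) (M N : FGModuleCat.{u} A) : Prop :=
  Hall.extend ρ (Hall.cls M * Hall.cls N) = ρ M * ρ N

/-- The properties that a function on modules needs, on the modules in a class `X`, in order to
factor through the modified Ringel-Hall algebra. -/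
structure IsHallMap (X : FGModuleCat.{u} A → Prop) (ρ : FGModuleCat.{u} A → R) : Prop where
  congr : IsoInvariant ρ
  mul : ∀ ⦃M N : FGModuleCat.{u} A⦄, X M → X N → MultAt ρ M N
  isUnit : ∀ ⦃K : FGModuleCat.{u} A⦄, X K → PD1 K → IsUnit (ρ K)
  sub : ∀ ⦃K L M : FGModuleCat.{u} A⦄ ⦃f : K →ₗ[A] L⦄ ⦃g : L →ₗ[A] M⦄, IsSES f g → X K → X L → X M → PD1 K →
    ρ K * ρ M = chi K M • ρ L

theorem MultAt.eq_sum {ρ : FGModuleCat.{u} A → R} (hρ : IsoInvariant ρ) {F Ω : FGModuleCat.{u} A}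
    {ι : Ω →ₗ[A] F} {π : F →ₗ[A] M} (h : IsSES ι π) (hF : Lifts F N) [Fintype (Ω →ₗ[A] N)] :
    Hall.extend ρ (Hall.cls M * Hall.cls N) =
      (Nat.card (F →ₗ[A] N) : ℚ)⁻¹ • ∑ φ : Ω →ₗ[A] N, ρ (glue φ ι) := by
  rw [Hall.cls_mul_cls h hF, map_smul, map_sum]
  simp only [Hall.extend_cls hρ]

theorem IsHallMap.map_zero {X : FGModuleCat.{u} A → Prop} {ρ : FGModuleCat.{u} A → R}
    (h : IsHallMap X ρ) (h0 : X (FGModuleCat.of A PUnit.{u + 1})) :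
    ρ (FGModuleCat.of A PUnit.{u + 1}) = 1 := by
  have hp : Module.Projective A (FGModuleCat.of A PUnit.{u + 1}) :=
    Module.Projective.of_free (P := PUnit.{u + 1})
  have h1 := h.mul h0 h0
  rw [MultAt, ← Hall.one_eq_cls, mul_one, Hall.one_eq_cls, Hall.extend_cls h.congr] at h1
  exact (h.isUnit h0 pd1_of_projective).mul_left_cancel (by rw [← h1, mul_one])

variable (A) in
/-- The quotient map followed by the localization map. -/
noncomputable def MH.proj : Hall A →ₐ[ℚ] MH A :=
  (Loc.of (denominators A)).comp (RingQuot.mkAlgHom ℚ (ModRel A))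

theorem MH.proj_cls (M : FGModuleCat.{u} A) : MH.proj A (Hall.cls M) = MH.cls M := rfl

theorem MH.algHom_ext {Φ Ψ : MH A →ₐ[ℚ] R} (h : ∀ M, Φ (MH.cls M) = Ψ (MH.cls M)) : Φ = Ψ := by
  have h1 : Φ.comp (Loc.of (denominators A)) = Ψ.comp (Loc.of (denominators A)) := by
    refine RingQuot.ringQuot_ext' ℚ _ _ (AlgHom.ext fun x => ?_)
    induction x using Hall.induction_cls with
    | h0 => simp
    | hadd x y hx hy => rw [map_add, map_add, hx, hy]
    | hsmul c M => rw [map_smul, map_smul]; exact congrArg (c • ·) (h M)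
  obtain ⟨F, -, hF⟩ := Loc.existsUnique_lift (denominators A) (Φ.comp (Loc.of (denominators A)))
    (fun s hs => (Loc.isUnit_of _ hs).map Φ)
  exact (hF Φ rfl).trans (hF Ψ h1.symm).symm

/-- A function on all modules with the properties of a Hall map extends to the modified
Ringel-Hall algebra. -/
theorem IsHallMap.exists_algHom {ρ : FGModuleCat.{u} A → R} (h : IsHallMap (fun _ => True) ρ) :
    ∃ Φ : MH A →ₐ[ℚ] R, ∀ M, Φ (MH.cls M) = ρ M := by
  have hmul : ∀ x y, Hall.extend ρ (x * y) = Hall.extend ρ x * Hall.extend ρ y := by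
    intro x y
    induction x using Hall.induction_cls with
    | h0 => simp
    | hadd a b ha hb => rw [add_mul, map_add, map_add, ha, hb, add_mul]
    | hsmul c M =>
      rw [smul_mul_assoc, map_smul, map_smul, smul_mul_assoc]
      congr 1
      induction y using Hall.induction_cls with
      | h0 => simp
      | hadd a b ha hb => rw [mul_add, map_add, map_add, ha, hb, mul_add]
      | hsmul d N =>
        rw [mul_smul_comm, map_smul, map_smul, mul_smul_comm, h.mul trivial trivial,
          Hall.extend_cls h.congr, Hall.extend_cls h.congr]
  have hone : Hall.extend ρ 1 = 1 := by
    rw [Hall.one_eq_cls, Hall.extend_cls h.congr, h.map_zero trivial]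
  let Φ₀ : Hall A →ₐ[ℚ] R := AlgHom.ofLinearMap (Hall.extend ρ) hone hmul
  have hrel : ∀ ⦃x y⦄, ModRel A x y → Φ₀ x = Φ₀ y := by
    rintro _ _ ⟨K, L, M, f, g, hs, hK⟩
    refine (Hall.extend_cls h.congr L).trans (Eq.trans ?_ (Hall.extend_cls h.congr _).symm)
    have h1 := h.sub hs trivial trivial trivial hK
    have h2 := h.sub (L := FGModuleCat.of A (K × M)) isSES_inl_snd trivial trivial trivial hK
    exact (smul_right_injective R (chi_ne_zero K M)) (h1.symm.trans h2)
  let Φ₁ : HallQuot A →ₐ[ℚ] R := RingQuot.liftAlgHom ℚ ⟨Φ₀, hrel⟩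
  have hΦ₁ : ∀ x, Φ₁ (RingQuot.mkAlgHom ℚ (ModRel A) x) = Φ₀ x :=
    fun x => RingQuot.liftAlgHom_mkAlgHom_apply ℚ Φ₀ hrel x
  obtain ⟨Φ, hΦ, -⟩ := Loc.existsUnique_lift (denominators A) Φ₁ (by
    rintro _ ⟨a, K, ha, hK, rfl⟩
    rw [map_smul, hΦ₁]
    change IsUnit (a • Hall.extend ρ (Hall.cls K))
    rw [Hall.extend_cls h.congr]
    exact (isUnit_smul_iff (Units.mk0 a ha) _).2 (h.isUnit trivial hK))
  refine ⟨Φ, fun M => ?_⟩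
  change (Φ.comp (Loc.of (denominators A))) _ = _
  rw [hΦ, hΦ₁]
  exact Hall.extend_cls h.congr M

end HallMap

section Canonical

variable {A : Type u} [Ring A] [Finite A] {K L M N P : FGModuleCat.{u} A}

theorem MH.cls_congr (h : Nonempty (M ≃ₗ[A] N)) : MH.cls M = MH.cls N := by
  rw [← MH.proj_cls, ← MH.proj_cls, Hall.cls_congr h]

theorem MH.isUnit_cls (hK : PD1 K) : IsUnit (MH.cls K) :=
  Loc.isUnit_of _ ⟨1, K, one_ne_zero, hK, (one_smul _ _).symm⟩

theorem MH.cls_eq_of_isSES {f : K →ₗ[A] L} {g : L →ₗ[A] M} (h : IsSES f g) (hK : PD1 K) :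
    MH.cls L = MH.cls (FGModuleCat.of A (K × M)) :=
  congrArg (Loc.of (denominators A)) (RingQuot.mkAlgHom_rel ℚ (ModRel.of_ses K L M f g h hK))

theorem MH.cls_mul_cls_of_projective [Module.Projective A P] :
    MH.cls P * MH.cls M =
      (Nat.card ((P : Type u) →ₗ[A] M) : ℚ)⁻¹ • MH.cls (FGModuleCat.of A (P × M)) := by
  have hu : Unique (FGModuleCat.of A PUnit.{u + 1} →ₗ[A] M) :=
    ⟨⟨0⟩, fun a => LinearMap.ext fun x => _root_.map_zero a⟩
  have hs : IsSES (A := A) (K := FGModuleCat.of A PUnit.{u + 1}) (L := P) (M := P) 0 LinearMap.id :=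
    isSES_zero_id
  rw [← MH.proj_cls, ← MH.proj_cls, ← map_mul, Hall.cls_mul_cls hs lifts_of_projective, map_smul,
    Fintype.sum_unique]
  have e (t : FGModuleCat.of A PUnit.{u + 1} →ₗ[A] M) :
      Nonempty (glue (F := P) t 0 ≃ₗ[A] M × P) := by
    rw [Subsingleton.elim t 0]; exact nonempty_glue_zero_equiv hs
  congr 1
  exact MH.cls_congr ((e _).map fun e => e.trans (LinearEquiv.prodComm A M P))

/-- All pushouts of a projective resolution of length one have the same class: by the relations,
their classes agree after multiplication by the class of the projective module `Ω`. -/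
theorem MH.cls_glue {F Ω : FGModuleCat.{u} A} {ι : Ω →ₗ[A] F} {π : F →ₗ[A] K} (h : IsSES ι π)
    [Module.Projective A Ω] (φ : Ω →ₗ[A] M) :
    MH.cls (glue φ ι) = MH.cls (FGModuleCat.of A (K × M)) := by
  have key : ∀ φ : Ω →ₗ[A] M, MH.cls Ω * MH.cls (glue φ ι) =
      ((Nat.card (Ω →ₗ[A] M) * Nat.card (Ω →ₗ[A] K) : ℕ) : ℚ)⁻¹ •
        MH.cls (FGModuleCat.of A (M × F)) := by
    intro φ
    obtain ⟨r, hr, -⟩ := exists_isSES_glue φ h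
    rw [MH.cls_mul_cls_of_projective, MH.cls_eq_of_isSES (K := Ω) (L := FGModuleCat.of A (M × F))
      (M := glue φ ι) (isSES_glueMk φ h.1) pd1_of_projective,
      card_hom_mul (M₂ := glue φ ι) hr (lifts_of_projective (glue φ ι) K _ _ hr)]
  obtain ⟨e⟩ := nonempty_glue_zero_equiv (N := M) h
  have e' : Nonempty (glue (0 : Ω →ₗ[A] M) ι ≃ₗ[A] FGModuleCat.of A (K × M)) :=
    ⟨e.trans (LinearEquiv.prodComm A M K)⟩
  rw [← MH.cls_congr e']
  exact (MH.isUnit_cls pd1_of_projective).mul_left_cancel ((key φ).trans (key 0).symm)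

theorem MH.cls_mul_cls (hK : PD1 K) :
    MH.cls K * MH.cls M = chi K M • MH.cls (FGModuleCat.of A (K × M)) := by
  obtain ⟨Ω, F, ι, π, hs, hF⟩ := exists_free_presentation K
  have := projective_left hs hK
  have := Fintype.ofFinite (Ω →ₗ[A] M)
  rw [← MH.proj_cls, ← MH.proj_cls, ← map_mul, Hall.cls_mul_cls hs lifts_of_projective, map_smul,
    map_sum]
  simp only [MH.proj_cls, MH.cls_glue hs]
  rw [Finset.sum_const, Finset.card_univ, ← Nat.card_eq_fintype_card, ← Nat.cast_smul_eq_nsmul ℚ,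
    smul_smul, chi_eq hs lifts_of_projective, div_eq_inv_mul]

/-- The class in `MH A` of an extension by a module of projective dimension at most one. -/
theorem MH.cls_mul_cls_of_isSES {f : M →ₗ[A] L} {g : L →ₗ[A] K} (h : IsSES f g) (hK : PD1 K) :
    MH.cls K * MH.cls M = chi K M • MH.cls L := by
  obtain ⟨Ω, F, ι, π, hs, hF⟩ := exists_free_presentation K
  have := projective_left hs hK
  obtain ⟨φ, e⟩ := exists_glue_equiv_of_lifts hs lifts_of_projective h
  rw [MH.cls_mul_cls hK, ← MH.cls_glue hs φ, MH.cls_congr e]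

theorem MH.isHallMap_cls : IsHallMap (fun _ => True) (MH.cls : FGModuleCat.{u} A → MH A) where
  congr _ _ := MH.cls_congr
  mul M N _ _ := by
    have : Hall.extend (MH.cls : FGModuleCat.{u} A → MH A) = (MH.proj A).toLinearMap := by
      refine LinearMap.ext fun x => ?_
      induction x using Hall.induction_cls with
      | h0 => simp
      | hadd x y hx hy => rw [map_add, map_add, hx, hy]
      | hsmul c M =>
        rw [map_smul, map_smul, Hall.extend_cls fun _ _ => MH.cls_congr]
        rfl
    rw [MultAt, this]
    exact map_mul (MH.proj A) _ _
  isUnit _ _ := MH.isUnit_cls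
  sub K L M f g h _ _ _ hK := by rw [MH.cls_mul_cls hK, MH.cls_eq_of_isSES h hK]

end Canonical

/-! ### Reduction of multiplicativity along short exact sequences -/

section Reduction

theorem sum_comp_surjective {G H V : Type*} [AddGroup G] [AddGroup H] [Fintype G] [Fintype H]
    [AddCommGroup V] [Module ℚ V] (p : G →+ H) (hp : Function.Surjective p) (f : H → V) :
    (Nat.card H : ℚ) • ∑ g, f (p g) = (Nat.card G : ℚ) • ∑ h, f h := by
  classical
  have hcard : ∀ h, Nat.card {g // p g = h} = Nat.card p.ker := fun h => by
    obtain ⟨g₀, rfl⟩ := hp h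
    refine Nat.card_congr ((Equiv.addLeft (-g₀)).subtypeEquiv fun g => ?_)
    rw [AddMonoidHom.mem_ker, Equiv.coe_addLeft, map_add, map_neg, neg_add_eq_zero, eq_comm]
  have h1 : ∑ g, f (p g) = (Nat.card p.ker : ℚ) • ∑ h, f h := by
    rw [← Finset.sum_fiberwise (g := p), Finset.smul_sum]
    refine Finset.sum_congr rfl fun h _ => ?_
    rw [Finset.sum_congr rfl (g := fun _ => f h) (by
      intro g hg; rw [(Finset.mem_filter.1 hg).2]), Finset.sum_const, Nat.cast_smul_eq_nsmul,
      ← hcard h, Nat.card_eq_fintype_card, Fintype.card_subtype]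
  rw [h1, smul_smul, card_eq_of_fibers p _ hcard, Nat.cast_mul]

variable {A : Type u} [Ring A] {K L M N X F F' Ω : FGModuleCat.{u} A}

/-- A monomorphism between the middle terms of two presentations induces a monomorphism of
pushouts with the same cokernel. -/
theorem exists_isSES_glue_map {φ : Ω →ₗ[A] N} {ι : Ω →ₗ[A] F} (hι : Function.Injective ι)
    {φ' : Ω →ₗ[A] X} {ι' : Ω →ₗ[A] F'} (hι' : Function.Injective ι') {i : N × F →ₗ[A] X × F'}
    {c : X × F' →ₗ[A] K} (hi : IsSES i c) (h : i ∘ₗ φ.prod ι = φ'.prod ι') :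
    ∃ (a : glue φ ι →ₗ[A] glue φ' ι') (b : glue φ' ι' →ₗ[A] K), IsSES a b := by
  obtain ⟨Z, q, a, b, h1, h2, -, -⟩ := exists_quotient (M := FGModuleCat.of A (N × F))
    (X := FGModuleCat.of A (X × F')) (K := Ω) (N := glue φ ι) hi (isSES_glueMk φ hι)
  rw [h] at h1
  obtain ⟨e⟩ := h1.equiv_right (isSES_glueMk φ' hι') (LinearEquiv.refl A _) (LinearEquiv.refl A _)
    rfl
  exact ⟨_, _, h2.congr_mid e⟩

variable [Finite A] {R : Type v} [Ring R] [Algebra ℚ R] {ρ : FGModuleCat.{u} A → R}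

/-- `ρ` is compatible with all short exact sequences that start in `K`. -/
def SubAt (ρ : FGModuleCat.{u} A → R) (K : FGModuleCat.{u} A) : Prop :=
  ∀ ⦃L M : FGModuleCat.{u} A⦄ ⦃f : K →ₗ[A] L⦄ ⦃g : L →ₗ[A] M⦄, IsSES f g →
    ρ K * ρ M = chi K M • ρ L

/-- `ρ` is compatible with all short exact sequences that end in `K`. -/
def QuotAt (ρ : FGModuleCat.{u} A → R) (K : FGModuleCat.{u} A) : Prop :=
  ∀ ⦃L M : FGModuleCat.{u} A⦄ ⦃f : M →ₗ[A] L⦄ ⦃g : L →ₗ[A] K⦄, IsSES f g →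
    ρ K * ρ M = chi K M • ρ L

theorem MultAt.smul_eq_sum (hρ : IsoInvariant ρ) {ι : Ω →ₗ[A] F} {π : F →ₗ[A] M}
    (h : IsSES ι π) [Module.Projective A F] [Fintype (Ω →ₗ[A] N)] :
    Hall.extend ρ (Hall.cls M * Hall.cls N) =
      (chi M N / Nat.card (Ω →ₗ[A] N)) • ∑ φ : Ω →ₗ[A] N, ρ (glue φ ι) := by
  rw [MultAt.eq_sum hρ h lifts_of_projective, chi_eq h lifts_of_projective]
  have := card_hom_ne_zero Ω N
  congr 1
  field_simp

/-- If `ρ` is multiplicative at `(M, K)`, then `ρ M` and `ρ K` commute up to a scalar. -/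
theorem MultAt.comm (hρ : IsoInvariant ρ) (hm : MultAt ρ M K) (hK : SubAt ρ K) :
    chi K M • (ρ M * ρ K) = chi M K • (ρ K * ρ M) := by
  obtain ⟨Ω, F, ι, π, hs, hF⟩ := exists_free_presentation M
  have := Fintype.ofFinite (Ω →ₗ[A] K)
  have h1 : ∀ φ : Ω →ₗ[A] K, ρ K * ρ M = chi K M • ρ (glue φ ι) := fun φ => by
    obtain ⟨r, hr, -⟩ := exists_isSES_glue φ hs
    exact hK (L := glue φ ι) hr
  rw [← hm, MultAt.smul_eq_sum hρ hs, smul_comm, Finset.smul_sum,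
    Finset.sum_congr rfl (fun φ _ => (h1 φ).symm), Finset.sum_const, Finset.card_univ,
    ← Nat.card_eq_fintype_card, ← Nat.cast_smul_eq_nsmul ℚ, smul_smul]
  have := card_hom_ne_zero Ω K
  congr 1
  field_simp

/-- Reduction of the left factor along `0 → M → X → K → 0`. -/
theorem MultAt.of_left_quot (hρ : IsoInvariant ρ) {f : M →ₗ[A] X} {g : X →ₗ[A] K}
    (h : IsSES f g) (hK : PD1 K) (hu : IsUnit (ρ K)) (hq : QuotAt ρ K) (hm : MultAt ρ X N) :
    MultAt ρ M N := by
  obtain ⟨Ω, F, ι, π, hs, hF⟩ := exists_free_presentation X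
  obtain ⟨W, a, b, j, hab, hj, rfl, -⟩ := exists_preimage hs h
  have := projective_left hj hK
  have := Fintype.ofFinite (Ω →ₗ[A] N)
  refine hu.mul_left_cancel ?_
  have key : ∀ φ : Ω →ₗ[A] N, ρ K * ρ (glue φ a) = (chi K N * chi K M) • ρ (glue φ (j ∘ₗ a)) := by
    intro φ
    obtain ⟨r, hr, -⟩ := exists_isSES_glue φ hab
    obtain ⟨a', b', h'⟩ := exists_isSES_glue_map (φ := φ) (φ' := φ) hab.1 hs.1
      (hj.prod_right' (N := N)) (by ext x <;> simp)
    rw [hq h', chi_mid_right (M₂ := glue φ a) hr hK]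
  have h1 : ρ K * ρ M = chi K M • ρ X := hq h
  have hX : chi X N = chi M N * chi K N := chi_mid_left h hK
  rw [← mul_assoc, h1, smul_mul_assoc, ← hm, MultAt.smul_eq_sum hρ hab, MultAt.smul_eq_sum hρ hs,
    mul_smul_comm, Finset.mul_sum, Finset.sum_congr rfl fun φ _ => key φ, ← Finset.smul_sum,
    smul_smul, smul_smul, hX]
  congr 1
  ring

/-- Reduction of the left factor along `0 → P → G → M → 0` with `P` projective. -/
theorem MultAt.of_left_sub (hρ : IsoInvariant ρ) {P G : FGModuleCat.{u} A} {f : P →ₗ[A] G}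
    {g : G →ₗ[A] M} (h : IsSES f g) [Module.Projective A P] (hu : IsUnit (ρ P))
    (hq : SubAt ρ P) (hm : MultAt ρ G N) : MultAt ρ M N := by
  obtain ⟨Ω', F, ι', π', hs, hF⟩ := exists_free_presentation G
  obtain ⟨Ω, a, b, j, hab, hj, rfl, -⟩ := exists_preimage hs h
  have := Fintype.ofFinite (Ω →ₗ[A] N)
  have := Fintype.ofFinite (Ω' →ₗ[A] N)
  refine hu.mul_left_cancel ?_
  have key : ∀ φ : Ω →ₗ[A] N,
      ρ P * ρ (glue φ j) = (chi P N * chi P M) • ρ (glue (φ ∘ₗ a) (j ∘ₗ a)) := by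
    intro φ
    obtain ⟨r, hr, -⟩ := exists_isSES_glue φ hj
    obtain ⟨Z, q, a', b', h1, h2, -, -⟩ := exists_quotient (M := Ω)
      (X := FGModuleCat.of A (N × F)) (C := glue φ j) (isSES_glueMk φ hj.1) hab
    obtain ⟨e⟩ := h1.equiv_right (isSES_glueMk (φ ∘ₗ a) hs.1) (LinearEquiv.refl A _)
      (LinearEquiv.refl A _) rfl
    rw [hq (h2.congr_mid e : IsSES (L := glue (φ ∘ₗ a) (j ∘ₗ a)) (M := glue φ j) _ _),
      chi_mid_right (M₂ := glue φ j) hr pd1_of_projective]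
  let p : (Ω →ₗ[A] N) →+ (Ω' →ₗ[A] N) :=
    AddMonoidHom.mk' (fun ψ => ψ ∘ₗ a) fun a b => LinearMap.add_comp _ _ _
  have hp : Function.Surjective p := Lifts.exists_extension lifts_of_projective hab
  have hsum := sum_comp_surjective p hp fun φ' => ρ (glue φ' (j ∘ₗ a))
  have h1 : ρ P * ρ M = chi P M • ρ G := hq h
  have hG : chi G N = chi P N * chi M N := chi_mid_left_of_projective h
  have c1 := card_hom_ne_zero Ω N
  have c2 := card_hom_ne_zero Ω' N
  have hsum' : ∑ φ : Ω →ₗ[A] N, ρ (glue (φ ∘ₗ a) (j ∘ₗ a)) =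
      ((Nat.card (Ω →ₗ[A] N) : ℚ) / Nat.card (Ω' →ₗ[A] N)) •
        ∑ φ' : Ω' →ₗ[A] N, ρ (glue φ' (j ∘ₗ a)) := by
    rw [div_eq_inv_mul, mul_smul, ← hsum, inv_smul_smul₀ c2]
    rfl
  rw [← mul_assoc, h1, smul_mul_assoc, ← hm, MultAt.smul_eq_sum hρ hj, MultAt.smul_eq_sum hρ hs,
    mul_smul_comm, Finset.mul_sum, Finset.sum_congr rfl fun φ _ => key φ, ← Finset.smul_sum,
    hsum', smul_smul, smul_smul, smul_smul, hG]
  congr 1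
  field_simp

/-- The common last step of the two reductions of the right factor. -/
theorem MultAt.of_right_aux (hu : IsUnit (ρ K))
    (hc : chi K M • (ρ M * ρ K) = chi M K • (ρ K * ρ M)) (hm : MultAt ρ M X)
    (hX : ρ K * ρ N = chi K N • ρ X)
    (h : chi M K • (ρ K * Hall.extend ρ (Hall.cls M * Hall.cls N)) =
      (chi K N * chi K M) • Hall.extend ρ (Hall.cls M * Hall.cls X)) : MultAt ρ M N := by
  refine hu.mul_left_cancel (smul_right_injective R (chi_ne_zero M K) ?_)
  simp only
  rw [h, hm, mul_comm, mul_smul, ← mul_smul_comm, ← hX, ← mul_assoc, ← smul_mul_assoc, hc,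
    smul_mul_assoc, mul_assoc]

/-- Reduction of the right factor along `0 → N → X → K → 0`. -/
theorem MultAt.of_right_quot (hρ : IsoInvariant ρ) {f : N →ₗ[A] X} {g : X →ₗ[A] K}
    (h : IsSES f g) (hK : PD1 K) (hu : IsUnit (ρ K)) (hq : QuotAt ρ K) (hMK : Lifts M K)
    (hc : chi K M • (ρ M * ρ K) = chi M K • (ρ K * ρ M)) (hm : MultAt ρ M X) :
    MultAt ρ M N := by
  refine MultAt.of_right_aux hu hc hm (hq h) ?_
  obtain ⟨Ω, F, ι, π, hs, hF⟩ := exists_free_presentation M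
  have := Fintype.ofFinite (Ω →ₗ[A] N)
  have := Fintype.ofFinite (Ω →ₗ[A] X)
  have := Fintype.ofFinite (F →ₗ[A] X)
  have key : ∀ φ : Ω →ₗ[A] N, ρ K * ρ (glue φ ι) = (chi K N * chi K M) • ρ (glue (f ∘ₗ φ) ι) := by
    intro φ
    obtain ⟨r, hr, -⟩ := exists_isSES_glue φ hs
    obtain ⟨a', b', h'⟩ := exists_isSES_glue_map (φ := φ) (φ' := f ∘ₗ φ) hs.1 hs.1
      (h.prod_right (N := F)) (by ext x <;> simp)
    rw [hq h', chi_mid_right (M₂ := glue φ ι) hr hK]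
  have hlift : ∀ t : Ω →ₗ[A] X, ∃ ψ : F →ₗ[A] X, g ∘ₗ ψ ∘ₗ ι = g ∘ₗ t := by
    intro t
    obtain ⟨s, hs'⟩ := hMK.exists_extension hs (g ∘ₗ t)
    obtain ⟨ψ, rfl⟩ := Module.projective_lifting_property g s h.2.2
    exact ⟨ψ, hs'⟩
  -- maps `Ω → X` come from maps `Ω → N`, up to maps that extend to `F`
  let p : (Ω →ₗ[A] N) × (F →ₗ[A] X) →+ (Ω →ₗ[A] X) :=
    AddMonoidHom.mk' (fun ψ => f ∘ₗ ψ.1 + ψ.2 ∘ₗ ι) fun a b => by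
      simp only [Prod.fst_add, Prod.snd_add, LinearMap.comp_add, LinearMap.add_comp]; abel
  have hp : Function.Surjective p := by
    intro t
    obtain ⟨ψ, hψ⟩ := hlift t
    obtain ⟨φ, hφ⟩ := h.exists_lift (t - ψ ∘ₗ ι) (by rw [LinearMap.comp_sub, hψ, sub_self])
    exact ⟨(φ, ψ), by change f ∘ₗ φ + ψ ∘ₗ ι = t; rw [hφ]; abel⟩
  have hsum := sum_comp_surjective p hp fun φ' => ρ (glue φ' ι)
  have hsum2 : ∑ x, ρ (glue (p x) ι) =
      (Nat.card (F →ₗ[A] X) : ℚ) • ∑ φ : Ω →ₗ[A] N, ρ (glue (f ∘ₗ φ) ι) := by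
    rw [Fintype.sum_prod_type, Finset.smul_sum]
    refine Finset.sum_congr rfl fun φ _ => ?_
    refine (Finset.sum_congr rfl (g := fun _ => ρ (glue (f ∘ₗ φ) ι)) fun ψ _ => hρ
      ((nonempty_glue_add_equiv (f ∘ₗ φ) hs.1 ψ).map LinearEquiv.symm)).trans ?_
    rw [Finset.sum_const, Finset.card_univ, ← Nat.card_eq_fintype_card, Nat.cast_smul_eq_nsmul]
  have hX : chi M X = chi M N * chi M K := chi_mid_right_of_card h hs fun t => by
    obtain ⟨s, rfl⟩ := hMK.exists_extension hs t
    obtain ⟨ψ, rfl⟩ := Module.projective_lifting_property g s h.2.2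
    exact ⟨ψ ∘ₗ ι, rfl⟩
  have c1 := card_hom_ne_zero Ω N
  have c2 := card_hom_ne_zero Ω X
  have c3 := card_hom_ne_zero F X
  have hsum' : ∑ φ : Ω →ₗ[A] N, ρ (glue (f ∘ₗ φ) ι) =
      ((Nat.card (Ω →ₗ[A] N) : ℚ) / Nat.card (Ω →ₗ[A] X)) •
        ∑ φ' : Ω →ₗ[A] X, ρ (glue φ' ι) := by
    rw [hsum2, Nat.card_prod, Nat.cast_mul, mul_comm (Nat.card (Ω →ₗ[A] N) : ℚ), mul_smul,
      smul_comm] at hsum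
    have := smul_right_injective R c3 hsum
    rw [div_eq_inv_mul, mul_smul, ← this, inv_smul_smul₀ c2]
  rw [MultAt.smul_eq_sum hρ hs, MultAt.smul_eq_sum hρ hs,
    mul_smul_comm, Finset.mul_sum, Finset.sum_congr rfl fun φ _ => key φ, ← Finset.smul_sum,
    hsum', smul_smul, smul_smul, smul_smul, smul_smul, hX]
  congr 1
  field_simp

/-- Reduction of the right factor along `0 → K → X → N → 0`. -/
theorem MultAt.of_right_sub (hρ : IsoInvariant ρ) {f : K →ₗ[A] X} {g : X →ₗ[A] N}
    (h : IsSES f g) (hK : PD1 K) (hu : IsUnit (ρ K)) (hq : SubAt ρ K)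
    (hMK : Subsingleton (Ext M.obj K.obj 2))
    (hc : chi K M • (ρ M * ρ K) = chi M K • (ρ K * ρ M)) (hm : MultAt ρ M X) :
    MultAt ρ M N := by
  refine MultAt.of_right_aux hu hc hm (hq h) ?_
  obtain ⟨Ω, F, ι, π, hs, hF⟩ := exists_free_presentation M
  have := Fintype.ofFinite (Ω →ₗ[A] N)
  have := Fintype.ofFinite (Ω →ₗ[A] X)
  have hΩ : Lifts Ω K := lifts_left hs hMK lifts_of_projective
  have key : ∀ φ : Ω →ₗ[A] X, ρ K * ρ (glue (g ∘ₗ φ) ι) = (chi K N * chi K M) • ρ (glue φ ι) := by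
    intro φ
    obtain ⟨r, hr, -⟩ := exists_isSES_glue (g ∘ₗ φ) hs
    obtain ⟨r', hr'⟩ := (h.prod_left (N := F)).quotient_of_lift (isSES_glueMk φ hs.1)
      (isSES_glueMk (g ∘ₗ φ) hs.1) (by ext x <;> simp)
    rw [hq (L := glue φ ι) (M := glue (g ∘ₗ φ) ι) hr', chi_mid_right (M₂ := glue (g ∘ₗ φ) ι) hr hK]
  let p : (Ω →ₗ[A] X) →+ (Ω →ₗ[A] N) :=
    AddMonoidHom.mk' (fun ψ => g ∘ₗ ψ) fun a b => LinearMap.comp_add _ _ _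
  have hp : Function.Surjective p := hΩ _ _ f g h
  have hsum := sum_comp_surjective p hp fun φ' => ρ K * ρ (glue φ' ι)
  have hX : chi M X = chi M K * chi M N := chi_mid_right_of_card h hs (hΩ _ _ f g h)
  have c1 := card_hom_ne_zero Ω N
  have c2 := card_hom_ne_zero Ω X
  have hsum' : ∑ φ : Ω →ₗ[A] N, ρ K * ρ (glue φ ι) =
      ((Nat.card (Ω →ₗ[A] N) : ℚ) / Nat.card (Ω →ₗ[A] X)) •
        (chi K N * chi K M) • ∑ φ' : Ω →ₗ[A] X, ρ (glue φ' ι) := by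
    rw [Finset.smul_sum, ← Finset.sum_congr rfl fun φ _ => key φ, div_eq_inv_mul,
      mul_comm, mul_smul, show ∑ φ : Ω →ₗ[A] X, ρ K * ρ (glue (g ∘ₗ φ) ι) =
      ∑ φ, ρ K * ρ (glue (p φ) ι) from rfl, smul_comm, hsum, inv_smul_smul₀ c2]
  rw [MultAt.smul_eq_sum hρ hs, MultAt.smul_eq_sum hρ hs,
    mul_smul_comm, Finset.mul_sum, hsum', smul_smul, smul_smul, smul_smul, smul_smul, hX]
  congr 1
  field_simp

end Reduction

/-! ### Gorenstein algebras: left self-injective dimension -/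

section LeftGorenstein

variable {A : Type u} [Ring A] {K M N F G Ω : FGModuleCat.{u} A}

theorem injDim_congr (n : ℕ) (e : M ≃ₗ[A] N) (hM : HasInjectiveDimensionLT M.obj n) :
    HasInjectiveDimensionLT N.obj n :=
  hasInjectiveDimensionLT_of_iso (X := M.obj) (X' := N.obj) e.toModuleIso n

theorem injDim_retract (n : ℕ) (i : M →ₗ[A] N) (p : N →ₗ[A] M) (h : p ∘ₗ i = LinearMap.id)
    (hN : HasInjectiveDimensionLT N.obj n) : HasInjectiveDimensionLT M.obj n :=
  Retract.hasInjectiveDimensionLT (X := M.obj) (Y := N.obj)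
    ⟨ModuleCat.ofHom i, ModuleCat.ofHom p, by rw [← ModuleCat.ofHom_comp, h]; rfl⟩ n

theorem pd1_retract (i : M →ₗ[A] N) (p : N →ₗ[A] M) (h : p ∘ₗ i = LinearMap.id)
    (hN : PD1 N) : PD1 M :=
  Retract.hasProjectiveDimensionLT (X := M.obj) (Y := N.obj)
    ⟨ModuleCat.ofHom i, ModuleCat.ofHom p, by rw [← ModuleCat.ofHom_comp, h]; rfl⟩ 2

theorem isZero_obj [Subsingleton M] : Limits.IsZero M.obj :=
  ModuleCat.isZero_of_iff_subsingleton.2 ‹_›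

theorem injDim_pi (k n : ℕ) (hM : HasInjectiveDimensionLT M.obj k) :
    HasInjectiveDimensionLT (FGModuleCat.of A (Fin n → M)).obj k := by
  induction n with
  | zero =>
    have : Subsingleton (FGModuleCat.of A (Fin 0 → M)) :=
      inferInstanceAs (Subsingleton (Fin 0 → M))
    have := isZero_obj (M := FGModuleCat.of A (Fin 0 → M)).hasInjectiveDimensionLT_zero
    exact hasInjectiveDimensionLT_of_ge _ 0 k (Nat.zero_le _)
  | succ n ih =>
    have hs : IsSES (A := A) (K := M) (L := M × (Fin n → M)) (M := Fin n → M)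
      (LinearMap.inl A _ _) (LinearMap.snd A _ _) := isSES_inl_snd
    have h2 := (IsSES.shortExact (K := M) (L := FGModuleCat.of A (M × (Fin n → M)))
      (M := FGModuleCat.of A (Fin n → M)) hs).hasInjectiveDimensionLT_X₂ k hM ih
    exact injDim_congr (M := FGModuleCat.of A (M × (Fin n → M)))
      (N := FGModuleCat.of A (Fin (n + 1) → M)) k (Fin.consLinearEquiv A fun _ => M) h2

theorem pd1_pi (n : ℕ) (hM : PD1 M) : PD1 (FGModuleCat.of A (Fin n → M)) := by
  induction n with
  | zero =>
    have : Subsingleton (FGModuleCat.of A (Fin 0 → M)) :=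
      inferInstanceAs (Subsingleton (Fin 0 → M))
    have := isZero_obj (M := FGModuleCat.of A (Fin 0 → M)).hasProjectiveDimensionLT_zero
    exact hasProjectiveDimensionLT_of_ge _ 0 2 (Nat.zero_le _)
  | succ n ih =>
    have hs : IsSES (A := A) (K := M) (L := M × (Fin n → M)) (M := Fin n → M)
      (LinearMap.inl A _ _) (LinearMap.snd A _ _) := isSES_inl_snd
    exact pd1_congr (M := FGModuleCat.of A (M × (Fin n → M)))
      (N := FGModuleCat.of A (Fin (n + 1) → M)) (Fin.consLinearEquiv A fun _ => M)
      (pd1_mid (K := M) (L := FGModuleCat.of A (M × (Fin n → M)))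
        (M := FGModuleCat.of A (Fin n → M)) hs hM ih)

variable (hA : HasInjectiveDimensionLE (ModuleCat.of A A) 1)
include hA

theorem injDim_of_projective [Module.Projective A M] : HasInjectiveDimensionLE M.obj 1 := by
  obtain ⟨n, p, hp⟩ := Module.Finite.exists_fin' A M
  obtain ⟨i, hi⟩ := Module.projective_lifting_property p LinearMap.id hp
  exact injDim_retract (N := FGModuleCat.of A (Fin n → A)) 2 i p hi
    (injDim_pi (M := FGModuleCat.of A A) 2 n hA)

variable [Finite A]

/-- Over an algebra of left self-injective dimension at most one, modules of projective dimension
at most one have injective dimension at most one. -/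
theorem PD1.injDim (hK : PD1 K) : HasInjectiveDimensionLE K.obj 1 := by
  obtain ⟨Ω, F, ι, π, hs, hF⟩ := exists_free_presentation K
  have := projective_left hs hK
  exact hs.shortExact.hasInjectiveDimensionLT_X₃ 2 (injDim_of_projective hA)
    (have := injDim_of_projective hA (M := Ω)
     hasInjectiveDimensionLT_of_ge Ω.obj 2 3 (by norm_num))

theorem PD1.subsingleton_ext_two_left (hK : PD1 K) (M : FGModuleCat.{u} A) :
    Subsingleton (Ext M.obj K.obj 2) :=
  have := hK.injDim hA
  HasInjectiveDimensionLT.subsingleton K.obj 2 2 le_rfl M.obj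

/-- Submodules of projective modules have no extensions by modules of projective dimension at most
one. -/
theorem lifts_of_isSES_projective {f : G →ₗ[A] F} {g : F →ₗ[A] M} (h : IsSES f g)
    [Module.Projective A F] (hK : PD1 K) : Lifts G K :=
  lifts_left h (hK.subsingleton_ext_two_left hA M) lifts_of_projective

/-- Modules of projective dimension at most two have projective dimension at most one. -/
theorem pd1_right_of_pd1 {f : Ω →ₗ[A] F} {g : F →ₗ[A] M} (h : IsSES f g) (hΩ : PD1 Ω)
    (hF : PD1 F) : PD1 M := by
  have h3 : HasProjectiveDimensionLT M.obj 3 := h.shortExact.hasProjectiveDimensionLT_X₃ 2 hΩ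
    (hasProjectiveDimensionLT_of_ge F.obj 2 3 (by norm_num))
  obtain ⟨Ω₁, F₁, ι₁, π₁, hs₁, hF₁⟩ := exists_free_presentation M
  obtain ⟨Ω₂, F₂, ι₂, π₂, hs₂, hF₂⟩ := exists_free_presentation Ω₁
  have hΩ₁ : PD1 Ω₁ := hs₁.shortExact.hasProjectiveDimensionLT_X₁ 2 pd1_of_projective h3
  have := projective_left hs₂ hΩ₁
  obtain ⟨s, hs⟩ := lifts_of_isSES_projective hA hs₁ (K := Ω₂) pd1_of_projective _ _ _ _ hs₂
    LinearMap.id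
  have := Module.Projective.of_split s π₂ hs
  exact pd1_right hs₁ pd1_of_projective

end LeftGorenstein

/-! ### Gorenstein algebras: right self-injective dimension -/

section RightGorenstein

variable {κ : Type} [Field κ] {B : Type u} [Ring B] [Algebra κ B]

/-- The dual over `κ` of a left or right module over a `κ`-algebra, a module on the other side. It
is a type synonym, since `M →ₗ[κ] κ` carries no action of the algebra. -/
def KDual (κ : Type) [Field κ] (M : Type u) [AddCommGroup M] [Module κ M] : Type u := M →ₗ[κ] κ

namespace KDual

section
variable {M : Type u} [AddCommGroup M] [Module κ M]

instance : AddCommGroup (KDual κ M) := inferInstanceAs (AddCommGroup (M →ₗ[κ] κ))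
instance : Module κ (KDual κ M) := inferInstanceAs (Module κ (M →ₗ[κ] κ))
instance : FunLike (KDual κ M) M κ := inferInstanceAs (FunLike (M →ₗ[κ] κ) M κ)
instance : LinearMapClass (KDual κ M) κ M κ := inferInstanceAs (LinearMapClass (M →ₗ[κ] κ) κ M κ)
instance [Finite M] [Finite κ] : Finite (KDual κ M) :=
  Finite.of_injective (fun f => (f : M → κ)) DFunLike.coe_injective

@[ext] theorem ext {f g : KDual κ M} (h : ∀ x, f x = g x) : f = g := DFunLike.ext _ _ h

@[simp] theorem add_apply (f g : KDual κ M) (x : M) : (f + g) x = f x + g x := rfl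
@[simp] theorem smul_apply (c : κ) (f : KDual κ M) (x : M) : (c • f) x = c • f x := rfl

/-- The dual of a left module is a right module. -/
instance [Module B M] [IsScalarTower κ B M] : Module Bᵐᵒᵖ (KDual κ M) where
  smul b f := LinearMap.comp (show M →ₗ[κ] κ from f) (Module.toModuleEnd κ M b.unop)
  one_smul f := by ext x; exact congrArg f (one_smul B x)
  mul_smul a b f := by ext x; exact congrArg f (mul_smul b.unop a.unop x)
  smul_zero a := rfl
  smul_add a f g := rfl
  add_smul a b f := by ext x; exact (congrArg f (add_smul a.unop b.unop x)).trans (map_add f _ _)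
  zero_smul f := by ext x; exact (congrArg f (zero_smul B x)).trans (map_zero f)

theorem op_smul_apply [Module B M] [IsScalarTower κ B M] (b : Bᵐᵒᵖ) (f : KDual κ M) (x : M) :
    (b • f) x = f (b.unop • x) := rfl

instance [Module B M] [IsScalarTower κ B M] : IsScalarTower κ Bᵐᵒᵖ (KDual κ M) :=
  ⟨fun c b f => by
    ext x
    change f ((c • b.unop) • x) = c • f (b.unop • x)
    rw [smul_assoc]; exact map_smul f _ _⟩

/-- The dual of the regular module, as a left module. -/
instance : Module B (KDual κ B) where
  smul b f := LinearMap.comp (show B →ₗ[κ] κ from f) (LinearMap.mulRight κ b)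
  one_smul f := by ext x; exact congrArg f (mul_one x)
  mul_smul a b f := by ext x; exact congrArg f (mul_assoc x a b).symm
  smul_zero a := rfl
  smul_add a f g := rfl
  add_smul a b f := by ext x; exact (congrArg f (mul_add x a b)).trans (map_add f _ _)
  zero_smul f := by ext x; exact (congrArg f (mul_zero x)).trans (map_zero f)

theorem left_smul_apply (b : B) (f : KDual κ B) (x : B) : (b • f) x = f (x * b) := rfl

instance : IsScalarTower κ B (KDual κ B) :=
  ⟨fun c b f => by
    ext x
    change f (x * c • b) = c • f (x * b)
    rw [mul_smul_comm]; exact map_smul f _ _⟩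

end

section

variable {M : Type u} [AddCommGroup M] [Module κ M] [Module B M] [IsScalarTower κ B M]
  {N : Type u} [AddCommGroup N] [Module κ N] [Module B N] [IsScalarTower κ B N]
  {L : Type u} [AddCommGroup L] [Module κ L] [Module B L] [IsScalarTower κ B L]

/-- The transpose of a linear map. -/
def map (κ : Type) [Field κ] [Algebra κ B] [Module κ M] [Module κ N] [IsScalarTower κ B M]
    [IsScalarTower κ B N] (f : M →ₗ[B] N) : KDual κ N →ₗ[Bᵐᵒᵖ] KDual κ M where
  toFun l := LinearMap.comp (show N →ₗ[κ] κ from l) (f.restrictScalars κ)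
  map_add' _ _ := rfl
  map_smul' b l := by ext x; exact congrArg l (f.map_smul b.unop x).symm

theorem map_apply (f : M →ₗ[B] N) (l : KDual κ N) (x : M) : map κ f l x = l (f x) := rfl

theorem isSES_map {f : M →ₗ[B] N} {g : N →ₗ[B] L} (h : IsSES f g) :
    IsSES (map κ g) (map κ f) := by
  refine ⟨?_, ?_, ?_⟩
  · intro a b hab
    ext x
    obtain ⟨y, rfl⟩ := h.2.2 x
    exact DFunLike.congr_fun hab y
  · intro l
    constructor
    · intro hl
      obtain ⟨s, hs⟩ := (g.restrictScalars κ).exists_rightInverse_of_surjective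
        (LinearMap.range_eq_top.2 h.2.2)
      refine ⟨LinearMap.comp (show N →ₗ[κ] κ from l) s, ?_⟩
      ext x
      have hx : g (s (g x) - x) = 0 := by
        rw [map_sub, sub_eq_zero]; exact LinearMap.congr_fun hs (g x)
      obtain ⟨y, hy⟩ := (h.2.1 _).1 hx
      have : l (f y) = 0 := DFunLike.congr_fun hl y
      rw [hy, map_sub, sub_eq_zero] at this
      exact this
    · rintro ⟨l, rfl⟩
      ext x
      change l (g (f x)) = 0
      rw [h.apply_eq_zero, map_zero]
  · intro l
    obtain ⟨s, hs⟩ := (f.restrictScalars κ).exists_leftInverse_of_injective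
      (LinearMap.ker_eq_bot.2 h.1)
    refine ⟨LinearMap.comp (show M →ₗ[κ] κ from l) s, ?_⟩
    ext x
    exact congrArg l (LinearMap.congr_fun hs x)

/-- The dual of a free module of finite rank is an injective right module. -/
theorem injective_pi (n : ℕ) : Module.Injective Bᵐᵒᵖ (KDual κ (Fin n → B)) where
  out X Y _ _ _ _ f hf g := by
    let _ : Module κ X := Module.compHom X (algebraMap κ Bᵐᵒᵖ)
    let _ : Module κ Y := Module.compHom Y (algebraMap κ Bᵐᵒᵖ)
    have : IsScalarTower κ Bᵐᵒᵖ X := IsScalarTower.of_algebraMap_smul fun _ _ => rfl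
    have : IsScalarTower κ Bᵐᵒᵖ Y := IsScalarTower.of_algebraMap_smul fun _ _ => rfl
    obtain ⟨l, hl⟩ := (f.restrictScalars κ).exists_leftInverse_of_injective
      (LinearMap.ker_eq_bot.2 hf)
    have hl' : ∀ x, l (f x) = x := LinearMap.congr_fun hl
    have hg : ∀ (c : κ) x, g (c • x) = c • g x := fun c x => (g.restrictScalars κ).map_smul c x
    -- a map to the dual of a free module is determined by its values at the standard basis
    let H : Y → KDual κ (Fin n → B) := fun y =>
      ({ toFun := fun w => ∑ i, g (l (MulOpposite.op (w i) • y)) (Pi.single i 1)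
         map_add' := fun w w' => by
          rw [← Finset.sum_add_distrib]
          refine Finset.sum_congr rfl fun i _ => ?_
          rw [Pi.add_apply, MulOpposite.op_add, add_smul, map_add, map_add, add_apply]
         map_smul' := fun c w => by
          rw [RingHom.id_apply, Finset.smul_sum]
          refine Finset.sum_congr rfl fun i _ => ?_
          rw [Pi.smul_apply, MulOpposite.op_smul, smul_assoc, map_smul, hg,
            smul_apply] } : (Fin n → B) →ₗ[κ] κ)
    have hH : ∀ y w, H y w = ∑ i, g (l (MulOpposite.op (w i) • y)) (Pi.single i 1) :=
      fun _ _ => rfl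
    refine ⟨{ toFun := H, map_add' := fun y y' => ?_, map_smul' := fun b y => ?_ }, fun x => ?_⟩
    · ext w
      rw [add_apply, hH, hH, hH, ← Finset.sum_add_distrib]
      refine Finset.sum_congr rfl fun i _ => ?_
      rw [smul_add, map_add, map_add, add_apply]
    · ext w
      rw [RingHom.id_apply, op_smul_apply, hH, hH]
      refine Finset.sum_congr rfl fun i _ => ?_
      rw [smul_smul]
      rfl
    · ext w
      change H (f x) w = _
      rw [hH]
      have : ∀ i, g (l (MulOpposite.op (w i) • f x)) (Pi.single i 1) =
          g x (Pi.single i (w i)) := fun i => by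
        rw [← map_smul f, hl', map_smul, op_smul_apply, MulOpposite.unop_op, ← Pi.single_smul',
          smul_eq_mul, mul_one]
      rw [Finset.sum_congr rfl fun i _ => this i, ← map_sum, Finset.univ_sum_single]

/-- A left module whose dual is an injective right module is projective. -/
theorem projective_of_injective [Module.Finite B M] [Finite B]
    (h : Module.Injective Bᵐᵒᵖ (KDual κ M)) : Module.Projective B M := by
  obtain ⟨n, q, hq⟩ := Module.Finite.exists_fin' B M
  have hinj : Function.Injective (map κ q) := by
    intro a b hab
    ext x
    obtain ⟨y, rfl⟩ := hq x
    exact DFunLike.congr_fun hab y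
  obtain ⟨r, hr⟩ := h.out (map κ q) hinj LinearMap.id
  have : Module.Finite κ B := Module.Finite.of_finite
  let E : (Fin n → B) ≃ₗ[κ] Module.Dual κ (Module.Dual κ (Fin n → B)) :=
    Module.evalEquiv κ (Fin n → B)
  let t : M → Module.Dual κ (Module.Dual κ (Fin n → B)) := fun z =>
    { toFun := fun l => r (show KDual κ (Fin n → B) from l) z
      map_add' := fun l l' => by
        exact DFunLike.congr_fun (map_add r (show KDual κ (Fin n → B) from l) l') z
      map_smul' := fun c l => by
        exact DFunLike.congr_fun
          ((r.restrictScalars κ).map_smul c (show KDual κ (Fin n → B) from l)) z }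
  have hE : ∀ z (l : KDual κ (Fin n → B)), l (E.symm (t z)) = r l z := fun z l => by
    have : E (E.symm (t z)) = t z := E.apply_symm_apply _
    exact LinearMap.congr_fun this l
  have sep : ∀ v w : Fin n → B, (∀ l : KDual κ (Fin n → B), l v = l w) → v = w := fun v w hvw =>
    E.injective (LinearMap.ext fun l => hvw l)
  have sepM : ∀ v w : M, (∀ l : KDual κ M, l v = l w) → v = w := fun v w hvw =>
    Module.eval_apply_injective κ (LinearMap.ext fun l => hvw l)
  let s : M →ₗ[B] (Fin n → B) :=
    { toFun := fun z => E.symm (t z)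
      map_add' := fun z z' => sep _ _ fun l => by
        rw [map_add, hE, hE, hE, map_add]
      map_smul' := fun b z => sep _ _ fun l => by
        have h1 := hE z (MulOpposite.op b • l)
        rw [op_smul_apply, map_smul r, op_smul_apply] at h1
        rw [hE, RingHom.id_apply]
        exact h1.symm }
  refine Module.Projective.of_split s q (LinearMap.ext fun z => sepM _ _ fun l => ?_)
  change l (q (E.symm (t z))) = l z
  rw [← map_apply, hE, hr]
  rfl

end

/-- The regular right module is its own double dual. -/
noncomputable def evalEquiv (κ : Type) [Field κ] [Algebra κ B] [Finite B] :
    B ≃ₗ[Bᵐᵒᵖ] KDual κ (KDual κ B) :=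
  have : Module.Finite κ B := Module.Finite.of_finite
  { (Module.evalEquiv κ B : B ≃ₗ[κ] Module.Dual κ (Module.Dual κ B)) with
    map_smul' := fun _ _ => rfl }

end KDual

variable [Finite B] [Finite κ] (hB : HasInjectiveDimensionLE (ModuleCat.of Bᵐᵒᵖ B) 1)
include hB

/-- The dual of the regular right module has projective dimension at most one: the dual of a free
presentation of it is an injective coresolution of the regular right module, of length one, so that
the kernel of the presentation has an injective dual. -/
theorem pd1_kDual : PD1 (FGModuleCat.of B (KDual κ B)) := by
  obtain ⟨n, p, hp⟩ := Module.Finite.exists_fin' B (KDual κ B)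
  have hs := isSES_ker hp
  have hd := KDual.isSES_map (κ := κ) hs
  have h1 : HasInjectiveDimensionLT (ModuleCat.of Bᵐᵒᵖ (KDual κ (KDual κ B))) 2 :=
    hasInjectiveDimensionLT_of_iso (KDual.evalEquiv κ (B := B)).toModuleIso 2
  have h2 : HasInjectiveDimensionLT (ModuleCat.of Bᵐᵒᵖ (KDual κ (Fin n → B))) 1 :=
    injective_iff_hasInjectiveDimensionLT_one.1
      ((Module.injective_iff_injective_object _ _).1 (KDual.injective_pi n))
  have h3 := (IsSES.shortExact (K := FGModuleCat.of Bᵐᵒᵖ (KDual κ (KDual κ B)))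
    (L := FGModuleCat.of Bᵐᵒᵖ (KDual κ (Fin n → B)))
    (M := FGModuleCat.of Bᵐᵒᵖ (KDual κ (LinearMap.ker p))) hd).hasInjectiveDimensionLT_X₃ 1 h2 h1
  have h4 : Module.Injective Bᵐᵒᵖ (KDual κ (LinearMap.ker p)) :=
    (Module.injective_iff_injective_object _ _).2 (injective_iff_hasInjectiveDimensionLT_one.2 h3)
  have h5 : Module.Projective B (FGModuleCat.of B (LinearMap.ker p)) :=
    KDual.projective_of_injective h4
  have h6 : Module.Projective B (FGModuleCat.of B (Fin n → B)) :=
    inferInstanceAs (Module.Projective B (Fin n → B))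
  exact pd1_right (Ω := FGModuleCat.of B (LinearMap.ker p)) (F := FGModuleCat.of B (Fin n → B))
    (M := FGModuleCat.of B (KDual κ B)) hs pd1_of_projective

/-- Over an algebra of right self-injective dimension at most one, every module embeds in a module
of projective dimension at most one, namely a power of the injective cogenerator. -/
theorem exists_embedding_pd1 (κ : Type) [Field κ] [Finite κ] [Algebra κ B]
    (N : FGModuleCat.{u} B) :
    ∃ (I : FGModuleCat.{u} B) (i : N →ₗ[B] I), PD1 I ∧ Function.Injective i := by
  let _ : Module κ N := Module.compHom N (algebraMap κ B)
  have : IsScalarTower κ B N := IsScalarTower.of_algebraMap_smul fun _ _ => rfl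
  obtain ⟨n, ⟨e⟩⟩ := Finite.exists_equiv_fin (KDual κ N)
  let j : N → KDual κ N → KDual κ B := fun x l =>
    LinearMap.comp (show N →ₗ[κ] κ from l) ((LinearMap.toSpanSingleton B N x).restrictScalars κ)
  have hj : ∀ x l b, j x l b = l (b • x) := fun _ _ _ => rfl
  refine ⟨FGModuleCat.of B (Fin n → KDual κ B),
    { toFun := fun x i => j x (e.symm i), map_add' := fun x y => ?_, map_smul' := fun b x => ?_ },
    pd1_pi n (pd1_kDual hB), fun x y hxy => ?_⟩
  · funext i
    ext b
    change _ = (j x (e.symm i) + j y (e.symm i)) b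
    rw [KDual.add_apply, hj, hj, hj, smul_add, map_add]
  · funext i
    ext c
    change _ = (b • j x (e.symm i)) c
    rw [KDual.left_smul_apply, hj, hj, mul_smul]
  · refine Module.eval_apply_injective κ (LinearMap.ext fun (l : KDual κ N) => ?_)
    have h1 := congrFun hxy (e l)
    have h2 : j x (e.symm (e l)) 1 = j y (e.symm (e l)) 1 := DFunLike.congr_fun h1 1
    rw [hj, hj, one_smul, one_smul, e.symm_apply_apply] at h2
    exact h2

end RightGorenstein

/-! ### The torsion class of a tilting module -/

section LiftsClosure

variable {A : Type u} [Ring A] {F F' K L M N N' Q Ω P : FGModuleCat.{u} A}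

theorem IsSES.pi {f : K →ₗ[A] L} {g : L →ₗ[A] M} (h : IsSES f g) (n : ℕ) :
    IsSES (f.compLeft (Fin n)) (g.compLeft (Fin n)) := by
  refine ⟨fun x y hxy => funext fun i => h.1 (congrFun hxy i), fun x => ?_, fun y => ?_⟩
  · constructor
    · intro hx
      choose z hz using fun i => (h.2.1 (x i)).1 (congrFun hx i)
      exact ⟨z, funext hz⟩
    · rintro ⟨z, rfl⟩
      exact funext fun i => h.apply_eq_zero (z i)
  · choose z hz using fun i => h.2.2 (y i)
    exact ⟨z, funext hz⟩

theorem lsum_comp_single {n : ℕ} {R V W : Type*} [Ring R] [AddCommGroup V] [Module R V]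
    [AddCommGroup W] [Module R W] (ψ : Fin n → V →ₗ[R] W) (i : Fin n) :
    LinearMap.lsum R (fun _ => V) ℕ ψ ∘ₗ LinearMap.single R (fun _ => V) i = ψ i := by
  ext x
  simp only [LinearMap.comp_apply, LinearMap.lsum_apply, LinearMap.sum_apply,
    LinearMap.proj_apply, LinearMap.single_apply]
  rw [Finset.sum_eq_single i (fun j _ hj => by rw [Pi.single_eq_of_ne hj, map_zero])
    (fun h => absurd (Finset.mem_univ i) h), Pi.single_eq_same]

theorem Lifts.retract_left (h : Lifts F N) (i : F' →ₗ[A] F) (p : F →ₗ[A] F')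
    (hip : p ∘ₗ i = LinearMap.id) : Lifts F' N := by
  intro L M f g hs π
  obtain ⟨ψ, hψ⟩ := h L M f g hs (π ∘ₗ p)
  exact ⟨ψ ∘ₗ i, by rw [← LinearMap.comp_assoc, hψ, LinearMap.comp_assoc, hip, LinearMap.comp_id]⟩

theorem Lifts.pi_left (h : Lifts F N) (n : ℕ) : Lifts (FGModuleCat.of A (Fin n → F)) N := by
  intro L M f g hs π
  choose ψ hψ using fun i : Fin n => h L M f g hs (π ∘ₗ LinearMap.single A (fun _ => F) i)
  refine ⟨LinearMap.lsum A (fun _ => F) ℕ ψ, ?_⟩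
  refine LinearMap.pi_ext' fun i => ?_
  rw [← hψ i, LinearMap.comp_assoc, lsum_comp_single]

variable [Finite A]

theorem lifts_of_exists_extension {ι : Ω →ₗ[A] P} {π : P →ₗ[A] F} (h : IsSES ι π)
    [Module.Projective A P] (hN : ∀ φ : Ω →ₗ[A] N, ∃ ψ : P →ₗ[A] N, ψ ∘ₗ ι = φ) : Lifts F N := by
  refine lifts_iff.2 (subsingleton_of_forall_eq 0 fun e => ?_)
  obtain ⟨φ, rfl⟩ := h.connect_surjective subsingleton_ext_of_projective e
  exact (h.connect_eq_zero_iff φ).2 (hN φ)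

theorem Lifts.retract_right (h : Lifts F N) (i : N' →ₗ[A] N) (p : N →ₗ[A] N')
    (hip : p ∘ₗ i = LinearMap.id) : Lifts F N' := by
  obtain ⟨Ω, P, ι, π, hs, hP⟩ := exists_free_presentation F
  refine lifts_of_exists_extension hs fun φ => ?_
  obtain ⟨ψ, hψ⟩ := h.exists_extension hs (i ∘ₗ φ)
  exact ⟨p ∘ₗ ψ, by rw [LinearMap.comp_assoc, hψ, ← LinearMap.comp_assoc, hip, LinearMap.id_comp]⟩

theorem Lifts.pi_right (h : Lifts F N) (n : ℕ) : Lifts F (FGModuleCat.of A (Fin n → N)) := by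
  obtain ⟨Ω, P, ι, π, hs, hP⟩ := exists_free_presentation F
  refine lifts_of_exists_extension hs fun φ => ?_
  choose ψ hψ using fun i : Fin n => h.exists_extension hs
    ((LinearMap.proj i : (Fin n → N) →ₗ[A] N) ∘ₗ φ)
  exact ⟨LinearMap.pi ψ, LinearMap.ext fun x => funext fun i => LinearMap.congr_fun (hψ i) x⟩

theorem Lifts.mid {f : K →ₗ[A] L} {g : L →ₗ[A] M} (h : IsSES f g) (hK : Lifts F K)
    (hM : Lifts F M) : Lifts F L := by
  rw [lifts_iff] at hK hM ⊢
  refine subsingleton_of_forall_eq 0 fun e => ?_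
  obtain ⟨x, rfl⟩ := Ext.covariant_sequence_exact₂ F.obj h.shortExact e (hM.elim _ _)
  rw [hK.elim x 0, Ext.zero_comp]

theorem Lifts.right {f : K →ₗ[A] L} {g : L →ₗ[A] M} (h : IsSES f g) (hF : PD1 F)
    (hL : Lifts F L) : Lifts F M := by
  rw [lifts_iff] at hL ⊢
  have h2 : Subsingleton (Ext F.obj K.obj 2) := hF.subsingleton_ext_two
  refine subsingleton_of_forall_eq 0 fun e => ?_
  obtain ⟨x, rfl⟩ := Ext.covariant_sequence_exact₃ F.obj h.shortExact e (n₁ := 2) rfl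
    (h2.elim _ _)
  rw [hL.elim x 0, Ext.zero_comp]

/-- If all maps from `F` to the right term lift, then `Ext¹(F, -)` vanishes on the left term. -/
theorem Lifts.left {f : K →ₗ[A] L} {g : L →ₗ[A] M} (h : IsSES f g) (hL : Lifts F L)
    (hg : ∀ t : F →ₗ[A] M, ∃ s : F →ₗ[A] L, g ∘ₗ s = t) : Lifts F K := by
  rw [lifts_iff] at hL ⊢
  refine subsingleton_of_forall_eq 0 fun e => ?_
  obtain ⟨x, rfl⟩ := Ext.covariant_sequence_exact₁ F.obj h.shortExact e (hL.elim _ _)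
    (n₀ := 0) rfl
  obtain ⟨y, rfl⟩ := (Ext.mk₀_bijective _ _).2 x
  obtain ⟨s, hs⟩ := hg y.hom
  have hy : y = (ModuleCat.ofHom s : F.obj ⟶ L.obj) ≫ (ModuleCat.ofHom g : L.obj ⟶ M.obj) :=
    ModuleCat.hom_ext hs.symm
  rw [hy, ← Ext.mk₀_comp_mk₀, Ext.comp_assoc_of_second_deg_zero, h.shortExact.comp_extClass,
    Ext.comp_zero]

end LiftsClosure

section Tilting

variable {A : Type u} [Ring A] {T : FGModuleCat.{u} A} {K L M N X T' : FGModuleCat.{u} A}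

theorem InAdd.retract (h : InAdd T N) (i : M →ₗ[A] N) (p : N →ₗ[A] M)
    (hip : p ∘ₗ i = LinearMap.id) : InAdd T M := by
  obtain ⟨n, i', p', h'⟩ := h
  refine ⟨n, i' ∘ₗ i, p ∘ₗ p', ?_⟩
  rw [LinearMap.comp_assoc, ← LinearMap.comp_assoc i, h', LinearMap.id_comp, hip]

theorem InAdd.congr (h : InAdd T N) (e : N ≃ₗ[A] M) : InAdd T M :=
  h.retract e.symm.toLinearMap e.toLinearMap (by ext x; simp)

theorem inAdd_pi (n : ℕ) : InAdd T (FGModuleCat.of A (Fin n → T)) :=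
  ⟨n, LinearMap.id, LinearMap.id, rfl⟩

theorem InAdd.pi (h : InAdd T N) (n : ℕ) : InAdd T (FGModuleCat.of A (Fin n → N)) := by
  obtain ⟨m, i, p, h⟩ := h
  let e : (Fin n → Fin m → T) ≃ₗ[A] (Fin (n * m) → T) :=
    (LinearEquiv.curry A T (Fin n) (Fin m)).symm.trans
      (LinearEquiv.funCongrLeft A T finProdFinEquiv.symm)
  have h1 : InAdd T (FGModuleCat.of A (Fin n → Fin m → T)) := (inAdd_pi (n * m)).congr e.symm
  refine h1.retract (i.compLeft (Fin n)) (p.compLeft (Fin n)) ?_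
  ext x j
  simpa using LinearMap.congr_fun h _

theorem InAdd.prod (hM : InAdd T M) (hN : InAdd T N) : InAdd T (FGModuleCat.of A (M × N)) := by
  obtain ⟨m, i, p, h⟩ := hM
  obtain ⟨n, i', p', h'⟩ := hN
  let e : (Fin (m + n) → T) ≃ₗ[A] ((Fin m → T) × (Fin n → T)) :=
    (LinearEquiv.funCongrLeft A T finSumFinEquiv).trans (LinearEquiv.sumArrowLequivProdArrow _ _ _ _)
  have h1 : InAdd T (FGModuleCat.of A ((Fin m → T) × (Fin n → T))) := (inAdd_pi (m + n)).congr e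
  refine h1.retract (i.prodMap i') (p.prodMap p') ?_
  rw [LinearMap.prodMap_comp, h, h', LinearMap.prodMap_id]

theorem InFac.right (hX : InFac T M) {g : M →ₗ[A] N} (hg : Function.Surjective g) :
    InFac T N := by
  obtain ⟨T₀, p, h, hp⟩ := hX
  exact ⟨T₀, g ∘ₗ p, h, hg.comp hp⟩

theorem InAdd.inFac (h : InAdd T M) : InFac T M := ⟨M, LinearMap.id, h, Function.surjective_id⟩

theorem inAdd_zero : InAdd T (FGModuleCat.of A PUnit.{u + 1}) :=
  (inAdd_pi (T := T) 0).retract 0 0 (by ext)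

theorem InAdd.pd1 (hT : PD1 T) (h : InAdd T M) : PD1 M := by
  obtain ⟨n, i, p, h⟩ := h
  exact pd1_retract (N := FGModuleCat.of A (Fin n → T)) i p h (pd1_pi n hT)

theorem InAdd.lifts (h : InAdd T M) (hN : Lifts T N) : Lifts M N := by
  obtain ⟨n, i, p, h⟩ := h
  exact (hN.pi_left n).retract_left i p h

theorem IsTilting.pd1 (hT : IsTilting T) (hM : InAdd T M) : PD1 M := hM.pd1 hT.projDim

/-- Every module embeds in a module of `Fac T` with cokernel in `add T`: the coresolution of a free
cover is pushed out. -/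
theorem IsTilting.exists_fac (hT : IsTilting T) (M : FGModuleCat.{u} A) :
    ∃ (X T' : FGModuleCat.{u} A) (f : M →ₗ[A] X) (g : X →ₗ[A] T'),
      InFac T X ∧ InAdd T T' ∧ IsSES f g := by
  obtain ⟨T₀, T₁, f, g, h₀, h₁, hs⟩ := hT.coresolution
  obtain ⟨n, p, hp⟩ := Module.Finite.exists_fin' A M
  have hs' := IsSES.pi (K := FGModuleCat.of A A) hs n
  obtain ⟨r, hr, -⟩ := exists_isSES_glue (Ω := FGModuleCat.of A (Fin n → A))
    (F := FGModuleCat.of A (Fin n → T₀)) (M := FGModuleCat.of A (Fin n → T₁)) p hs'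
  refine ⟨_, _, _, r, ?_, h₁.pi n, hr⟩
  have hq := isSES_glueMk (Ω := FGModuleCat.of A (Fin n → A))
    (F := FGModuleCat.of A (Fin n → T₀)) p hs'.1
  refine ⟨FGModuleCat.of A (Fin n → T₀), glueMk (Ω := FGModuleCat.of A (Fin n → A))
    (F := FGModuleCat.of A (Fin n → T₀)) p _ ∘ₗ LinearMap.inr A M (Fin n → T₀), h₀.pi n, ?_⟩
  intro e
  obtain ⟨⟨m, t⟩, rfl⟩ := hq.2.2 e
  obtain ⟨a, rfl⟩ := hp m
  refine ⟨t - f.compLeft (Fin n) a, ?_⟩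
  rw [LinearMap.comp_apply, LinearMap.inr_apply, ← sub_eq_zero, ← map_sub]
  refine (hq.2.1 _).2 ⟨-a, ?_⟩
  ext <;> simp

variable [Finite A]

theorem IsTilting.lifts_self (hT : IsTilting T) : Lifts T T :=
  lifts_iff.2 (hT.ext_self 1 one_pos)

theorem IsTilting.lifts_add (hT : IsTilting T) (h : InAdd T M) : Lifts T M := by
  obtain ⟨n, i, p, h⟩ := h
  exact (hT.lifts_self.pi_right n).retract_right i p h

/-- `Fac T` is the class of the modules `M` with `Ext¹(T, M) = 0`. -/
theorem IsTilting.inFac_iff (hT : IsTilting T) : InFac T M ↔ Lifts T M := by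
  constructor
  · rintro ⟨T₀, p, h, hp⟩
    exact Lifts.right (K := FGModuleCat.of A (LinearMap.ker p)) (isSES_ker hp) hT.projDim
      (hT.lifts_add h)
  · intro h
    obtain ⟨T₀, T₁, f, g, h₀, h₁, hs⟩ := hT.coresolution
    obtain ⟨n, p, hp⟩ := Module.Finite.exists_fin' A M
    choose ψ hψ using fun i : Fin n => (h₁.lifts h).exists_extension
      (Ω := FGModuleCat.of A A) hs (p ∘ₗ LinearMap.single A (fun _ => A) i)
    refine ⟨FGModuleCat.of A (Fin n → T₀), LinearMap.lsum A (fun _ => T₀) ℕ ψ, h₀.pi n, ?_⟩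
    have : LinearMap.lsum A (fun _ => T₀) ℕ ψ ∘ₗ f.compLeft (Fin n) = p := by
      refine LinearMap.pi_ext' fun i => ?_
      have hf : f.compLeft (Fin n) ∘ₗ LinearMap.single A (fun _ => A) i =
          LinearMap.single A (fun _ => T₀) i ∘ₗ f := by
        refine LinearMap.ext fun x => funext fun j => ?_
        obtain rfl | hj := eq_or_ne j i <;> simp [*]
      rw [← hψ i, LinearMap.comp_assoc, hf, ← LinearMap.comp_assoc, lsum_comp_single]
    have hp' : Function.Surjective (LinearMap.lsum A (fun _ => T₀) ℕ ψ ∘ₗ f.compLeft (Fin n)) :=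
      this ▸ hp
    exact fun y => (hp' y).elim fun x hx => ⟨_, hx⟩

theorem IsTilting.lifts (hT : IsTilting T) (hM : InAdd T M) (hN : InFac T N) : Lifts M N :=
  hM.lifts (hT.inFac_iff.1 hN)

theorem IsTilting.inFac_mid (hT : IsTilting T) {f : K →ₗ[A] L} {g : L →ₗ[A] M} (h : IsSES f g)
    (hK : InFac T K) (hM : InFac T M) : InFac T L := by
  rw [hT.inFac_iff] at *
  exact hK.mid h hM

theorem IsTilting.add_of_isSES (hT : IsTilting T) {f : K →ₗ[A] L} {g : L →ₗ[A] M} (h : IsSES f g)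
    (hK : InAdd T K) (hM : InAdd T M) : InAdd T L := by
  obtain ⟨s, hs⟩ := hT.lifts hM hK.inFac _ _ _ _ h LinearMap.id
  obtain ⟨e⟩ := h.equiv_prod_of_section s hs
  exact (hK.prod hM).congr e

/-- A presentation of a module in `Fac T` by a module in `add T`, with kernel in `Fac T`. -/
theorem IsTilting.exists_presentation (hT : IsTilting T) (hX : InFac T X) :
    ∃ (K T₀ : FGModuleCat.{u} A) (f : K →ₗ[A] T₀) (g : T₀ →ₗ[A] X),
      IsSES f g ∧ InFac T K ∧ InAdd T T₀ := by
  obtain ⟨n, ⟨e⟩⟩ := Finite.exists_equiv_fin (T →ₗ[A] X)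
  let p : (Fin n → T) →ₗ[A] X := LinearMap.lsum A (fun _ => T) ℕ fun i => e.symm i
  have hlift : ∀ t : T →ₗ[A] X, ∃ s : T →ₗ[A] (Fin n → T), p ∘ₗ s = t := fun t =>
    ⟨LinearMap.single A (fun _ => T) (e t), by
      rw [lsum_comp_single, e.symm_apply_apply]⟩
  have hp : Function.Surjective p := by
    obtain ⟨T₀, q, ⟨m, i, r, hir⟩, hq⟩ := hX
    choose s hs using fun j : Fin m => hlift (q ∘ₗ r ∘ₗ LinearMap.single A (fun _ => T) j)
    have h1 : p ∘ₗ LinearMap.lsum A (fun _ => T) ℕ s = q ∘ₗ r := by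
      refine LinearMap.pi_ext' fun j => ?_
      rw [LinearMap.comp_assoc, lsum_comp_single, hs j, LinearMap.comp_assoc]
    have hr : Function.Surjective r := fun x => ⟨i x, LinearMap.congr_fun hir x⟩
    have h2 : Function.Surjective (p ∘ₗ LinearMap.lsum A (fun _ => T) ℕ s) := h1 ▸ hq.comp hr
    exact fun y => (h2 y).elim fun x hx => ⟨_, hx⟩
  refine ⟨FGModuleCat.of A (LinearMap.ker p), FGModuleCat.of A (Fin n → T), _, p, isSES_ker hp,
    ?_, inAdd_pi n⟩
  exact hT.inFac_iff.2 (Lifts.left (K := FGModuleCat.of A (LinearMap.ker p))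
    (L := FGModuleCat.of A (Fin n → T)) (isSES_ker hp) (hT.lifts_add (inAdd_pi n)) hlift)

end Tilting

/-! ### Extending functions from the torsion class to all modules -/

section ChiZero

variable {A : Type u} [Ring A] [Finite A] {K M N : FGModuleCat.{u} A}

theorem chi_zero_left : chi (FGModuleCat.of A PUnit.{u + 1}) N = 1 := by
  have : Module.Projective A (FGModuleCat.of A PUnit.{u + 1}) :=
    Module.Projective.of_free (P := PUnit.{u + 1})
  have h := chi_mid_left_of_projective (M₁ := FGModuleCat.of A PUnit.{u + 1}) (M₂ := N) (M₃ := N)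
    (N := N) isSES_zero_id
  exact (mul_eq_right₀ (chi_ne_zero N N)).1 h.symm

theorem chi_zero_right (hK : PD1 K) : chi K (FGModuleCat.of A PUnit.{u + 1}) = 1 := by
  have h := chi_mid_right (M₁ := K) (M₂ := K) (M₃ := FGModuleCat.of A PUnit.{u + 1})
    isSES_id_zero hK
  exact (mul_eq_left₀ (chi_ne_zero K K)).1 h.symm

theorem chi_congr_right (hK : PD1 K) (e : M ≃ₗ[A] N) : chi K M = chi K N := by
  have h := chi_mid_right (M₁ := M) (M₂ := N) (M₃ := FGModuleCat.of A PUnit.{u + 1})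
    (isSES_id_zero.congr_left e) hK
  rw [h, chi_zero_right hK, mul_one]

theorem chi_congr_left (e : K ≃ₗ[A] M) : chi K N = chi M N := by
  have : Module.Projective A (FGModuleCat.of A PUnit.{u + 1}) :=
    Module.Projective.of_free (P := PUnit.{u + 1})
  have h := chi_mid_left_of_projective (M₁ := FGModuleCat.of A PUnit.{u + 1}) (M₂ := K) (M₃ := M)
    (N := N) (isSES_zero_id.congr_right e)
  rw [h, chi_zero_left, one_mul]

end ChiZero

section EmbeddingPreimage

variable {A : Type u} [Ring A] [Finite A]

/-- Over an algebra whose modules embed in modules of projective dimension at most one, every module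
is the quotient of a submodule of a projective module by a projective module. -/
theorem exists_isSES_of_embedding
    (hE : ∀ N : FGModuleCat.{u} A, ∃ (I : FGModuleCat.{u} A) (i : N →ₗ[A] I),
      PD1 I ∧ Function.Injective i) (N : FGModuleCat.{u} A) :
    ∃ (P G Q C : FGModuleCat.{u} A) (f : P →ₗ[A] G) (g : G →ₗ[A] N) (j : G →ₗ[A] Q)
      (c : Q →ₗ[A] C),
      Module.Projective A P ∧ Module.Projective A Q ∧ IsSES f g ∧ IsSES j c := by
  obtain ⟨I, i, hI, hi⟩ := hE N
  obtain ⟨P₁, P₀, ι, π, hs, hP₀⟩ := exists_free_presentation I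
  have hP₁ := projective_left hs hI
  have hc : IsSES (L := I) (M := FGModuleCat.of A (I ⧸ LinearMap.range i)) i _ := isSES_coker hi
  obtain ⟨G, a, b, j, hab, hj, -, -⟩ := exists_preimage (M := N)
    (C := FGModuleCat.of A (I ⧸ LinearMap.range i)) hs hc
  exact ⟨P₁, G, P₀, _, a, b, j, _, hP₁, hP₀, hab, hj⟩

end EmbeddingPreimage

section ExtendFac

variable {A : Type u} [Ring A] [Finite A] {T K L M N X X' Z T' T'' : FGModuleCat.{u} A}
  {R : Type v} [Ring R] [Algebra ℚ R] {ρ ξ : FGModuleCat.{u} A → R}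

/-- `ξ` is determined by `ρ` through `ρ(T') ξ(M) = χ(T', M) ρ(X)`, for all short exact sequences
`0 → M → X → T' → 0` with `X` in `Fac T` and `T'` in `add T`. -/
def ExtendsFac (T : FGModuleCat.{u} A) (ρ ξ : FGModuleCat.{u} A → R) : Prop :=
  ∀ ⦃M X T' : FGModuleCat.{u} A⦄ ⦃f : M →ₗ[A] X⦄ ⦃g : X →ₗ[A] T'⦄, IsSES f g → InFac T X →
    InAdd T T' → ρ T' * ξ M = chi T' M • ρ X

theorem ExtendsFac.eq (hξ : ExtendsFac T ρ ξ) (hρ : IsHallMap (InFac T) ρ)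
    (hX : InFac T X) : ξ X = ρ X := by
  have h := hξ (M := X) (X := X) isSES_id_zero hX inAdd_zero
  rwa [hρ.map_zero inAdd_zero.inFac, chi_zero_left, one_mul, one_smul] at h

variable (hT : IsTilting T) (hρ : IsHallMap (InFac T) ρ)

include hT hρ

theorem IsHallMap.isUnit_add (h : InAdd T T') : IsUnit (ρ T') :=
  hρ.isUnit h.inFac (hT.pd1 h)

theorem IsHallMap.quot_add {f : X →ₗ[A] Z} {g : Z →ₗ[A] T'} (h : IsSES f g) (hX : InFac T X)
    (h' : InAdd T T') : ρ T' * ρ X = chi T' X • ρ Z := by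
  obtain ⟨s, hs⟩ := hT.lifts h' hX _ _ _ _ h LinearMap.id
  have hP : InFac T (FGModuleCat.of A (X × T')) :=
    hT.inFac_mid (L := FGModuleCat.of A (X × T')) isSES_inl_snd hX h'.inFac
  rw [hρ.sub (L := FGModuleCat.of A (X × T')) isSES_inr_fst h'.inFac hP hX (hT.pd1 h'),
    hρ.congr (h.equiv_prod_of_section s hs)]

theorem IsHallMap.comm_add (hX : InFac T X) (hX' : PD1 X) (h' : InAdd T T') :
    chi X T' • (ρ T' * ρ X) = chi T' X • (ρ X * ρ T') := by
  have hP : InFac T (FGModuleCat.of A (X × T')) :=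
    hT.inFac_mid (L := FGModuleCat.of A (X × T')) isSES_inl_snd hX h'.inFac
  rw [hρ.quot_add hT (Z := FGModuleCat.of A (X × T')) isSES_inl_snd hX h',
    hρ.sub (L := FGModuleCat.of A (X × T')) isSES_inl_snd hX hP h'.inFac hX', smul_comm]

theorem IsHallMap.exists_extendsFac : ∃ ξ : FGModuleCat.{u} A → R, ExtendsFac T ρ ξ := by
  have key : ∀ M : FGModuleCat.{u} A, ∃ x : R, ∀ (X T' : FGModuleCat.{u} A) (f : M →ₗ[A] X)
      (g : X →ₗ[A] T'), IsSES f g → InFac T X → InAdd T T' → ρ T' * x = chi T' M • ρ X := by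
    intro M
    obtain ⟨X, T', f, g, hX, hT', h⟩ := hT.exists_fac M
    obtain ⟨u, hu⟩ := hρ.isUnit_add hT hT'
    refine ⟨(u⁻¹ : Rˣ) * (chi T' M • ρ X), fun X₁ T₁ f₁ g₁ h₁ hX₁ hT₁ => ?_⟩
    have hx : ρ T' * ((u⁻¹ : Rˣ) * (chi T' M • ρ X)) = chi T' M • ρ X := by
      rw [← hu, Units.mul_inv_cancel_left]
    -- the values given by two choices are compared in the pushout of `X` and `X₁` along `M`
    obtain ⟨Z, a, b, a', b', hab, hab'⟩ := exists_pushout h h₁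
    have e1 := hρ.quot_add hT hab hX hT₁
    have e2 := hρ.quot_add hT hab' hX₁ hT'
    have e3 := hρ.comm_add hT hT₁.inFac (hT.pd1 hT₁) hT'
    refine (hρ.isUnit_add hT hT').mul_left_cancel (smul_right_injective R (chi_ne_zero T₁ T') ?_)
    simp only
    rw [← mul_assoc, ← smul_mul_assoc, e3, smul_mul_assoc, mul_assoc, hx, mul_smul_comm,
      mul_smul_comm, e1, e2, chi_mid_right h (hT.pd1 hT₁), chi_mid_right h₁ (hT.pd1 hT')]
    module
  choose ξ hξ using key
  exact ⟨ξ, fun M X T' f g => hξ M X T' f g⟩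

variable (hξ : ExtendsFac T ρ ξ)

include hξ

theorem ExtendsFac.congr : IsoInvariant ξ := by
  rintro M N ⟨e⟩
  obtain ⟨X, T', f, g, hX, hT', h⟩ := hT.exists_fac N
  refine (hρ.isUnit_add hT hT').mul_left_cancel ?_
  rw [hξ h hX hT', hξ (h.congr_left e) hX hT', chi_congr_right (hT.pd1 hT') e]

theorem ExtendsFac.quotAt (hT' : InAdd T T') : QuotAt ξ T' := by
  intro L M f g h
  obtain ⟨X, T₂, f₂, g₂, hX, hT₂, h₂⟩ := hT.exists_fac L
  -- `T₃ = X / M` is an extension of `T₂` by `T'`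
  obtain ⟨T₃, q, a, b, hq, hab, -, -⟩ := exists_quotient h₂ h
  have hT₃ := hT.add_of_isSES hab hT' hT₂
  have e1 := hξ hq hX hT₃
  have e2 := hξ h₂ hX hT₂
  have e3 := hρ.quot_add hT hab hT'.inFac hT₂
  have e4 : chi T₃ M = chi T' M * chi T₂ M := chi_mid_left hab (hT.pd1 hT₂)
  refine (hρ.isUnit_add hT hT₂).mul_left_cancel ?_
  rw [hξ.eq hρ hT'.inFac, ← mul_assoc, e3, smul_mul_assoc, e1, mul_smul_comm, e2, e4,
    chi_mid_right h (hT.pd1 hT₂)]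
  module

theorem ExtendsFac.subAt (hK : PD1 K) : SubAt ξ K := by
  intro L M f g h
  obtain ⟨Y, T₁, f₁, g₁, hY, hT₁, h₁⟩ := hT.exists_fac K
  have hY' : PD1 Y := pd1_mid h₁ hK (hT.pd1 hT₁)
  -- `Z` contains `Y` with quotient `M`, and `Q = X / Y` is an extension of `T₂` by `M`; so the
  -- sequence `0 → K → L → M → 0` is compared with `0 → Y → X → Q → 0`, which lies in `Fac T`
  obtain ⟨Z, a, b, a', b', hab, hab'⟩ := exists_pushout h₁ h
  obtain ⟨X, T₂, f₂, g₂, hX, hT₂, h₂⟩ := hT.exists_fac Z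
  obtain ⟨Q, q, c, d, hq, hcd, -, -⟩ := exists_quotient h₂ hab
  have hQ : InFac T Q := hX.right hq.2.2
  have e1 := hξ hcd hQ hT₂
  have e2 := hρ.sub hq hY hX hQ hY'
  have e3 := hξ h₁ hY hT₁
  have e4 := hξ h₂ hX hT₂
  have e5 := hξ.quotAt hT hρ hT₁ hab'
  rw [hξ.eq hρ hT₁.inFac] at e5
  have e6 := hρ.comm_add hT hY hY' hT₂
  have c1 : chi Y M = chi K M * chi T₁ M := chi_mid_left h₁ (hT.pd1 hT₁)
  refine (hρ.isUnit_add hT hT₁).mul_left_cancel ((hρ.isUnit_add hT hT₂).mul_left_cancel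
    (smul_right_injective R (chi_ne_zero Y T₂) ?_))
  simp only
  rw [← mul_assoc (ρ T₁), e3, smul_mul_assoc, mul_smul_comm, ← mul_assoc, smul_comm,
    ← smul_mul_assoc, e6, smul_mul_assoc, mul_assoc, e1, mul_smul_comm, e2, mul_smul_comm, e5,
    mul_smul_comm, mul_smul_comm, e4, chi_mid_right hcd hY', c1, chi_mid_right h (hT.pd1 hT₁),
    chi_mid_right hab (hT.pd1 hT₂)]
  module

theorem ExtendsFac.isUnit (hK : PD1 K) : IsUnit (ξ K) := by
  obtain ⟨Y, T₁, f₁, g₁, hY, hT₁, h₁⟩ := hT.exists_fac K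
  have hu := hρ.isUnit hY (pd1_mid h₁ hK (hT.pd1 hT₁))
  have e := hξ h₁ hY hT₁
  obtain ⟨u, hu₁⟩ := hρ.isUnit_add hT hT₁
  rw [← hu₁] at e
  have : IsUnit (chi T₁ K • ρ Y) := hu.smul (Units.mk0 _ (chi_ne_zero T₁ K))
  rw [← e] at this
  exact (Units.isUnit_units_mul u _).1 this

/-- The extension of `ρ` is multiplicative. The left factor is reduced to `Fac T`, then the right
factor is reduced for a left factor without extensions by `add T`; over a Gorenstein algebra every
module is a quotient of such a module by a projective module. -/
theorem ExtendsFac.multAt (hA : HasInjectiveDimensionLE (ModuleCat.of A A) 1)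
    (hE : ∀ N : FGModuleCat.{u} A, ∃ (I : FGModuleCat.{u} A) (i : N →ₗ[A] I),
      PD1 I ∧ Function.Injective i) (M N : FGModuleCat.{u} A) : MultAt ξ M N := by
  have hiso := hξ.congr hT hρ
  have hadd : ∀ {T'}, InAdd T T' → IsUnit (ξ T') := fun h => hξ.isUnit hT hρ (hT.pd1 h)
  have h1 : ∀ {M N}, InFac T M → InFac T N → MultAt ξ M N := by
    intro M N hM hN
    obtain ⟨Ω, F, ι, π, hs, hF⟩ := exists_free_presentation M
    have := Fintype.ofFinite (Ω →ₗ[A] N)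
    have := hρ.mul hM hN
    rw [MultAt, MultAt.eq_sum hρ.congr hs lifts_of_projective] at this
    rw [MultAt, MultAt.eq_sum hiso hs lifts_of_projective, hξ.eq hρ hM, hξ.eq hρ hN, ← this]
    congr 1
    refine Finset.sum_congr rfl fun φ _ => hξ.eq hρ ?_
    obtain ⟨r, hr, -⟩ := exists_isSES_glue φ hs
    exact hT.inFac_mid (L := glue φ ι) hr hN hM
  have h2 : ∀ {M N}, InFac T N → MultAt ξ M N := by
    intro M N hN
    obtain ⟨X, T', f, g, hX, hT', h⟩ := hT.exists_fac M
    exact MultAt.of_left_quot hiso h (hT.pd1 hT') (hadd hT') (hξ.quotAt hT hρ hT') (h1 hX hN)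
  have h3 : ∀ {G P C N : FGModuleCat.{u} A} {i : G →ₗ[A] P} {p : P →ₗ[A] C}, IsSES i p →
      Module.Projective A P → MultAt ξ G N := by
    intro G P C N i p hs hP
    obtain ⟨X, T', f, g, hX, hT', h⟩ := hT.exists_fac N
    exact MultAt.of_right_quot hiso h (hT.pd1 hT') (hadd hT') (hξ.quotAt hT hρ hT')
      (lifts_of_isSES_projective hA hs (hT.pd1 hT'))
      (MultAt.comm hiso (h2 hT'.inFac) (hξ.subAt hT hρ (hT.pd1 hT'))) (h2 hX)
  obtain ⟨P, G, Q, C, f, g, j, c, hP, hQ, h, hj⟩ := exists_isSES_of_embedding hE M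
  exact MultAt.of_left_sub hiso h (hξ.isUnit hT hρ pd1_of_projective)
    (hξ.subAt hT hρ pd1_of_projective) (h3 hj hQ)

theorem ExtendsFac.isHallMap (hA : HasInjectiveDimensionLE (ModuleCat.of A A) 1)
    (hE : ∀ N : FGModuleCat.{u} A, ∃ (I : FGModuleCat.{u} A) (i : N →ₗ[A] I),
      PD1 I ∧ Function.Injective i) : IsHallMap (fun _ => True) ξ where
  congr := hξ.congr hT hρ
  mul M N _ _ := hξ.multAt hT hρ hA hE M N
  isUnit _ _ hK := hξ.isUnit hT hρ hK
  sub _ _ _ _ _ h _ _ _ hK := hξ.subAt hT hρ hK h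

end ExtendFac

/-! ### Extending functions from a torsion-free class to all modules -/

section ExtendSub

variable {A : Type u} [Ring A]

/-- A class of modules that contains the projective modules and is closed under submodules and
extensions. -/
structure IsResolvingFree (Y : FGModuleCat.{u} A → Prop) : Prop where
  proj : ∀ ⦃P : FGModuleCat.{u} A⦄, Module.Projective A P → Y P
  sub : ∀ ⦃M N : FGModuleCat.{u} A⦄ (i : M →ₗ[A] N), Function.Injective i → Y N → Y M
  mid : ∀ ⦃K L M : FGModuleCat.{u} A⦄ ⦃f : K →ₗ[A] L⦄ ⦃g : L →ₗ[A] M⦄, IsSES f g → Y K → Y M → Y L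

variable [Finite A] {K L M N P X X' Z : FGModuleCat.{u} A} {Y : FGModuleCat.{u} A → Prop}
  {R : Type v} [Ring R] [Algebra ℚ R] {ρ ξ : FGModuleCat.{u} A → R}

/-- `ξ` is determined by `ρ` through `ρ(P) ξ(M) = χ(P, M) ρ(X)`, for all short exact sequences
`0 → P → X → M → 0` with `P` projective and `X` in the class `Y`. -/
def ExtendsSub (Y : FGModuleCat.{u} A → Prop) (ρ ξ : FGModuleCat.{u} A → R) : Prop :=
  ∀ ⦃P X M : FGModuleCat.{u} A⦄ ⦃f : P →ₗ[A] X⦄ ⦃g : X →ₗ[A] M⦄, IsSES f g →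
    Module.Projective A P → Y X → ρ P * ξ M = chi P M • ρ X

theorem ExtendsSub.eq (hξ : ExtendsSub Y ρ ξ) (hY : IsResolvingFree Y) (hρ : IsHallMap Y ρ)
    (hX : Y X) : ξ X = ρ X := by
  have hp : Module.Projective A (FGModuleCat.of A PUnit.{u + 1}) :=
    Module.Projective.of_free (P := PUnit.{u + 1})
  have h := hξ (P := FGModuleCat.of A PUnit.{u + 1}) (M := X) (X := X) isSES_zero_id hp hX
  rwa [hρ.map_zero (hY.proj hp), chi_zero_left, one_mul, one_smul] at h

variable (hY : IsResolvingFree Y) (hρ : IsHallMap Y ρ)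

include hY hρ

theorem IsHallMap.comm_of_projective (hX : Y X) (hX' : PD1 X) (hP : Module.Projective A P) :
    chi X P • (ρ P * ρ X) = chi P X • (ρ X * ρ P) := by
  have hZ : Y (FGModuleCat.of A (X × P)) :=
    hY.mid (L := FGModuleCat.of A (X × P)) isSES_inl_snd hX (hY.proj hP)
  rw [hρ.sub (L := FGModuleCat.of A (X × P)) isSES_inr_fst (hY.proj hP) hZ hX pd1_of_projective,
    hρ.sub (L := FGModuleCat.of A (X × P)) isSES_inl_snd hX hZ (hY.proj hP) hX', smul_comm]

variable (hE : ∀ N : FGModuleCat.{u} A, ∃ (P X : FGModuleCat.{u} A) (f : P →ₗ[A] X)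
  (g : X →ₗ[A] N), Module.Projective A P ∧ Y X ∧ IsSES f g)

include hE

theorem IsHallMap.exists_extendsSub : ∃ ξ : FGModuleCat.{u} A → R, ExtendsSub Y ρ ξ := by
  have key : ∀ M : FGModuleCat.{u} A, ∃ x : R, ∀ (P X : FGModuleCat.{u} A) (f : P →ₗ[A] X)
      (g : X →ₗ[A] M), IsSES f g → Module.Projective A P → Y X → ρ P * x = chi P M • ρ X := by
    intro M
    obtain ⟨P, X, f, g, hP, hX, h⟩ := hE M
    have hu := hρ.isUnit (hY.proj hP) pd1_of_projective
    obtain ⟨u, hu'⟩ := hu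
    refine ⟨(u⁻¹ : Rˣ) * (chi P M • ρ X), fun P₁ X₁ f₁ g₁ h₁ hP₁ hX₁ => ?_⟩
    have hx : ρ P * ((u⁻¹ : Rˣ) * (chi P M • ρ X)) = chi P M • ρ X := by
      rw [← hu', Units.mul_inv_cancel_left]
    -- the values given by two choices are compared in the pullback of `X` and `X₁` over `M`
    obtain ⟨Z, a, b, a', b', hab, hab'⟩ := exists_pullback h h₁
    have hZ := hY.mid hab (hY.proj hP) hX₁
    have e1 := hρ.sub hab (hY.proj hP) hZ hX₁ pd1_of_projective
    have e2 := hρ.sub hab' (hY.proj hP₁) hZ hX pd1_of_projective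
    have e3 := hρ.comm_of_projective hY (hY.proj hP₁) pd1_of_projective hP
    refine (hρ.isUnit (hY.proj hP) pd1_of_projective).mul_left_cancel
      (smul_right_injective R (chi_ne_zero P₁ P) ?_)
    simp only
    rw [← mul_assoc, ← smul_mul_assoc, e3, smul_mul_assoc, mul_assoc, hx, mul_smul_comm,
      mul_smul_comm, e1, e2, chi_mid_right h pd1_of_projective,
      chi_mid_right h₁ pd1_of_projective]
    module
  choose ξ hξ using key
  exact ⟨ξ, fun P X M f g => hξ M P X f g⟩

variable (hξ : ExtendsSub Y ρ ξ)

include hξ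

theorem ExtendsSub.congr : IsoInvariant ξ := by
  rintro M N ⟨e⟩
  obtain ⟨P, X, f, g, hP, hX, h⟩ := hE M
  refine (hρ.isUnit (hY.proj hP) pd1_of_projective).mul_left_cancel ?_
  rw [hξ h hP hX, hξ (h.congr_right e) hP hX, chi_congr_right pd1_of_projective e]

theorem ExtendsSub.subAt (hK : PD1 K) : SubAt ξ K := by
  intro L M f g h
  obtain ⟨P, X, f₁, g₁, hP, hX, h₁⟩ := hE L
  -- `W` is the preimage of `K` in `X`, and `V` is the pullback of `X` and `X₂` over `M`; so the
  -- sequence `0 → K → L → M → 0` is compared with `0 → W → V → X₂ → 0`, which lies in the class `Y`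
  obtain ⟨W, a, b, j, hab, hj, -, -⟩ := exists_preimage h₁ h
  have hW : Y W := hY.sub j hj.1 hX
  have hW' : PD1 W := pd1_mid hab pd1_of_projective hK
  obtain ⟨P₂, X₂, f₂, g₂, hP₂, hX₂, h₂⟩ := hE M
  obtain ⟨V, c, d, c', d', hcd, hcd'⟩ := exists_pullback hj h₂
  have hV : Y V := hY.mid hcd hW hX₂
  have e1 := hξ hab hP hW
  have e2 := hξ h₁ hP hX
  have e3 := hξ h₂ hP₂ hX₂
  have e4 := hρ.sub hcd hW hV hX₂ hW'
  have e5 := hρ.sub hcd' (hY.proj hP₂) hV hX pd1_of_projective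
  have e6 := hρ.comm_of_projective hY hW hW' hP₂
  have c1 : chi W M = chi P M * chi K M := chi_mid_left hab hK
  refine (hρ.isUnit (hY.proj hP) pd1_of_projective).mul_left_cancel
    ((hρ.isUnit (hY.proj hP₂) pd1_of_projective).mul_left_cancel
    (smul_right_injective R (chi_ne_zero W P₂) ?_))
  simp only
  rw [← mul_assoc (ρ P), e1, smul_mul_assoc, mul_smul_comm, ← mul_assoc, smul_comm,
    ← smul_mul_assoc, e6, smul_mul_assoc, mul_assoc, e3, mul_smul_comm, e4, mul_smul_comm, e2,
    mul_smul_comm, mul_smul_comm, e5, chi_mid_right h₂ hW', c1, chi_mid_right h pd1_of_projective,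
    chi_mid_right hj pd1_of_projective]
  module

theorem ExtendsSub.isUnit (hK : PD1 K) : IsUnit (ξ K) := by
  obtain ⟨P, X, f, g, hP, hX, h⟩ := hE K
  have hu := hρ.isUnit hX (pd1_mid h pd1_of_projective hK)
  have e := hξ h hP hX
  obtain ⟨u, hu₁⟩ := hρ.isUnit (hY.proj hP) pd1_of_projective
  rw [← hu₁] at e
  have : IsUnit (chi P K • ρ X) := hu.smul (Units.mk0 _ (chi_ne_zero P K))
  rw [← e] at this
  exact (Units.isUnit_units_mul u _).1 this

/-- The extension of `ρ` is multiplicative: the left factor and then the right factor are reduced to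
the class `Y`. The second reduction needs that `Ext²` vanishes on projective modules in the second
variable. -/
theorem ExtendsSub.multAt (hA : HasInjectiveDimensionLE (ModuleCat.of A A) 1)
    (M N : FGModuleCat.{u} A) : MultAt ξ M N := by
  have hiso := hξ.congr hY hρ hE
  have hu : ∀ {P : FGModuleCat.{u} A}, Module.Projective A P → IsUnit (ξ P) := fun h =>
    hξ.isUnit hY hρ hE pd1_of_projective
  have hs : ∀ {P : FGModuleCat.{u} A}, Module.Projective A P → SubAt ξ P := fun h =>
    hξ.subAt hY hρ hE pd1_of_projective
  have h1 : ∀ {M N}, Y M → Y N → MultAt ξ M N := by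
    intro M N hM hN
    obtain ⟨Ω, F, ι, π, hs, hF⟩ := exists_free_presentation M
    have := Fintype.ofFinite (Ω →ₗ[A] N)
    have := hρ.mul hM hN
    rw [MultAt, MultAt.eq_sum hρ.congr hs lifts_of_projective] at this
    rw [MultAt, MultAt.eq_sum hiso hs lifts_of_projective, hξ.eq hY hρ hM, hξ.eq hY hρ hN, ← this]
    congr 1
    refine Finset.sum_congr rfl fun φ _ => hξ.eq hY hρ ?_
    obtain ⟨r, hr, -⟩ := exists_isSES_glue φ hs
    exact hY.mid (L := glue φ ι) hr hN hM
  have h2 : ∀ {M N}, Y N → MultAt ξ M N := by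
    intro M N hN
    obtain ⟨P, X, f, g, hP, hX, h⟩ := hE M
    exact MultAt.of_left_sub hiso h (hu hP) (hs hP) (h1 hX hN)
  obtain ⟨P, X, f, g, hP, hX, h⟩ := hE N
  exact MultAt.of_right_sub hiso h pd1_of_projective (hu hP) (hs hP)
    (PD1.subsingleton_ext_two_left hA pd1_of_projective M)
    (MultAt.comm hiso (h2 (hY.proj hP)) (hs hP)) (h2 hX)

theorem ExtendsSub.isHallMap (hA : HasInjectiveDimensionLE (ModuleCat.of A A) 1) :
    IsHallMap (fun _ => True) ξ where
  congr := hξ.congr hY hρ hE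
  mul M N _ _ := hξ.multAt hY hρ hE hA M N
  isUnit _ _ hK := hξ.isUnit hY hρ hE hK
  sub _ _ _ _ _ h _ _ _ hK := hξ.subAt hY hρ hE hK h

end ExtendSub

/-! ### The tilting functor on the torsion class -/

section HomFunctor

variable {A : Type u} [Ring A] [Finite A] {T K L M N X X' : FGModuleCat.{u} A}

/-- The functor `Hom(T, -)` on maps. -/
def homMap (T : FGModuleCat.{u} A) (f : M →ₗ[A] N) : homFunctor T M →ₗ[EndOp T] homFunctor T N where
  toFun t := f ∘ₗ (show T →ₗ[A] M from t)
  map_add' s t := LinearMap.comp_add (show T →ₗ[A] M from s) (show T →ₗ[A] M from t) f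
  map_smul' c t := (LinearMap.comp_assoc c.unop (show T →ₗ[A] M from t) f).symm

theorem homMap_comp (g : M →ₗ[A] N) (f : L →ₗ[A] M) :
    homMap T (g ∘ₗ f) = homMap T g ∘ₗ homMap T f := rfl

theorem homMap_id : homMap T (LinearMap.id : M →ₗ[A] M) = LinearMap.id := rfl

theorem homMap_zero : homMap T (0 : M →ₗ[A] N) = 0 := rfl

theorem nonempty_homFunctor_equiv (e : M ≃ₗ[A] N) :
    Nonempty (homFunctor T M ≃ₗ[EndOp T] homFunctor T N) :=
  ⟨LinearEquiv.ofLinearMap (homMap T e.toLinearMap) (homMap T e.symm.toLinearMap)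
    (by rw [← homMap_comp, LinearEquiv.comp_coe, LinearEquiv.symm_trans_self]; rfl)
    (by rw [← homMap_comp, LinearEquiv.comp_coe, LinearEquiv.self_trans_symm]; rfl)⟩

/-- `Hom(T, T)` is the regular module. -/
def homFunctorSelf (T : FGModuleCat.{u} A) : homFunctor T T ≃ₗ[EndOp T] EndOp T where
  toFun t := MulOpposite.op (show T →ₗ[A] T from t)
  invFun t := t.unop
  map_add' _ _ := rfl
  map_smul' _ _ := rfl
  left_inv _ := rfl
  right_inv _ := rfl

/-- `Hom(T, -)` commutes with finite powers. -/
def homFunctorPi (T M : FGModuleCat.{u} A) (n : ℕ) :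
    homFunctor T (FGModuleCat.of A (Fin n → M)) ≃ₗ[EndOp T] (Fin n → homFunctor T M) where
  toFun t i := (LinearMap.proj i ∘ₗ (show T →ₗ[A] (Fin n → M) from t) : T →ₗ[A] M)
  invFun t := (LinearMap.pi fun i => (show T →ₗ[A] M from t i) : T →ₗ[A] (Fin n → M))
  map_add' _ _ := rfl
  map_smul' _ _ := rfl
  left_inv _ := rfl
  right_inv _ := rfl

/-- `Hom(T, -)` commutes with products. -/
def homFunctorProd (T M N : FGModuleCat.{u} A) :
    homFunctor T (FGModuleCat.of A (M × N)) ≃ₗ[EndOp T] homFunctor T M × homFunctor T N where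
  toFun t := ((LinearMap.fst A M N ∘ₗ (show T →ₗ[A] M × N from t) : T →ₗ[A] M),
    (LinearMap.snd A M N ∘ₗ (show T →ₗ[A] M × N from t) : T →ₗ[A] N))
  invFun t := ((show T →ₗ[A] M from t.1).prod (show T →ₗ[A] N from t.2) : T →ₗ[A] M × N)
  map_add' _ _ := rfl
  map_smul' _ _ := rfl
  left_inv _ := rfl
  right_inv _ := rfl

/-- The powers of `T` correspond to the free modules of finite rank. -/
noncomputable def homFunctorFree (T : FGModuleCat.{u} A) (n : ℕ) :
    homFunctor T (FGModuleCat.of A (Fin n → T)) ≃ₗ[EndOp T] (Fin n → EndOp T) :=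
  (homFunctorPi T T n).trans (LinearEquiv.piCongrRight fun _ => homFunctorSelf T)

theorem InAdd.projective_homFunctor (h : InAdd T M) :
    Module.Projective (EndOp T) (homFunctor T M) := by
  obtain ⟨n, i, p, h⟩ := h
  have h1 : Module.Projective (EndOp T) (homFunctor T (FGModuleCat.of A (Fin n → T))) :=
    Module.Projective.of_equiv (homFunctorFree T n).symm
  exact Module.Projective.of_split (homMap T (N := FGModuleCat.of A (Fin n → T)) i)
    (homMap T (M := FGModuleCat.of A (Fin n → T)) p) (by
      rw [← homMap_comp, h, homMap_id])

theorem homMap_injective_of_injective {f : M →ₗ[A] N} (hf : Function.Injective f) :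
    Function.Injective (homMap T f) := fun s t hst =>
  LinearMap.ext fun x => hf (LinearMap.congr_fun (show f ∘ₗ (show T →ₗ[A] M from s) =
    f ∘ₗ (show T →ₗ[A] M from t) from hst) x)

theorem InFac.eq_of_homMap_eq (hX : InFac T X) {f g : X →ₗ[A] M} (h : homMap T f = homMap T g) :
    f = g := by
  obtain ⟨T₀, q, ⟨m, i, r, hir⟩, hq⟩ := hX
  have hr : Function.Surjective r := fun x => ⟨i x, LinearMap.congr_fun hir x⟩
  have key : f ∘ₗ q ∘ₗ r = g ∘ₗ q ∘ₗ r := by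
    refine LinearMap.pi_ext' fun j => ?_
    exact LinearMap.congr_fun h (q ∘ₗ r ∘ₗ LinearMap.single A (fun _ => T) j : T →ₗ[A] X)
  refine LinearMap.ext fun x => ?_
  obtain ⟨y, rfl⟩ := hq x
  obtain ⟨z, rfl⟩ := hr y
  exact LinearMap.congr_fun key z

theorem InAdd.exists_homMap_eq (hX : InAdd T X)
    (φ : homFunctor T X →ₗ[EndOp T] homFunctor T M) : ∃ f : X →ₗ[A] M, homMap T f = φ := by
  obtain ⟨n, i, p, h⟩ := hX
  -- a map out of `Hom(T, Tⁿ)` is determined by the images of the inclusions `T → Tⁿ`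
  let S : Fin n → T →ₗ[A] (FGModuleCat.of A (Fin n → T)) := LinearMap.single A (fun _ => T)
  let q : FGModuleCat.of A (Fin n → T) →ₗ[A] X := p
  let j : X →ₗ[A] FGModuleCat.of A (Fin n → T) := i
  let ψ : Fin n → T →ₗ[A] M := fun j => φ (homMap T q (S j : T →ₗ[A] _))
  let f : FGModuleCat.of A (Fin n → T) →ₗ[A] M := LinearMap.lsum A (fun _ => T) ℕ ψ
  have hf : homMap T f = φ ∘ₗ homMap T q := by
    have h1 : homMap T f ∘ₗ (homFunctorPi T T n).symm.toLinearMap =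
        (φ ∘ₗ homMap T q) ∘ₗ (homFunctorPi T T n).symm.toLinearMap := by
      refine LinearMap.pi_ext' fun k => ?_
      have h2 : (homFunctorPi T T n).symm.toLinearMap ∘ₗ
          LinearMap.single (EndOp T) (fun _ => homFunctor T T) k = homMap T (S k) := by
        refine LinearMap.ext fun t => LinearMap.ext fun x => funext fun l => ?_
        change (show T →ₗ[A] T from (Pi.single k t : Fin n → homFunctor T T) l) x =
          (Pi.single k ((show T →ₗ[A] T from t) x) : Fin n → T) l
        obtain rfl | hl := eq_or_ne l k
        · rw [Pi.single_eq_same, Pi.single_eq_same]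
        · rw [Pi.single_eq_of_ne hl, Pi.single_eq_of_ne hl]; rfl
      rw [LinearMap.comp_assoc, LinearMap.comp_assoc, h2, ← homMap_comp, lsum_comp_single]
      exact LinearMap.ext fun t =>
        (φ.map_smul (MulOpposite.op (show T →ₗ[A] T from t)) (homMap T q (S k : T →ₗ[A] _))).symm
    refine LinearMap.ext fun t => ?_
    obtain ⟨t, rfl⟩ := (homFunctorPi T T n).symm.surjective t
    exact LinearMap.congr_fun h1 t
  refine ⟨f ∘ₗ j, ?_⟩
  rw [homMap_comp, hf, LinearMap.comp_assoc, ← homMap_comp, show q ∘ₗ j = LinearMap.id from h]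
  rfl

variable (hT : IsTilting T)

include hT

theorem IsTilting.isSES_homMap {f : K →ₗ[A] L} {g : L →ₗ[A] M} (h : IsSES f g)
    (hK : InFac T K) : IsSES (homMap T f) (homMap T g) := by
  refine ⟨homMap_injective_of_injective h.1, fun t => ⟨fun ht => ?_, ?_⟩, fun t => ?_⟩
  · obtain ⟨s, hs⟩ := h.exists_lift (N := T) t ht
    exact ⟨s, hs⟩
  · rintro ⟨s, rfl⟩
    exact LinearMap.ext fun x => h.apply_eq_zero _
  · obtain ⟨s, hs⟩ := hT.inFac_iff.1 hK _ _ _ _ h t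
    exact ⟨s, hs⟩

/-- `Hom(T, -)` is full on `Fac T`. -/
theorem InFac.exists_homMap_eq (hX : InFac T X)
    (φ : homFunctor T X →ₗ[EndOp T] homFunctor T M) : ∃ f : X →ₗ[A] M, homMap T f = φ := by
  obtain ⟨K, T₀, f, g, h, hK, hT₀⟩ := hT.exists_presentation hX
  have hF := hT.isSES_homMap h hK
  obtain ⟨s, hs⟩ := hT₀.exists_homMap_eq (φ ∘ₗ homMap T g)
  obtain ⟨r, hr⟩ := h.exists_desc s (hK.eq_of_homMap_eq (by
    rw [homMap_comp, hs, homMap_zero]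
    exact LinearMap.ext fun t => (congrArg φ (hF.apply_eq_zero t)).trans (map_zero φ)))
  exact ⟨r, hF.desc_unique (by rw [← homMap_comp, hr, hs])⟩

theorem InFac.bijective_homMap (hX : InFac T X) :
    Function.Bijective (homMap T : (X →ₗ[A] M) → _) :=
  ⟨fun _ _ => hX.eq_of_homMap_eq, hX.exists_homMap_eq hT⟩

theorem InFac.nonempty_equiv (hX : InFac T X) (hX' : InFac T X')
    (e : homFunctor T X ≃ₗ[EndOp T] homFunctor T X') : Nonempty (X ≃ₗ[A] X') := by
  obtain ⟨f, hf⟩ := hX.exists_homMap_eq hT e.toLinearMap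
  obtain ⟨g, hg⟩ := hX'.exists_homMap_eq hT e.symm.toLinearMap
  refine ⟨LinearEquiv.ofLinearMap f g (hX'.eq_of_homMap_eq ?_) (hX.eq_of_homMap_eq ?_)⟩
  · rw [homMap_comp, hf, hg, homMap_id, LinearEquiv.comp_coe, LinearEquiv.symm_trans_self]; rfl
  · rw [homMap_comp, hf, hg, homMap_id, LinearEquiv.comp_coe, LinearEquiv.self_trans_symm]; rfl

theorem IsTilting.nonempty_homFunctor_glue_equiv {ι : K →ₗ[A] L} (hι : Function.Injective ι)
    (φ : K →ₗ[A] N) (hK : InFac T K) : Nonempty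
      (homFunctor T (glue φ ι) ≃ₗ[EndOp T] glue (homMap T φ) (homMap T ι)) := by
  have h := hT.isSES_homMap (L := FGModuleCat.of A (N × L)) (M := glue φ ι) (isSES_glueMk φ hι) hK
  exact h.equiv_right (isSES_glueMk (homMap T φ) (homMap_injective_of_injective hι))
    (LinearEquiv.refl _ _) (homFunctorProd T N L) rfl

end HomFunctor

/-! ### The torsion-free class of modules of the form `Hom(T, X)` -/

section InHom

variable {A : Type u} [Ring A] [Finite A] {T K L M N X X' : FGModuleCat.{u} A}
  {Y Y' E : FGModuleCat.{u} (EndOp T)}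

/-- The modules isomorphic to some `Hom(T, X)` with `X` in `Fac T`. -/
def InHom (T : FGModuleCat.{u} A) (Y : FGModuleCat.{u} (EndOp T)) : Prop :=
  ∃ X : FGModuleCat.{u} A, InFac T X ∧ Nonempty (homFunctor T X ≃ₗ[EndOp T] Y)

theorem InHom.congr (h : InHom T Y) (e : Y ≃ₗ[EndOp T] Y') : InHom T Y' := by
  obtain ⟨X, hX, ⟨e'⟩⟩ := h
  exact ⟨X, hX, ⟨e'.trans e⟩⟩

theorem inHom_homFunctor (hX : InFac T X) : InHom T (homFunctor T X) := ⟨X, hX, ⟨LinearEquiv.refl _ _⟩⟩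

theorem exists_homFunctor_surjective (Y : FGModuleCat.{u} (EndOp T)) :
    ∃ (T₀ : FGModuleCat.{u} A) (p : homFunctor T T₀ →ₗ[EndOp T] Y),
      InAdd T T₀ ∧ Function.Surjective p := by
  obtain ⟨n, p, hp⟩ := Module.Finite.exists_fin' (EndOp T) Y
  exact ⟨FGModuleCat.of A (Fin n → T), p ∘ₗ (homFunctorFree T n).toLinearMap, inAdd_pi n,
    hp.comp (homFunctorFree T n).surjective⟩

variable (hT : IsTilting T)

include hT

/-- A submodule of `Hom(T, X)` is `Hom(T, X')`, where `X'` is the cokernel of the map between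
modules of `add T` that corresponds to a presentation of the submodule. -/
theorem InHom.of_injective {i : Y →ₗ[EndOp T] Y'} (hi : Function.Injective i) (h : InHom T Y') :
    InHom T Y := by
  obtain ⟨X, hX, ⟨e⟩⟩ := h
  let j : Y →ₗ[EndOp T] homFunctor T X := e.symm.toLinearMap ∘ₗ i
  have hj : Function.Injective j := e.symm.injective.comp hi
  obtain ⟨T₀, b, hT₀, hb⟩ := exists_homFunctor_surjective Y
  obtain ⟨T₁, a, hT₁, ha⟩ := exists_homFunctor_surjective
    (FGModuleCat.of (EndOp T) (LinearMap.ker b))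
  obtain ⟨α, hα⟩ := hT₁.exists_homMap_eq ((LinearMap.ker b).subtype ∘ₗ a)
  obtain ⟨β, hβ⟩ := hT₀.exists_homMap_eq (j ∘ₗ b)
  have hba : b ∘ₗ homMap T α = 0 := by
    rw [hα]
    exact LinearMap.ext fun t => (a t).2
  let U : FGModuleCat.{u} A := FGModuleCat.of A (LinearMap.range α)
  let X' : FGModuleCat.{u} A := FGModuleCat.of A (T₀ ⧸ LinearMap.range α)
  let q : T₀ →ₗ[A] X' := (LinearMap.range α).mkQ
  have hq : IsSES (K := U) (LinearMap.range α).subtype q := isSES_mkQ _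
  have hU : InFac T U := hT₁.inFac.right α.surjective_rangeRestrict
  have hX' : InFac T X' := hT₀.inFac.right hq.2.2
  have hqF := hT.isSES_homMap hq hU
  have hqα : q ∘ₗ α = 0 := LinearMap.ext fun x =>
    (Submodule.Quotient.mk_eq_zero _).2 (LinearMap.mem_range_self α x)
  obtain ⟨c, hc⟩ := (isSES_ker hb).exists_desc (homMap T q) (by
    refine LinearMap.ext fun t => ?_
    obtain ⟨t, rfl⟩ := ha t
    have := LinearMap.congr_fun (congrArg (homMap T) hqα) t
    rw [homMap_comp, hα] at this
    exact this)
  obtain ⟨γ, hγ⟩ := hq.exists_desc β (by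
    refine LinearMap.ext fun x => ?_
    obtain ⟨_, x, rfl⟩ := x
    have : β ∘ₗ α = 0 := hT₁.inFac.eq_of_homMap_eq (by
      rw [homMap_comp, hβ, LinearMap.comp_assoc, hba, LinearMap.comp_zero, homMap_zero])
    exact LinearMap.congr_fun this x)
  have hγc : homMap T γ ∘ₗ c = j := (isSES_ker hb).desc_unique (by
    rw [LinearMap.comp_assoc, hc, ← homMap_comp, hγ, hβ])
  refine ⟨X', hX', ⟨(LinearEquiv.ofBijective c ⟨?_, ?_⟩).symm⟩⟩
  · exact Function.Injective.of_comp (f := homMap T γ) (by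
      rw [← LinearMap.coe_comp, hγc]; exact hj)
  · exact fun y => (hqF.2.2 y).elim fun x hx => ⟨b x, (LinearMap.congr_fun hc x).trans hx⟩

/-- Every extension of `Hom(T, M)` by `Hom(T, N)` comes from an extension of `M` by `N`. -/
theorem IsTilting.exists_isSES_of_homFunctor (hM : InFac T M) (hN : InFac T N)
    {f : homFunctor T N →ₗ[EndOp T] E} {g : E →ₗ[EndOp T] homFunctor T M} (h : IsSES f g) :
    ∃ (L : FGModuleCat.{u} A) (f' : N →ₗ[A] L) (g' : L →ₗ[A] M), IsSES f' g' ∧ InFac T L ∧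
      Nonempty (homFunctor T L ≃ₗ[EndOp T] E) := by
  obtain ⟨K, T₀, ι, π, hs, hK, hT₀⟩ := hT.exists_presentation hM
  have := hT₀.projective_homFunctor
  obtain ⟨φ, ⟨e⟩⟩ := exists_glue_equiv_of_lifts (hT.isSES_homMap hs hK) lifts_of_projective h
  obtain ⟨φ, rfl⟩ := hK.exists_homMap_eq hT φ
  obtain ⟨r, hr, -⟩ := exists_isSES_glue φ hs
  obtain ⟨e'⟩ := hT.nonempty_homFunctor_glue_equiv hs.1 φ hK
  exact ⟨glue φ ι, _, r, hr, hT.inFac_mid hr hN hM, ⟨e'.trans e⟩⟩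

theorem IsTilting.isResolvingFree : IsResolvingFree (InHom T) where
  proj P hP := by
    obtain ⟨T₀, p, hT₀, hp⟩ := exists_homFunctor_surjective P
    obtain ⟨s, hs⟩ := Module.projective_lifting_property p LinearMap.id hp
    exact InHom.of_injective hT (i := s) (Function.LeftInverse.injective (g := p)
      fun x => LinearMap.congr_fun hs x) (inHom_homFunctor hT₀.inFac)
  sub M N i hi h := h.of_injective hT hi
  mid K L M f g h := by
    rintro ⟨N, hN, ⟨a⟩⟩ ⟨M, hM, ⟨b⟩⟩
    obtain ⟨L, -, -, -, hL, e⟩ := hT.exists_isSES_of_homFunctor hM hN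
      ((h.congr_left a).congr_right b.symm)
    exact ⟨L, hL, e⟩

/-! ### Comparison of Hall products, Euler forms and projective dimensions -/

/-- Both sides are computed from one presentation of `K` by `add T`, which `Hom(T, -)` turns into a
presentation by a projective module. -/
theorem IsTilting.chi_homFunctor (hK : InFac T K) (hM : InFac T M) :
    chi (homFunctor T K) (homFunctor T M) = chi K M := by
  obtain ⟨L, T₀, ι, π, hs, hL, hT₀⟩ := hT.exists_presentation hK
  have := hT₀.projective_homFunctor
  rw [chi_eq hs (hT.lifts hT₀ hM), chi_eq (hT.isSES_homMap hs hL) lifts_of_projective,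
    Nat.card_congr (Equiv.ofBijective _ (hL.bijective_homMap hT)),
    Nat.card_congr (Equiv.ofBijective _ (hT₀.inFac.bijective_homMap hT))]

/-- `Hom(T, -)` preserves the Hall products of modules of `Fac T`: it carries the pushouts of a
presentation by `add T` to the pushouts of a presentation by a projective module. -/
theorem IsTilting.multAt_iff {R : Type v} [Ring R] [Algebra ℚ R] {ρ : FGModuleCat.{u} A → R}
    {σ : FGModuleCat.{u} (EndOp T) → R} (hρ : IsoInvariant ρ) (hσ : IsoInvariant σ)
    (h : ∀ ⦃X⦄, InFac T X → σ (homFunctor T X) = ρ X) (hM : InFac T M) (hN : InFac T N) :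
    MultAt ρ M N ↔ MultAt σ (homFunctor T M) (homFunctor T N) := by
  obtain ⟨K, T₀, ι, π, hs, hK, hT₀⟩ := hT.exists_presentation hM
  have := hT₀.projective_homFunctor
  have := Fintype.ofFinite (K →ₗ[A] N)
  have := Fintype.ofFinite (homFunctor T K →ₗ[EndOp T] homFunctor T N)
  rw [MultAt, MultAt, h hM, h hN, MultAt.eq_sum hρ hs (hT.lifts hT₀ hN),
    MultAt.eq_sum hσ (hT.isSES_homMap hs hK) lifts_of_projective,
    Nat.card_congr (Equiv.ofBijective _ (hT₀.inFac.bijective_homMap hT)),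
    ← Equiv.sum_comp (Equiv.ofBijective _ (hK.bijective_homMap hT))
      fun φ => σ (glue φ (homMap T ι))]
  have key : ∀ φ : K →ₗ[A] N, ρ (glue φ ι) = σ (glue (homMap T φ) (homMap T ι)) := fun φ => by
    obtain ⟨r, hr, -⟩ := exists_isSES_glue φ hs
    rw [← h (hT.inFac_mid (L := glue φ ι) hr hN hM),
      hσ (hT.nonempty_homFunctor_glue_equiv hs.1 φ hK)]
  simp only [key, Equiv.ofBijective_apply]

/-- If `K` has projective dimension at most one, then the kernel of a presentation of `K` by `add T`
is itself in `add T`, and `Hom(T, -)` turns the presentation into a projective resolution. -/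
theorem IsTilting.pd1_homFunctor (hK : InFac T K) (h : PD1 K) : PD1 (homFunctor T K) := by
  obtain ⟨L, T₀, ι, π, hs, hL, hT₀⟩ := hT.exists_presentation hK
  obtain ⟨L', T₁, ι', π', hs', hL', hT₁⟩ := hT.exists_presentation hL
  obtain ⟨s, hs''⟩ := lifts_left hs h.subsingleton_ext_two (hT.lifts hT₀ hL') _ _ _ _ hs'
    LinearMap.id
  have := (hT₁.retract s π' hs'').projective_homFunctor
  have := hT₀.projective_homFunctor
  exact pd1_right (hT.isSES_homMap hs hL) pd1_of_projective

theorem IsTilting.pd1_of_homFunctor (hA : HasInjectiveDimensionLE (ModuleCat.of A A) 1)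
    (hK : InFac T K) (h : PD1 (homFunctor T K)) : PD1 K := by
  obtain ⟨L, T₀, ι, π, hs, hL, hT₀⟩ := hT.exists_presentation hK
  obtain ⟨L', T₁, ι', π', hs', hL', hT₁⟩ := hT.exists_presentation hL
  have := hT₀.projective_homFunctor
  have := projective_left (hT.isSES_homMap hs hL) h
  obtain ⟨s, hs''⟩ := Module.projective_lifting_property (homMap T π') LinearMap.id
    (hT.isSES_homMap hs' hL').2.2
  obtain ⟨s, rfl⟩ := hL.exists_homMap_eq hT s
  exact pd1_right_of_pd1 hA hs (hT.pd1 (hT₁.retract s π' (hL.eq_of_homMap_eq hs''))) (hT.pd1 hT₀)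

end InHom

/-! ### The isomorphism of modified Ringel-Hall algebras -/

section Transfer

variable {A : Type u} [Ring A] [Finite A] {T : FGModuleCat.{u} A} (hT : IsTilting T)

include hT

theorem IsTilting.isHallMap_homFunctor :
    IsHallMap (InFac T) fun X => MH.cls (homFunctor T X) where
  congr _ _ := fun ⟨e⟩ => MH.cls_congr (nonempty_homFunctor_equiv e)
  mul _ _ hM hN := (hT.multAt_iff (fun _ _ ⟨e⟩ => MH.cls_congr (nonempty_homFunctor_equiv e))
    MH.isHallMap_cls.congr (fun _ _ => rfl) hM hN).2 (MH.isHallMap_cls.mul trivial trivial)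
  isUnit _ hK h := MH.isUnit_cls (hT.pd1_homFunctor hK h)
  sub _ _ _ _ _ h hK _ hM h1 := by
    rw [← hT.chi_homFunctor hK hM]
    exact MH.isHallMap_cls.sub (hT.isSES_homMap h hK) trivial trivial trivial
      (hT.pd1_homFunctor hK h1)

/-- The classes in `MH A` of the modules of `Fac T`, seen as a function on the modules `Hom(T, X)`. -/
theorem IsTilting.exists_isHallMap_inHom (hA : HasInjectiveDimensionLE (ModuleCat.of A A) 1) :
    ∃ σ : FGModuleCat.{u} (EndOp T) → MH A, IsHallMap (InHom T) σ ∧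
      ∀ ⦃X⦄, InFac T X → σ (homFunctor T X) = MH.cls X := by
  classical
  -- outside the image of `Fac T` the values are irrelevant
  let σ : FGModuleCat.{u} (EndOp T) → MH A := fun Y =>
    if h : InHom T Y then MH.cls h.choose else 0
  have hσ : ∀ ⦃X⦄ ⦃Y : FGModuleCat.{u} (EndOp T)⦄, InFac T X →
      Nonempty (homFunctor T X ≃ₗ[EndOp T] Y) → σ Y = MH.cls X := by
    rintro X Y hX ⟨e⟩
    have h : InHom T Y := ⟨X, hX, ⟨e⟩⟩
    obtain ⟨e'⟩ := h.choose_spec.2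
    have h1 : σ Y = MH.cls h.choose := dif_pos h
    rw [h1]
    exact MH.cls_congr (h.choose_spec.1.nonempty_equiv hT hX (e'.trans e.symm))
  have hF : ∀ ⦃X⦄, InFac T X → σ (homFunctor T X) = MH.cls X := fun X hX =>
    hσ hX ⟨LinearEquiv.refl _ _⟩
  have hiso : IsoInvariant σ := by
    rintro Y Y' ⟨e⟩
    by_cases h : InHom T Y
    · obtain ⟨X, hX, ⟨e'⟩⟩ := h
      rw [hσ hX ⟨e'⟩, hσ hX ⟨e'.trans e⟩]
    · have h' : ¬ InHom T Y' := fun h' => h (h'.congr e.symm)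
      have h1 : σ Y = 0 := dif_neg h
      have h2 : σ Y' = 0 := dif_neg h'
      rw [h1, h2]
  refine ⟨σ, ⟨hiso, ?_, ?_, ?_⟩, hF⟩
  · rintro Y Y' ⟨X, hX, ⟨e⟩⟩ ⟨X', hX', ⟨e'⟩⟩
    have h := (hT.multAt_iff MH.isHallMap_cls.congr hiso hF hX hX').1
      (MH.isHallMap_cls.mul trivial trivial)
    rwa [MultAt, Hall.cls_congr ⟨e⟩, Hall.cls_congr ⟨e'⟩, hiso ⟨e⟩, hiso ⟨e'⟩] at h
  · rintro Y ⟨X, hX, ⟨e⟩⟩ hY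
    rw [hσ hX ⟨e⟩]
    exact MH.isUnit_cls (hT.pd1_of_homFunctor hA hX (pd1_congr e.symm hY))
  · rintro Y₁ Y₂ Y₃ f g h ⟨X₁, hX₁, ⟨e₁⟩⟩ - ⟨X₃, hX₃, ⟨e₃⟩⟩ h1
    obtain ⟨L, f', g', h', hL, e⟩ := hT.exists_isSES_of_homFunctor hX₃ hX₁
      ((h.congr_left e₁).congr_right e₃.symm)
    have h2 : PD1 (homFunctor T X₁) := pd1_congr e₁.symm h1
    rw [hσ hX₁ ⟨e₁⟩, hσ hX₃ ⟨e₃⟩, hσ hL e,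
      MH.isHallMap_cls.sub h' trivial trivial trivial (hT.pd1_of_homFunctor hA hX₁ h2),
      ← hT.chi_homFunctor hX₁ hX₃, chi_congr_right h2 e₃,
      chi_congr_left e₁]

end Transfer

section Embedding

theorem exists_embedding_of_char {B : Type u} [Ring B] [Finite B] (p : ℕ) [Fact p.Prime]
    (hp : (p : B) = 0) (hB : HasInjectiveDimensionLE (ModuleCat.of Bᵐᵒᵖ B) 1)
    (N : FGModuleCat.{u} B) :
    ∃ (I : FGModuleCat.{u} B) (i : N →ₗ[B] I), PD1 I ∧ Function.Injective i := by
  let : Algebra (ZMod p) B := ZMod.algebra' B (ringChar B) (ringChar.dvd hp)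
  exact exists_embedding_pd1 hB (ZMod p) N

end Embedding

section EulerForm

variable {k : Type v} [Field k] [Finite k] {A : Type u} [Ring A] [Algebra k A] [Finite A]

theorem zpow_eulerForm (K M : FGModuleCat.{u} A) :
    (Nat.card k : ℚ) ^ (-eulerForm k K M) = chi K M := by
  have := finite_ext K M
  have : Finite (K.obj ⟶ M.obj) := Finite.of_equiv _ ModuleCat.homEquiv.symm
  have h1 : Nat.card (K →ₗ[A] M) = Nat.card k ^ Module.finrank k (K.obj ⟶ M.obj) := by
    rw [← Module.natCard_eq_pow_finrank (K := k) (V := (K.obj ⟶ M.obj))]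
    exact (Nat.card_congr ModuleCat.homEquiv).symm
  have h2 : Nat.card (Ext K.obj M.obj 1) = Nat.card k ^ Module.finrank k (Ext K.obj M.obj 1) :=
    Module.natCard_eq_pow_finrank
  have hk : (Nat.card k : ℚ) ≠ 0 := Nat.cast_ne_zero.2 Nat.card_pos.ne'
  rw [chi, h1, h2, eulerForm, neg_sub, zpow_sub₀ hk, zpow_natCast, zpow_natCast, Nat.cast_pow,
    Nat.cast_pow]

end EulerForm

/-- The two algebra maps are built on generators from the two extension theorems, and their
composites are the identity because they are so on `Fac T` and on its image. -/
theorem IsTilting.exists_algEquiv {A : Type u} [Ring A] [Finite A] {T : FGModuleCat.{u} A}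
    (hT : IsTilting T) (hA : HasInjectiveDimensionLE (ModuleCat.of A A) 1)
    (hΓ : HasInjectiveDimensionLE (ModuleCat.of (EndOp T) (EndOp T)) 1)
    (hE : ∀ N : FGModuleCat.{u} A, ∃ (I : FGModuleCat.{u} A) (i : N →ₗ[A] I),
      PD1 I ∧ Function.Injective i)
    (hE' : ∀ N : FGModuleCat.{u} (EndOp T), ∃ (I : FGModuleCat.{u} (EndOp T))
      (i : N →ₗ[EndOp T] I), PD1 I ∧ Function.Injective i) :
    ∃ Ξ : MH A ≃ₐ[ℚ] MH (EndOp T), ∀ ⦃M X T' : FGModuleCat.{u} A⦄ ⦃f : M →ₗ[A] X⦄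
      ⦃g : X →ₗ[A] T'⦄, IsSES f g → InFac T X → InAdd T T' →
      MH.cls (homFunctor T T') * Ξ (MH.cls M) = chi T' M • MH.cls (homFunctor T X) := by
  have hρ := hT.isHallMap_homFunctor
  obtain ⟨ξ, hξ⟩ := hρ.exists_extendsFac hT
  obtain ⟨Ξ, hΞ⟩ := (hξ.isHallMap hT hρ hA hE).exists_algHom
  have hY := hT.isResolvingFree
  obtain ⟨σ, hσ, hσF⟩ := hT.exists_isHallMap_inHom hA
  have hE₂ : ∀ N : FGModuleCat.{u} (EndOp T), ∃ (P X : FGModuleCat.{u} (EndOp T))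
      (f : P →ₗ[EndOp T] X) (g : X →ₗ[EndOp T] N),
      Module.Projective (EndOp T) P ∧ InHom T X ∧ IsSES f g := fun N => by
    obtain ⟨P, G, Q, C, f, g, j, c, hP, hQ, h, hj⟩ := exists_isSES_of_embedding hE' N
    exact ⟨P, G, f, g, hP, hY.sub j hj.1 (hY.proj hQ), h⟩
  obtain ⟨ζ, hζ⟩ := hσ.exists_extendsSub hY hE₂
  obtain ⟨Θ, hΘ⟩ := (hζ.isHallMap hY hσ hE₂ hΓ).exists_algHom
  have hΘF : ∀ {X}, InFac T X → Θ (MH.cls (homFunctor T X)) = MH.cls X := fun hX => by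
    rw [hΘ, hζ.eq hY hσ (inHom_homFunctor hX), hσF hX]
  have hΞF : ∀ {Y}, InHom T Y → Ξ (σ Y) = MH.cls Y := by
    rintro Y ⟨X, hX, e⟩
    rw [← hσ.congr e, hσF hX, hΞ, hξ.eq hρ hX, MH.cls_congr e]
  have h1 : Θ.comp Ξ = AlgHom.id ℚ (MH A) := by
    refine MH.algHom_ext fun M => ?_
    obtain ⟨X, T', f, g, hX, hT', h⟩ := hT.exists_fac M
    have e := congrArg Θ (hξ h hX hT')
    rw [map_mul, map_smul, hΘF hX, hΘF hT'.inFac,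
      ← MH.cls_mul_cls_of_isSES h (hT.pd1 hT')] at e
    rw [AlgHom.comp_apply, hΞ]
    exact (MH.isUnit_cls (hT.pd1 hT')).mul_left_cancel e
  have h2 : Ξ.comp Θ = AlgHom.id ℚ (MH (EndOp T)) := by
    refine MH.algHom_ext fun N => ?_
    obtain ⟨P, X, f, g, hP, hX, h⟩ := hE₂ N
    have e := congrArg Ξ (hζ h hP hX)
    rw [map_mul, map_smul, hΞF hX, hΞF (hY.proj hP),
      ← MH.isHallMap_cls.sub h trivial trivial trivial pd1_of_projective] at e
    rw [AlgHom.comp_apply, hΘ]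
    exact (MH.isUnit_cls pd1_of_projective).mul_left_cancel e
  refine ⟨AlgEquiv.ofAlgHom Ξ Θ h2 h1, fun M X T' f g h hX hT' => ?_⟩
  change _ * Ξ (MH.cls M) = _
  rw [hΞ]
  exact hξ h hX hT'

end RingelHall

theorem theoremD {k : Type v} [Field k] [Finite k] {A : Type u} [Ring A] [Algebra k A]
    [Module.Finite k A] [Finite A] (hA : RingelHall.IsOneGorenstein A)
    (T : FGModuleCat.{u} A) (hT : RingelHall.IsTilting T)
    (hΓ : RingelHall.IsOneGorenstein (RingelHall.EndOp T)) :
    (∀ M : FGModuleCat.{u} A, ∃ (X T' : FGModuleCat.{u} A) (f : M →ₗ[A] X) (g : X →ₗ[A] T'),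
      RingelHall.InFac T X ∧ RingelHall.InAdd T T' ∧ RingelHall.IsSES f g) ∧
    ∃ Ξ : RingelHall.MH A ≃ₐ[ℚ] RingelHall.MH (RingelHall.EndOp T),
      ∀ (M X T' : FGModuleCat.{u} A) (f : M →ₗ[A] X) (g : X →ₗ[A] T'),
        RingelHall.InFac T X → RingelHall.InAdd T T' → RingelHall.IsSES f g →
        IsUnit (RingelHall.MH.cls (RingelHall.homFunctor T T')) ∧
        Ξ (RingelHall.MH.cls M) =
          ((Nat.card k : ℚ) ^ (-RingelHall.eulerForm k T' M)) •
            (Ring.inverse (RingelHall.MH.cls (RingelHall.homFunctor T T')) *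
              RingelHall.MH.cls (RingelHall.homFunctor T X)) := by
  refine ⟨hT.exists_fac, ?_⟩
  -- the embedding theorem is applied over the prime field, which acts on `A` and on `End(T)ᵒᵖ`
  have hk : (ringChar k).Prime := CharP.char_is_prime k _
  have : Fact (ringChar k).Prime := ⟨hk⟩
  have hp : ((ringChar k : ℕ) : A) = 0 := by
    rw [← map_natCast (algebraMap k A), ringChar.Nat.cast_ringChar, map_zero]
  have hp' : ((ringChar k : ℕ) : RingelHall.EndOp T) = 0 := by
    have : ((ringChar k : ℕ) : Module.End A T) = 0 := LinearMap.ext fun x => by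
      rw [Module.End.natCast_apply, ← Nat.cast_smul_eq_nsmul A, hp, zero_smul,
        LinearMap.zero_apply]
    rw [← MulOpposite.op_natCast, this, MulOpposite.op_zero]
  obtain ⟨Ξ, hΞ⟩ := hT.exists_algEquiv hA.left hΓ.left
    (RingelHall.exists_embedding_of_char _ hp hA.right)
    (RingelHall.exists_embedding_of_char _ hp' hΓ.right)
  refine ⟨Ξ, fun M X T' f g hX hT' h => ?_⟩
  have hu : IsUnit (RingelHall.MH.cls (RingelHall.homFunctor T T')) :=
    RingelHall.MH.isUnit_cls (hT.pd1_homFunctor hT'.inFac (hT.pd1 hT'))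
  refine ⟨hu, hu.mul_left_cancel ?_⟩
  rw [hΞ h hX hT', RingelHall.zpow_eulerForm, mul_smul_comm, Ring.mul_inverse_cancel_left _ _ hu]
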